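/- Let $R>0$, $b\ge 0$, $\beta\le 0$, and let $\mathcal B=\{x\in\mathbb R^2:|x|<R\}$, $\mathbf A(x)=\tfrac12(-x_2,x_1)$. Let $\mathsf H_{\mathcal B}^{\beta,b}$ be the magnetic Robin Laplacian on $\mathcal B$, i.e. the self-adjoint operator in $L^2(\mathcal B)$ associated with the closed, semi-bounded quadratic form $$\mathfrak q_{\mathcal B}^{\beta,b}[u]=\|(\nabla-\mathsf i b\mathbf A)u\|^2_{L^2(\mathcal B;\mathbb C^2)}+\beta\,\|u|_{\partial\mathcal B}\|^2_{L^2(\partial\mathcal B)},\qquad \mathrm{dom}\,\mathfrak q_{\mathcal B}^{\beta,b}=H^1(\mathcal B),$$ and let $$\lambda_1^{\beta,b}(\mathcal B)=\inf_{u\in H^1(\mathcal B)\setminus\{0\}}\frac{\mathfrak q_{\mathcal B}^{\beta,b}[u]}{\|u\|^2_{L^2(\mathcal B)}}.$$ For $m\in\mathbb Z$ let $\mathsf H_{m,R}^{\beta,b}$ be the self-adjoint fiber operator in $L^2((0,R);r\,dr)$ associated with the form $$\mathfrak q_{m,R}^{\beta,b}[f]=\int_0^R\Big(|f'(r)|^2+\frac1{r^2}\Big(m-\frac{br^2}2\Big)^2|f(r)|^2\Big)r\,dr+\beta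 R|f(R)|^2,$$ $$\mathrm{dom}\,\mathfrak q_{m,R}^{\beta,b}=\{f: f,\ f',\ mr^{-1}f\in L^2((0,R);r\,dr)\},$$ and let $$\mu_{1,m}^{\beta,b}(R)=\inf_{f\in\mathrm{dom}\,\mathfrak q_{m,R}^{\beta,b}\setminus\{0\}}\frac{\mathfrak q_{m,R}^{\beta,b}[f]}{\int_0^R|f|^2r\,dr}.$$ Then the number $\lambda_1^{\beta,b}(\mathcal B)$ is the lowest eigenvalue of $\mathsf H_{\mathcal B}^{\beta,b}$, and the following hold. (i) There exists $m_\star=m_\star(\beta,b,R)\in\mathbb Z$ with $|m_\star|\le bR^2$ such that $\mu_{1,m_\star}^{\beta,b}(R)$ is the lowest eigenvalue of $\mathsf H_{m_\star,R}^{\beta,b}$ and $$\lambda_1^{\beta,b}(\mathcal B)=\mu_{1,m_\star}^{\beta,b}(R).$$ (ii) If $bR^2<1$, then $\mathsf H_{\mathcal B}^{\beta,b}$ has a radial eigenfunction, i.e. one of the form $u(x)=f(|x|)$, corresponding to its lowest eigenvalue $\lambda_1^{\beta,b}(\mathcal B)$. -/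

import Mathlib

open MeasureTheory Filter Topology
open scoped ContDiff ComplexConjugate

noncomputable section

namespace MagneticRobin

/-! The plane `ℝ²` is identified with `ℂ`: `x = (x₁, x₂)` is the complex number with real part `x₁`
and imaginary part `x₂`; the norm is the Euclidean one, `volume` is the planar Lebesgue measure, and
the coordinate directions are `e₁ = 1` and `e₂ = Complex.I`.

Elements of `L²` are represented by functions; all notions on the disk depend only on the class
of a function modulo equality almost everywhere. -/

/-- The Lebesgue measure on the open disk of radius `R` centred at the origin. -/
def diskMeasure (R : ℝ) : Measure ℂ := volume.restrict (Metric.ball (0 : ℂ) R)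

/-- `w` is the weak derivative of `u` on the disk of radius `R` in the direction `e`:
`∫ u ∂ₑφ = - ∫ w φ` for all test functions `φ ∈ C_c^∞` of the disk. -/
def HasWeakDeriv (R : ℝ) (e : ℂ) (u w : ℂ → ℂ) : Prop :=
  ∀ φ : ℂ → ℂ, ContDiff ℝ ∞ φ → HasCompactSupport φ → tsupport φ ⊆ Metric.ball (0 : ℂ) R →
    ∫ x, u x * fderiv ℝ φ x e ∂(diskMeasure R) = -∫ x, w x * φ x ∂(diskMeasure R)

/-- The Sobolev space `H¹` of the disk: functions in `L²` whose two first order weak partial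
derivatives exist in `L²`. -/
def MemH1 (R : ℝ) (u : ℂ → ℂ) : Prop :=
  MemLp u 2 (diskMeasure R) ∧
    (∃ w, MemLp w 2 (diskMeasure R) ∧ HasWeakDeriv R 1 u w) ∧
    (∃ w, MemLp w 2 (diskMeasure R) ∧ HasWeakDeriv R Complex.I u w)

open Classical in
/-- The weak derivative in `L²` of `u` in the direction `e` (unique almost everywhere on the disk);
it is set to `0` if there is none. -/
def weakDeriv (R : ℝ) (e : ℂ) (u : ℂ → ℂ) : ℂ → ℂ :=
  if h : ∃ w, MemLp w 2 (diskMeasure R) ∧ HasWeakDeriv R e u w then h.choose else 0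

/-- The measure `dθ` on `(0, 2π]`, the parameter interval of the boundary circle. -/
def angleMeasure : Measure ℝ := volume.restrict (Set.Ioc 0 (2 * Real.pi))

/-- `g` is the boundary trace of `u`, written as a function of the polar angle: the trace map is the
continuous extension to `H¹` of the restriction `φ ↦ φ|_{∂B}` of functions smooth up to the
boundary, i.e. there are smooth `φₙ` that converge to `u` in `H¹` of the disk and whose
restrictions to the boundary circle `θ ↦ R e^{iθ}` converge to `g` in `L²`. -/
def IsTrace (R : ℝ) (u : ℂ → ℂ) (g : ℝ → ℂ) : Prop :=
  MemLp g 2 angleMeasure ∧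
    ∃ φ : ℕ → ℂ → ℂ, (∀ n, ContDiff ℝ ∞ (φ n)) ∧
      Tendsto (fun n => eLpNorm (fun x => φ n x - u x) 2 (diskMeasure R)) atTop (𝓝 0) ∧
      Tendsto (fun n => eLpNorm (fun x => fderiv ℝ (φ n) x 1 - weakDeriv R 1 u x) 2
        (diskMeasure R)) atTop (𝓝 0) ∧
      Tendsto (fun n => eLpNorm (fun x => fderiv ℝ (φ n) x Complex.I - weakDeriv R Complex.I u x) 2
        (diskMeasure R)) atTop (𝓝 0) ∧
      Tendsto (fun n => eLpNorm (fun θ => φ n (circleMap 0 R θ) - g θ) 2 angleMeasure) atTop (𝓝 0)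

open Classical in
/-- The boundary trace of `u` as a function of the polar angle; it exists and is unique almost
everywhere for every `u` in `H¹` of a disk of positive radius. -/
def trace (R : ℝ) (u : ℂ → ℂ) : ℝ → ℂ :=
  if h : ∃ g, IsTrace R u g then h.choose else 0

/-- First component of `(∇ - i b A) u`, where `A(x) = (-x₂, x₁) / 2`. -/
def magD1 (b R : ℝ) (u : ℂ → ℂ) (x : ℂ) : ℂ :=
  weakDeriv R 1 u x - Complex.I * b * ((-x.im / 2 : ℝ) : ℂ) * u x

/-- Second component of `(∇ - i b A) u`, where `A(x) = (-x₂, x₁) / 2`. -/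
def magD2 (b R : ℝ) (u : ℂ → ℂ) (x : ℂ) : ℂ :=
  weakDeriv R Complex.I u x - Complex.I * b * ((x.re / 2 : ℝ) : ℂ) * u x

/-- The quadratic form `‖(∇ - i b A) u‖² + β ‖u|_{∂B}‖²` of the magnetic Robin Laplacian on the
disk, with form domain `H¹`; the arc length on the boundary is `R dθ`. -/
def form (β b R : ℝ) (u : ℂ → ℂ) : ℝ :=
  (∫ x, (‖magD1 b R u x‖ ^ 2 + ‖magD2 b R u x‖ ^ 2) ∂(diskMeasure R))
    + β * ∫ θ, ‖trace R u θ‖ ^ 2 * R ∂angleMeasure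

/-- The sesquilinear form (antilinear in the second argument) belonging to `form`. -/
def sesqForm (β b R : ℝ) (u v : ℂ → ℂ) : ℂ :=
  (∫ x, (magD1 b R u x * conj (magD1 b R v x) + magD2 b R u x * conj (magD2 b R v x))
      ∂(diskMeasure R))
    + β * ∫ θ, trace R u θ * conj (trace R v θ) * R ∂angleMeasure

/-- The graph of the magnetic Robin Laplacian `H` on the disk, the operator associated with the form:
`u ∈ dom H` and `H u = w` iff `u ∈ H¹`, `w ∈ L²` and `q[u, v] = (w, v)` for all `v ∈ H¹`. -/
def RobinLaplacian (β b R : ℝ) (u w : ℂ → ℂ) : Prop :=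
  MemH1 R u ∧ MemLp w 2 (diskMeasure R) ∧
    ∀ v, MemH1 R v → sesqForm β b R u v = ∫ x, w x * conj (v x) ∂(diskMeasure R)

/-- `u` is an eigenfunction of the magnetic Robin Laplacian on the disk with eigenvalue `lam`. -/
def IsEigenfunction (β b R lam : ℝ) (u : ℂ → ℂ) : Prop :=
  ¬ u =ᵐ[diskMeasure R] 0 ∧ RobinLaplacian β b R u (fun x => (lam : ℂ) * u x)

/-- The set of eigenvalues of the magnetic Robin Laplacian on the disk. -/
def eigenvalues (β b R : ℝ) : Set ℝ := {lam | ∃ u, IsEigenfunction β b R lam u}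

/-- `λ₁^{β,b}(B_R)`, the infimum of the Rayleigh quotient over nonzero `u ∈ H¹`. -/
def lambda1 (β b R : ℝ) : ℝ :=
  sInf {t | ∃ u, MemH1 R u ∧ ¬ u =ᵐ[diskMeasure R] 0 ∧
    t = form β b R u / ∫ x, ‖u x‖ ^ 2 ∂(diskMeasure R)}

/-- The measure `r dr` on `(0, R)`. -/
def radialMeasure (R : ℝ) : Measure ℝ :=
  (volume.restrict (Set.Ioo 0 R)).withDensity (fun r => ENNReal.ofReal r)

/-- The domain `{f : f, f', m f / r ∈ L²((0,R); r dr)}` of the fiber form with angular momentum `m`.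
As usual in one dimension, a weakly differentiable `f` is represented by its locally absolutely
continuous version on `(0, R]`, whose almost everywhere derivative is the weak derivative. -/
def MemFiberDom (m : ℤ) (R : ℝ) (f : ℝ → ℂ) : Prop :=
  (∀ ε ∈ Set.Ioo 0 R, AbsolutelyContinuousOnInterval f ε R) ∧
    MemLp f 2 (radialMeasure R) ∧
    MemLp (deriv f) 2 (radialMeasure R) ∧
    MemLp (fun r => ((m / r : ℝ) : ℂ) * f r) 2 (radialMeasure R)

/-- The fiber form
`∫₀ᴿ (|f'|² + r⁻² (m - b r² / 2)² |f|²) r dr + β R |f(R)|²`. -/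
def fiberForm (β b : ℝ) (m : ℤ) (R : ℝ) (f : ℝ → ℂ) : ℝ :=
  (∫ r, (‖deriv f r‖ ^ 2 + 1 / r ^ 2 * (m - b * r ^ 2 / 2) ^ 2 * ‖f r‖ ^ 2) ∂(radialMeasure R))
    + β * R * ‖f R‖ ^ 2

/-- The sesquilinear form (antilinear in the second argument) belonging to `fiberForm`. -/
def fiberSesqForm (β b : ℝ) (m : ℤ) (R : ℝ) (f g : ℝ → ℂ) : ℂ :=
  (∫ r, (deriv f r * conj (deriv g r)
      + ((1 / r ^ 2 * (m - b * r ^ 2 / 2) ^ 2 : ℝ) : ℂ) * (f r * conj (g r))) ∂(radialMeasure R))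
    + β * R * (f R * conj (g R))

/-- The graph of the fiber operator associated with the fiber form in `L²((0,R); r dr)`. -/
def FiberOperator (β b : ℝ) (m : ℤ) (R : ℝ) (f h : ℝ → ℂ) : Prop :=
  MemFiberDom m R f ∧ MemLp h 2 (radialMeasure R) ∧
    ∀ g, MemFiberDom m R g →
      fiberSesqForm β b m R f g = ∫ r, h r * conj (g r) ∂(radialMeasure R)

/-- The set of eigenvalues of the fiber operator with angular momentum `m`. -/
def fiberEigenvalues (β b : ℝ) (m : ℤ) (R : ℝ) : Set ℝ :=
  {lam | ∃ f, ¬ f =ᵐ[radialMeasure R] 0 ∧ FiberOperator β b m R f (fun r => (lam : ℂ) * f r)}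

/-- `μ_{1,m}^{β,b}(R)`, the infimum of the Rayleigh quotient of the fiber form. -/
def mu1 (β b : ℝ) (m : ℤ) (R : ℝ) : ℝ :=
  sInf {t | ∃ f, MemFiberDom m R f ∧ ¬ f =ᵐ[radialMeasure R] 0 ∧
    t = fiberForm β b m R f / ∫ r, ‖f r‖ ^ 2 ∂(radialMeasure R)}

end MagneticRobin

end

noncomputable section

namespace MagneticRobin

/-! The vector potential is rotation invariant, so in polar coordinates the magnetic Robin form
decouples over the angular modes `exp (i k θ)`. If `a_k(r)` are the Fourier coefficients of `u` on
the circle of radius `r`, Parseval on each circle turns the disk form into `2π` times the sum of the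
fiber forms of the `a_k` (`hasSum_fiberForm`), and the squared norm into the corresponding sum. A
common lower bound for all fibers is thus a lower bound on the disk. Conversely, a ground state `f`
of a fiber `m` gives the planar function `f(r) exp (i m θ)` with the same Rayleigh quotient.

Only finitely many fibers compete. The potential of fiber `k` exceeds that of fiber `0` by `k (k - b
r²) / r²`, which is nonnegative on `(0, R)` unless `0 < k < b R²` (`fiberForm_zero_le`). The minimum
is therefore attained at some natural number `m ≤ b R²`; if `b R² < 1`, this forces `m = 0`, and the
planar ground state is radial.

Existence of ground states is obtained without compactness, from explicit solutions. Writing `f r =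
r ^ m g(r²)` for `m ≥ 0` turns the fiber equation with eigenvalue `κ - m b` into `4 s g'' + 4 (m +
1) g' = (b² s / 4 - κ) g`, whose solution with `g 0 = 1` is an entire power series, jointly
continuous in `κ` and `s`. A shooting argument in `κ` (`exists_shooting`) finds a solution that is
positive on `[0, R²]` and satisfies the Robin condition. Its logarithmic derivative `ρ = r f' / f`
solves a Riccati equation, and Picone's inequality (`picone`), a completion of squares, shows that
`κ - m b` bounds the fiber form from below. Equality holds for `f` itself (`fiberForm_shooting`).

On the disk, the lower bound is first proved for functions smooth up to the boundary and then
extended to `H¹` by density (`MemH1.exists_smooth_approx`) and the trace inequality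
(`trace_inequality`). Finally, a minimizer of a Rayleigh quotient is an eigenfunction for the least
eigenvalue, because a null vector of a nonnegative form lies in its kernel (`fiber_isLeast`,
`disk_isLeast`). -/

/-! ### Power series with coefficients of exponential type -/

/-- The sum of the power series with coefficients `a`. -/
def pser (a : ℕ → ℝ) (s : ℝ) : ℝ := ∑' k, a k * s ^ k

/-- The coefficients of the derivative of a power series. -/
def dcoeff (a : ℕ → ℝ) (k : ℕ) : ℝ := (k + 1) * a (k + 1)

/-- Coefficients of exponential type. -/
def ExpBound (C M : ℝ) (a : ℕ → ℝ) : Prop := ∀ k, |a k| ≤ C * (M ^ k / k.factorial)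

lemma ExpBound.dcoeff {C M : ℝ} {a : ℕ → ℝ} (h : ExpBound C M a) :
    ExpBound (C * M) M (dcoeff a) := by
  intro k
  have hk : (0 : ℝ) < k + 1 := by positivity
  have h1 := h (k + 1)
  rw [MagneticRobin.dcoeff, abs_mul, abs_of_pos hk]
  calc (k + 1 : ℝ) * |a (k + 1)| ≤ (k + 1) * (C * (M ^ (k + 1) / (k + 1).factorial)) := by gcongr
    _ = C * M * (M ^ k / k.factorial) := by
      rw [Nat.factorial_succ]; push_cast
      have : (k.factorial : ℝ) ≠ 0 := by positivity
      field_simp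
      ring

lemma ExpBound.norm_le {C M B : ℝ} {a : ℕ → ℝ} (h : ExpBound C M a) {s : ℝ} (hs : |s| ≤ B) (k : ℕ) :
    ‖a k * s ^ k‖ ≤ C * ((M * B) ^ k / k.factorial) := by
  rw [Real.norm_eq_abs, abs_mul, abs_pow]
  calc |a k| * |s| ^ k ≤ C * (M ^ k / k.factorial) * B ^ k := by
        gcongr
        · exact (abs_nonneg _).trans (h k)
        · exact h k
    _ = _ := by rw [mul_pow]; ring

lemma ExpBound.summable {C M : ℝ} {a : ℕ → ℝ} (h : ExpBound C M a) (s : ℝ) :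
    Summable fun k => a k * s ^ k :=
  Summable.of_norm_bounded ((Real.summable_pow_div_factorial (M * |s|)).mul_left C)
    (h.norm_le le_rfl)

/-- Termwise differentiation on the ball of radius `|s| + 1`, where the differentiated terms are
dominated by an exponential series. -/
lemma ExpBound.hasDerivAt {C M : ℝ} {a : ℕ → ℝ} (h : ExpBound C M a) (s : ℝ) :
    HasDerivAt (pser a) (pser (MagneticRobin.dcoeff a) s) s := by
  set B := |s| + 1
  have hsum : Summable fun k : ℕ => (k : ℝ) * (C * (M ^ k / k.factorial)) * B ^ (k - 1) := by
    rw [← summable_nat_add_iff 1]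
    refine ((Real.summable_pow_div_factorial (M * B)).mul_left (C * M)).congr fun k => ?_
    rw [Nat.factorial_succ, mul_pow]; push_cast
    have : (k.factorial : ℝ) ≠ 0 := by positivity
    field_simp
    ring
  have key := hasDerivAt_tsum_of_isPreconnected (𝕜 := ℝ) (F := ℝ)
    (g := fun k y => a k * y ^ k) (g' := fun k y => a k * (k * y ^ (k - 1)))
    (t := Metric.ball 0 B) (y₀ := s) (y := s) hsum Metric.isOpen_ball
    (convex_ball _ _).isPreconnected (fun n y _ => (hasDerivAt_pow n y).const_mul _)
    (fun n y hy => by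
      have hy' : |y| ≤ B := by simpa using (Metric.mem_ball.1 hy).le
      rw [Real.norm_eq_abs, abs_mul, abs_mul, abs_pow, Nat.abs_cast]
      have := h n
      have h0 : 0 ≤ C * (M ^ n / n.factorial) := (abs_nonneg _).trans this
      calc |a n| * (n * |y| ^ (n - 1)) ≤ C * (M ^ n / n.factorial) * (n * B ^ (n - 1)) := by gcongr
        _ = _ := by ring) (by simp [B]) (h.summable s) (by simp [B])
  refine HasDerivAt.congr_deriv key ?_
  rw [Summable.tsum_eq_zero_add (f := fun k => a k * (k * s ^ (k - 1)))]
  · simp [MagneticRobin.dcoeff, pser]; congr 1; ext k; ring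
  · rw [← summable_nat_add_iff 1]
    refine (h.dcoeff.summable s).congr fun k => ?_
    simp [MagneticRobin.dcoeff]; ring

/-- The bound is stable under differentiation of the series up to its constant, so the induction on
the order runs over all `C` and `a` at once. -/
lemma ExpBound.contDiff {C M : ℝ} {a : ℕ → ℝ} (h : ExpBound C M a) : ContDiff ℝ ∞ (pser a) := by
  refine contDiff_infty.2 fun n => ?_
  induction n generalizing C a with
  | zero =>
    exact contDiff_zero.2 (continuous_iff_continuousAt.2 fun s => (h.hasDerivAt s).continuousAt)
  | succ n ih =>
    push_cast
    refine contDiff_succ_iff_deriv.2 ⟨fun s => (h.hasDerivAt s).differentiableAt, by simp, ?_⟩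
    rw [show deriv (pser a) = pser (MagneticRobin.dcoeff a) from
      funext fun s => (h.hasDerivAt s).deriv]
    exact ih h.dcoeff

/-! ### The regular solution of the radial equation -/

/-- The coefficients of the solution of `4 s g'' + 4 (m + 1) g' = (e s - κ) g`, `g 0 = 1`. -/
def kcoeff (e : ℝ) (m : ℕ) (κ : ℝ) : ℕ → ℝ
  | 0 => 1
  | 1 => -κ / (4 * (m + 1))
  | k + 2 => (e * kcoeff e m κ k - κ * kcoeff e m κ (k + 1)) / (4 * (k + 2) * (k + 2 + m))

/-- The two-term recursion divides by at least `(k + 2)²`, which pays for the factorial, and `M = 1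
+ Λ + e` satisfies `e + Λ M ≤ M²`, which pays for the numerator. The bound depends on `κ` only
through `Λ`, as needed for continuity in `κ`. -/
lemma kcoeff_bound {e Λ : ℝ} (he : 0 ≤ e) (m : ℕ) {κ : ℝ} (hκ : |κ| ≤ Λ) :
    ExpBound 1 (1 + Λ + e) (kcoeff e m κ) := by
  have hΛ : 0 ≤ Λ := (abs_nonneg _).trans hκ
  set M := 1 + Λ + e with hM
  have hM0 : 0 < M := by positivity
  have main : ∀ k, |kcoeff e m κ k| ≤ M ^ k / k.factorial ∧
      |kcoeff e m κ (k + 1)| ≤ M ^ (k + 1) / (k + 1).factorial := by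
    intro k
    induction k with
    | zero =>
      refine ⟨by simp [kcoeff], ?_⟩
      have : (1 : ℝ) ≤ 4 * (m + 1) := by nlinarith [(Nat.cast_nonneg m : (0 : ℝ) ≤ m)]
      simp only [zero_add, kcoeff, abs_div, abs_neg, pow_one, Nat.factorial_one, Nat.cast_one,
        div_one]
      rw [abs_of_pos (by positivity : (0 : ℝ) < 4 * (m + 1))]
      exact (div_le_self (abs_nonneg _) this).trans (by linarith)
    | succ k ih =>
      refine ⟨ih.2, ?_⟩
      have hden : (k + 2 : ℝ) * (k + 2) ≤ 4 * (k + 2) * (k + 2 + m) := by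
        nlinarith [(Nat.cast_nonneg m : (0 : ℝ) ≤ m), (Nat.cast_nonneg k : (0 : ℝ) ≤ k),
          mul_nonneg (Nat.cast_nonneg k : (0 : ℝ) ≤ k) (Nat.cast_nonneg m : (0 : ℝ) ≤ m)]
      have hnum : |e * kcoeff e m κ k - κ * kcoeff e m κ (k + 1)| ≤
          e * (M ^ k / k.factorial) + Λ * (M ^ (k + 1) / (k + 1).factorial) := by
        refine (abs_sub _ _).trans ?_
        rw [abs_mul, abs_mul, abs_of_nonneg he]
        gcongr
        exacts [ih.1, ih.2]
      have hfac : ((k + 2).factorial : ℝ) = (k + 2) * ((k + 1) * k.factorial) := by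
        rw [Nat.factorial_succ, Nat.factorial_succ]; push_cast; ring
      have hfac1 : ((k + 1).factorial : ℝ) = (k + 1) * k.factorial := by
        rw [Nat.factorial_succ]; push_cast; ring
      have hf : (0 : ℝ) < k.factorial := by positivity
      rw [kcoeff, abs_div, abs_of_pos (by positivity : (0 : ℝ) < 4 * (k + 2) * (k + 2 + m)),
        div_le_iff₀ (by positivity)]
      refine hnum.trans ?_
      rw [hfac1, show k + 1 + 1 = k + 2 from rfl, hfac]
      have h1 : e * (M ^ k / k.factorial) + Λ * (M ^ (k + 1) / ((k + 1) * k.factorial)) ≤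
          M ^ (k + 2) / k.factorial := by
        have : M ^ (k + 1) / ((k + 1) * k.factorial) ≤ M ^ (k + 1) / k.factorial := by
          gcongr
          nlinarith [(Nat.cast_nonneg k : (0 : ℝ) ≤ k)]
        calc e * (M ^ k / k.factorial) + Λ * (M ^ (k + 1) / ((k + 1) * k.factorial))
            ≤ e * (M ^ k / k.factorial) + Λ * (M ^ (k + 1) / k.factorial) := by gcongr
          _ = (e + Λ * M) * (M ^ k / k.factorial) := by ring
          _ ≤ M ^ 2 * (M ^ k / k.factorial) := by
            gcongr
            nlinarith
          _ = _ := by ring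
      refine h1.trans ?_
      calc M ^ (k + 2) / k.factorial
          ≤ M ^ (k + 2) / ((k + 2) * ((k + 1) * k.factorial)) * ((k + 2) * (k + 2)) := by
            rw [div_mul_eq_mul_div, div_le_div_iff₀ (by positivity) (by positivity)]
            have : 0 ≤ M ^ (k + 2) * k.factorial := by positivity
            have h3 : (0:ℝ) ≤ k := Nat.cast_nonneg k
            have h2 : (k + 2 : ℝ) * (k + 1) ≤ (k + 2) * (k + 2) := by nlinarith
            nlinarith [mul_le_mul_of_nonneg_left h2 this]
        _ ≤ _ := by gcongr
  intro k
  rw [one_mul]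
  exact (main k).1

/-- The solution of `4 s g'' + 4 (m + 1) g' = (e s - κ) g` with `g 0 = 1`. -/
def ksol (e : ℝ) (m : ℕ) (κ : ℝ) : ℝ → ℝ := pser (kcoeff e m κ)

/-- The derivative of `ksol`. -/
def ksol' (e : ℝ) (m : ℕ) (κ : ℝ) : ℝ → ℝ := pser (dcoeff (kcoeff e m κ))

/-- The second derivative of `ksol`. -/
def ksol'' (e : ℝ) (m : ℕ) (κ : ℝ) : ℝ → ℝ := pser (dcoeff (dcoeff (kcoeff e m κ)))

section ksol

variable {e : ℝ} (he : 0 ≤ e) (m : ℕ) (κ : ℝ)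

lemma ksol_contDiff (he : 0 ≤ e) : ContDiff ℝ ∞ (ksol e m κ) := (kcoeff_bound he m le_rfl).contDiff

lemma hasDerivAt_ksol (he : 0 ≤ e) (s : ℝ) : HasDerivAt (ksol e m κ) (ksol' e m κ s) s :=
  (kcoeff_bound he m le_rfl).hasDerivAt s

lemma hasDerivAt_ksol' (he : 0 ≤ e) (s : ℝ) : HasDerivAt (ksol' e m κ) (ksol'' e m κ s) s :=
  (kcoeff_bound he m le_rfl).dcoeff.hasDerivAt s

lemma continuous_ksol (he : 0 ≤ e) : Continuous (ksol e m κ) :=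
  continuous_iff_continuousAt.2 fun s => (hasDerivAt_ksol m κ he s).continuousAt

lemma continuous_ksol' (he : 0 ≤ e) : Continuous (ksol' e m κ) :=
  continuous_iff_continuousAt.2 fun s => (hasDerivAt_ksol' m κ he s).continuousAt

lemma ksol_zero : ksol e m κ 0 = 1 := by
  rw [ksol, pser, tsum_eq_single 0]
  · simp [kcoeff]
  · intro k hk; simp [hk]

/-- Comparison of coefficients: the constant term fixes `kcoeff e m κ 1`, and the coefficient of `s
^ (k + 1)` is the recursion. -/
lemma ksol_ode (he : 0 ≤ e) (s : ℝ) :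
    4 * (s * ksol'' e m κ s) + 4 * (m + 1) * ksol' e m κ s = (e * s - κ) * ksol e m κ s := by
  have hb := kcoeff_bound he m (le_refl |κ|)
  have h0 := hb.summable s
  have h1 := hb.dcoeff.summable s
  have h2 := hb.dcoeff.dcoeff.summable s
  have e0 : ksol e m κ s = kcoeff e m κ 0 + ∑' k, kcoeff e m κ (k + 1) * s ^ (k + 1) := by
    rw [ksol, pser, h0.tsum_eq_zero_add]; simp
  have e1 : ksol' e m κ s = kcoeff e m κ 1
      + ∑' k, dcoeff (kcoeff e m κ) (k + 1) * s ^ (k + 1) := by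
    rw [ksol', pser, h1.tsum_eq_zero_add]; simp [dcoeff]
  have e0' : s * ksol e m κ s = ∑' k, kcoeff e m κ k * s ^ (k + 1) := by
    rw [ksol, pser, ← tsum_mul_left]; congr 1; ext k; ring
  have e2' : s * ksol'' e m κ s = ∑' k, dcoeff (dcoeff (kcoeff e m κ)) k * s ^ (k + 1) := by
    rw [ksol'', pser, ← tsum_mul_left]; congr 1; ext k; ring
  have s0 := (summable_nat_add_iff 1).2 h0
  have s1 := (summable_nat_add_iff 1).2 h1
  have s0' : Summable fun k => kcoeff e m κ k * s ^ (k + 1) :=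
    (h0.mul_left s).congr fun k => by ring
  have s2' : Summable fun k => dcoeff (dcoeff (kcoeff e m κ)) k * s ^ (k + 1) :=
    (h2.mul_left s).congr fun k => by ring
  rw [show (e * s - κ) * ksol e m κ s = e * (s * ksol e m κ s) - κ * ksol e m κ s by ring, e0', e2',
    e1, e0, mul_add, mul_add κ, ← tsum_mul_left, ← tsum_mul_left, ← tsum_mul_left, ← tsum_mul_left]
  have c0 : 4 * ((m : ℝ) + 1) * kcoeff e m κ 1 = - κ * kcoeff e m κ 0 := by
    have : (m : ℝ) + 1 ≠ 0 := by positivity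
    simp only [kcoeff]; field_simp
  have hs : (∑' k, 4 * (dcoeff (dcoeff (kcoeff e m κ)) k * s ^ (k + 1)))
      + (∑' k, 4 * ((m : ℝ) + 1) * (dcoeff (kcoeff e m κ) (k + 1) * s ^ (k + 1)))
      = (∑' k, e * (kcoeff e m κ k * s ^ (k + 1)))
        - ∑' k, κ * (kcoeff e m κ (k + 1) * s ^ (k + 1)) := by
    rw [← (s2'.mul_left _).tsum_add (s1.mul_left _), ← (s0'.mul_left _).tsum_sub (s0.mul_left _)]
    congr 1; ext k
    simp only [dcoeff, kcoeff]
    push_cast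
    have h1 : (k : ℝ) + 2 ≠ 0 := by positivity
    have h2 : (k : ℝ) + 2 + m ≠ 0 := by positivity
    field_simp
    ring
  linarith

/-- For `κ ≤ 0` the recursion produces only nonnegative coefficients, and the constant one is `1`.
-/
lemma ksol_pos_of_nonpos (he : 0 ≤ e) (hκ : κ ≤ 0) {s : ℝ} (hs : 0 ≤ s) : 0 < ksol e m κ s := by
  have hpos : ∀ k, 0 ≤ kcoeff e m κ k ∧ 0 ≤ kcoeff e m κ (k + 1) := by
    intro k
    induction k with
    | zero => exact ⟨by simp [kcoeff], by simp only [kcoeff]; have : 0 ≤ -κ := by linarith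
                                          positivity⟩
    | succ k ih =>
      refine ⟨ih.2, ?_⟩
      rw [kcoeff]
      have : 0 ≤ -κ * kcoeff e m κ (k + 1) := mul_nonneg (by linarith) ih.2
      have h2 := mul_nonneg he ih.1
      exact div_nonneg (by linarith) (by positivity)
  have hsum := (kcoeff_bound he m (le_refl |κ|)).summable s
  rw [ksol, pser, hsum.tsum_eq_zero_add]
  have : 0 ≤ ∑' k, kcoeff e m κ (k + 1) * s ^ (k + 1) :=
    tsum_nonneg fun k => mul_nonneg (hpos k).2 (by positivity)
  simp only [kcoeff, pow_zero]
  linarith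

lemma continuous_kcoeff (k : ℕ) : Continuous fun κ => kcoeff e m κ k := by
  have main : ∀ k, (Continuous fun κ => kcoeff e m κ k) ∧
      Continuous fun κ => kcoeff e m κ (k + 1) := by
    intro k
    induction k with
    | zero => exact ⟨by simp only [kcoeff]; fun_prop, by simp only [kcoeff]; fun_prop⟩
    | succ k ih =>
      refine ⟨ih.2, ?_⟩
      simp only [kcoeff]
      have := ih.1; have := ih.2
      fun_prop
  exact (main k).1

/-- Joint continuity by the Weierstrass test: near a given point the series is dominated by one
exponential series, uniformly in both variables. -/
lemma continuous_pser_of_bound {A : ℝ → ℕ → ℝ} (hA : ∀ k, Continuous fun κ => A κ k)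
    (hb : ∀ Λ, ∃ C M, ∀ κ, |κ| ≤ Λ → ExpBound C M (A κ)) :
    Continuous fun p : ℝ × ℝ => pser (A p.1) p.2 := by
  rw [continuous_iff_continuousAt]
  rintro ⟨κ, s⟩
  obtain ⟨C, M, hCM⟩ := hb (|κ| + 1)
  have hU : {p : ℝ × ℝ | |p.1| < |κ| + 1} ∩ {p | |p.2| < |s| + 1} ∈ 𝓝 (κ, s) :=
    ((isOpen_lt continuous_fst.abs continuous_const).inter
      (isOpen_lt continuous_snd.abs continuous_const)).mem_nhds ⟨by simp, by simp⟩
  refine ContinuousOn.continuousAt ?_ hU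
  refine continuousOn_tsum (f := fun k (p : ℝ × ℝ) => A p.1 k * p.2 ^ k)
    (u := fun k => C * ((M * (|s| + 1)) ^ k / k.factorial))
    (fun k => ?_) ((Real.summable_pow_div_factorial _).mul_left C) ?_
  · have h1 : Continuous fun p : ℝ × ℝ => A p.1 k := (hA k).comp continuous_fst
    exact (h1.mul (continuous_snd.pow k)).continuousOn
  · intro k p hp
    exact (hCM p.1 (le_of_lt hp.1)).norm_le (le_of_lt hp.2) k

lemma continuous_ksol_uncurry (he : 0 ≤ e) : Continuous fun p : ℝ × ℝ => ksol e m p.1 p.2 :=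
  continuous_pser_of_bound (continuous_kcoeff m) fun _ => ⟨_, _, fun _ h => kcoeff_bound he m h⟩

lemma continuous_ksol'_uncurry (he : 0 ≤ e) : Continuous fun p : ℝ × ℝ => ksol' e m p.1 p.2 := by
  refine continuous_pser_of_bound (A := fun κ => dcoeff (kcoeff e m κ)) (fun k => ?_)
    fun Λ => ⟨_, _, fun _ h => (kcoeff_bound he m h).dcoeff⟩
  simp only [dcoeff]
  have := continuous_kcoeff (e := e) m (k + 1)
  fun_prop

/-- A solution with vanishing Cauchy data at a positive point vanishes to the left of it, which is
impossible because of its value at `0`. -/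
lemma ksol_cauchy_ne_zero (he : 0 ≤ e) {s₀ : ℝ} (hs₀ : 0 < s₀) (h : ksol e m κ s₀ = 0) :
    ksol' e m κ s₀ ≠ 0 := by
  intro h'
  have hzero : ∀ δ ∈ Set.Ioc 0 s₀, ksol e m κ δ = 0 := by
    intro δ hδ
    set L := (e * s₀ + |κ|) / (4 * δ) with hL
    -- Grönwall constant on `[δ, s₀]`. Solving the equation for `g''`, the derivative of `g² + g'²`
    -- is at least `-K (g² + g'²)`: the summands of `K` absorb `2 g g'`, the zeroth order term and
    -- the damping term respectively. Thus `E` increases up to `E s₀ = 0`.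
    set K := 1 + L + 2 * ((m + 1) / δ) with hK
    have hL0 : 0 ≤ L := by have := hδ.1; positivity
    set E : ℝ → ℝ := fun s => (ksol e m κ s ^ 2 + ksol' e m κ s ^ 2) * Real.exp (K * s) with hE
    have hd : ∀ s, HasDerivAt E ((2 * ksol e m κ s * ksol' e m κ s
        + 2 * ksol' e m κ s * ksol'' e m κ s + K * (ksol e m κ s ^ 2 + ksol' e m κ s ^ 2))
          * Real.exp (K * s)) s := by
      intro s
      have h1 := (hasDerivAt_ksol m κ he s).pow 2
      have h2 := (hasDerivAt_ksol' m κ he s).pow 2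
      have h3 : HasDerivAt (fun s => Real.exp (K * s)) (Real.exp (K * s) * K) s := by
        simpa using ((hasDerivAt_id s).const_mul K).exp
      refine ((h1.add h2).mul h3).congr_deriv ?_
      simp only [Pi.add_apply, Pi.pow_apply]
      push_cast
      ring
    have hmono : MonotoneOn E (Set.Icc δ s₀) := by
      refine monotoneOn_of_deriv_nonneg (convex_Icc _ _)
        (fun s _ => (hd s).continuousAt.continuousWithinAt)
        (fun s _ => (hd s).differentiableAt.differentiableWithinAt) fun s hs => ?_
      rw [interior_Icc] at hs
      rw [(hd s).deriv]
      refine mul_nonneg ?_ (Real.exp_pos _).le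
      have hs0 : 0 < s := hδ.1.trans hs.1
      have ode := ksol_ode m κ he s
      set g := ksol e m κ s
      set g' := ksol' e m κ s
      have hg'' : ksol'' e m κ s = ((e * s - κ) / (4 * s)) * g - ((m + 1) / s) * g' := by
        field_simp
        linarith
      have hc1 : |(e * s - κ) / (4 * s)| ≤ L := by
        rw [abs_div, abs_of_pos (by positivity : (0 : ℝ) < 4 * s), hL]
        gcongr ?_ / ?_
        · have := hδ.1; have := hs.1; positivity
        · refine (abs_sub _ _).trans ?_
          rw [abs_of_nonneg (by positivity)]
          gcongr
          exact hs.2.le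
        · have := hs.1
          linarith
      have hc2 : |((m : ℝ) + 1) / s| ≤ (m + 1) / δ := by
        rw [abs_of_pos (by positivity)]
        have := hδ.1; have := hs.1
        gcongr
      rw [hg'']
      set c1 := (e * s - κ) / (4 * s)
      set c2 := ((m : ℝ) + 1) / s
      have hp : |g * g'| ≤ (g ^ 2 + g' ^ 2) / 2 := by
        rw [abs_le]; constructor <;> nlinarith [sq_nonneg (g + g'), sq_nonneg (g - g')]
      have t1 : -(L * ((g ^ 2 + g' ^ 2) / 2)) ≤ c1 * (g * g') := by
        have : |c1 * (g * g')| ≤ L * ((g ^ 2 + g' ^ 2) / 2) := by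
          rw [abs_mul]; gcongr
        linarith [neg_abs_le (c1 * (g * g'))]
      have t2 : c2 * g' ^ 2 ≤ (m + 1) / δ * (g ^ 2 + g' ^ 2) := by
        have := (le_abs_self c2).trans hc2
        have h3 : 0 ≤ ((m : ℝ) + 1) / δ := by have := hδ.1; positivity
        nlinarith [sq_nonneg g, sq_nonneg g']
      have t3 := neg_abs_le (g * g')
      rw [hK]
      nlinarith [sq_nonneg g, sq_nonneg g']
    have hEs : E s₀ = 0 := by simp [hE, h, h']
    have hle := hmono ⟨le_rfl, hδ.2⟩ ⟨hδ.2, le_rfl⟩ hδ.2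
    rw [hEs] at hle
    have h0 : ksol e m κ δ ^ 2 + ksol' e m κ δ ^ 2 ≤ 0 := by
      by_contra hcon
      push Not at hcon
      exact absurd hle (not_le.2 (mul_pos hcon (Real.exp_pos _)))
    nlinarith [sq_nonneg (ksol e m κ δ), sq_nonneg (ksol' e m κ δ)]
  -- The constant `K` blows up as `δ → 0`, so the singular point itself is reached by continuity
  -- only.
  have hlim : Tendsto (ksol e m κ) (𝓝[>] 0) (𝓝 1) := by
    have := (continuous_ksol m κ he).tendsto 0
    rw [ksol_zero] at this
    exact this.mono_left nhdsWithin_le_nhds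
  have hlim0 : Tendsto (ksol e m κ) (𝓝[>] 0) (𝓝 0) := by
    refine tendsto_const_nhds.congr' ?_
    filter_upwards [Ioc_mem_nhdsGT hs₀] with δ hδ using (hzero δ hδ).symm
  exact one_ne_zero (tendsto_nhds_unique hlim hlim0)

/-- The logarithmic derivative is large when `-κ` is. -/
lemma mul_ksol_le_ksol' (he : 0 ≤ e) {K X : ℝ} (hK : 0 ≤ K) (hX : 0 < X)
    (hκ : κ ≤ -(4 * (K * (m + 1) + K ^ 2 * X))) : K * ksol e m κ X ≤ ksol' e m κ X := by
  have hκ0 : κ ≤ 0 := hκ.trans (by have : 0 ≤ K * (m + 1) + K ^ 2 * X := by positivity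
                                   linarith)
  -- The integrating factor `s ^ (m + 1) exp (K s)` removes `g''` and `g'` from the derivative of
  -- `Z`: by the equation it equals `s ^ m exp (K s) ((e s - κ) / 4 - K (m + 1) - K² s) g`. The
  -- hypothesis on `κ` makes the bracket nonnegative up to `X`, and `Z 0 = 0`.
  set Z : ℝ → ℝ := fun s => s ^ (m + 1) * Real.exp (K * s) * (ksol' e m κ s - K * ksol e m κ s)
  have hd : ∀ s, HasDerivAt Z (((m + 1) * s ^ m * Real.exp (K * s)
      + s ^ (m + 1) * (Real.exp (K * s) * K)) * (ksol' e m κ s - K * ksol e m κ s)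
      + s ^ (m + 1) * Real.exp (K * s) * (ksol'' e m κ s - K * ksol' e m κ s)) s := by
    intro s
    have h3 : HasDerivAt (fun s => Real.exp (K * s)) (Real.exp (K * s) * K) s := by
      simpa using ((hasDerivAt_id s).const_mul K).exp
    refine (((hasDerivAt_pow (m + 1) s).mul h3).mul
      ((hasDerivAt_ksol' m κ he s).sub ((hasDerivAt_ksol m κ he s).const_mul K))).congr_deriv ?_
    push_cast
    simp
  have hmono : MonotoneOn Z (Set.Icc 0 X) := by
    refine monotoneOn_of_deriv_nonneg (convex_Icc _ _)
      (fun s _ => (hd s).continuousAt.continuousWithinAt)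
      (fun s _ => (hd s).differentiableAt.differentiableWithinAt) fun s hs => ?_
    rw [interior_Icc] at hs
    rw [(hd s).deriv]
    have ode := ksol_ode m κ he s
    have hg := ksol_pos_of_nonpos m κ he hκ0 hs.1.le
    have heq : ((m + 1) * s ^ m * Real.exp (K * s)
      + s ^ (m + 1) * (Real.exp (K * s) * K)) * (ksol' e m κ s - K * ksol e m κ s)
      + s ^ (m + 1) * Real.exp (K * s) * (ksol'' e m κ s - K * ksol' e m κ s)
      = s ^ m * Real.exp (K * s) * (((e * s - κ) / 4 - K * (m + 1) - K ^ 2 * s)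
        * ksol e m κ s) := by
      rw [pow_succ]
      linear_combination (s ^ m * Real.exp (K * s) / 4) * ode
    rw [heq]
    have hs0 := hs.1
    refine mul_nonneg (by positivity) (mul_nonneg ?_ hg.le)
    nlinarith [mul_nonneg he hs0.le, mul_le_mul_of_nonneg_left hs.2.le (sq_nonneg K)]
  have := hmono ⟨le_rfl, hX.le⟩ ⟨hX.le, le_rfl⟩ hX.le
  simp only [Z, ne_eq, Nat.add_eq_zero_iff, one_ne_zero, and_false, not_false_eq_true, zero_pow,
    zero_mul] at this
  by_contra hcon
  push Not at hcon
  have hneg : X ^ (m + 1) * Real.exp (K * X) * (ksol' e m κ X - K * ksol e m κ X) < 0 :=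
    mul_neg_of_pos_of_neg (by positivity) (by linarith)
  linarith

end ksol

/-! ### The weighted measure and the fiber form domain -/

lemma integral_radialMeasure {E : Type*} [NormedAddCommGroup E] [NormedSpace ℝ E] (R : ℝ)
    (F : ℝ → E) : ∫ r, F r ∂(radialMeasure R) = ∫ r in Set.Ioo 0 R, r • F r := by
  rw [radialMeasure, integral_withDensity_eq_integral_toReal_smul (by fun_prop) (by simp)]
  refine setIntegral_congr_fun measurableSet_Ioo fun r hr => ?_
  simp only [ENNReal.toReal_ofReal hr.1.le]

lemma integrable_radialMeasure_iff {E : Type*} [NormedAddCommGroup E] [NormedSpace ℝ E] {R : ℝ}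
    {F : ℝ → E} : Integrable F (radialMeasure R) ↔
      IntegrableOn (fun r => r • F r) (Set.Ioo 0 R) := by
  rw [radialMeasure, integrable_withDensity_iff_integrable_smul' (by fun_prop) (by simp)]
  refine integrable_congr ?_
  filter_upwards [ae_restrict_mem measurableSet_Ioo] with r hr
  rw [ENNReal.toReal_ofReal hr.1.le]

lemma radialMeasure_absolutelyContinuous (R : ℝ) :
    radialMeasure R ≪ volume.restrict (Set.Ioo 0 R) :=
  withDensity_absolutelyContinuous _ _

lemma ae_radialMeasure_mem (R : ℝ) : ∀ᵐ r ∂(radialMeasure R), r ∈ Set.Ioo 0 R :=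
  (radialMeasure_absolutelyContinuous R).ae_le (ae_restrict_mem measurableSet_Ioo)

instance (R : ℝ) : IsFiniteMeasure (radialMeasure R) := by
  refine isFiniteMeasure_withDensity_ofReal (Integrable.hasFiniteIntegral ?_)
  exact (continuous_id.integrableOn_Icc).mono_set Set.Ioo_subset_Icc_self

lemma AbsolutelyContinuousOnInterval_re {f : ℝ → ℂ} {a b : ℝ}
    (hf : AbsolutelyContinuousOnInterval f a b) :
    AbsolutelyContinuousOnInterval (fun r => (f r).re) a b := by
  refine squeeze_zero (fun t => Finset.sum_nonneg fun i _ => dist_nonneg) (fun t => ?_) hf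
  refine Finset.sum_le_sum fun i _ => ?_
  rw [Real.dist_eq, dist_eq_norm, ← Complex.sub_re]
  exact Complex.abs_re_le_norm _

lemma AbsolutelyContinuousOnInterval_im {f : ℝ → ℂ} {a b : ℝ}
    (hf : AbsolutelyContinuousOnInterval f a b) :
    AbsolutelyContinuousOnInterval (fun r => (f r).im) a b := by
  refine squeeze_zero (fun t => Finset.sum_nonneg fun i _ => dist_nonneg) (fun t => ?_) hf
  refine Finset.sum_le_sum fun i _ => ?_
  rw [Real.dist_eq, dist_eq_norm, ← Complex.sub_im]
  exact Complex.abs_im_le_norm _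

variable {m : ℤ} {R : ℝ} {f g : ℝ → ℂ}

/-- Absolute continuity is available only away from `0`, so `(0, R)` is exhausted by the intervals
`[R / (n + 2), R]`. The result makes `deriv` additive almost everywhere on the domain. -/
lemma MemFiberDom.ae_differentiableAt (hf : MemFiberDom m R f) :
    ∀ᵐ r ∂(radialMeasure R), DifferentiableAt ℝ f r := by
  have h : ∀ n : ℕ, ∀ᵐ r, R / (n + 2) ∈ Set.Ioo 0 R → r ∈ Set.uIcc (R / (n + 2)) R →
      DifferentiableAt ℝ f r := by
    intro n
    by_cases hn : R / (n + 2) ∈ Set.Ioo 0 R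
    · filter_upwards [(hf.1 _ hn).boundedVariationOn.ae_differentiableAt_of_mem_uIcc] with r hr _
        using hr
    · exact Eventually.of_forall fun r h => absurd h hn
  filter_upwards [ae_radialMeasure_mem R,
    (radialMeasure_absolutelyContinuous R).ae_le (ae_restrict_of_ae (ae_all_iff.2 h))] with r hr hall
  have hR : 0 < R := hr.1.trans hr.2
  obtain ⟨n, hn⟩ := exists_nat_gt (R / r)
  have hlt : R / (n + 2) < r := by
    rw [div_lt_iff₀ (by positivity)]
    rw [div_lt_iff₀ hr.1] at hn
    nlinarith [hr.1]
  exact hall n ⟨by positivity, hlt.trans hr.2⟩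
    (by rw [Set.uIcc_of_le (hlt.trans hr.2).le]; exact ⟨hlt.le, hr.2.le⟩)

lemma MemFiberDom.add (hf : MemFiberDom m R f) (hg : MemFiberDom m R g) :
    MemFiberDom m R (f + g) := by
  refine ⟨fun ε hε => (hf.1 ε hε).add (hg.1 ε hε), hf.2.1.add hg.2.1,
    (hf.2.2.1.add hg.2.2.1).ae_eq ?_, (hf.2.2.2.add hg.2.2.2).ae_eq ?_⟩
  · filter_upwards [hf.ae_differentiableAt, hg.ae_differentiableAt] with r h1 h2
    exact (deriv_add h1 h2).symm
  · exact Eventually.of_forall fun r => by simp [mul_add]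

lemma MemFiberDom.const_smul (c : ℂ) (hf : MemFiberDom m R f) : MemFiberDom m R (c • f) := by
  refine ⟨fun ε hε => (hf.1 ε hε).const_smul c, hf.2.1.const_smul c,
    (hf.2.2.1.const_smul c).ae_eq ?_, (hf.2.2.2.const_smul c).ae_eq ?_⟩
  · exact Eventually.of_forall fun r => (deriv_const_smul_field c f).symm
  · exact Eventually.of_forall fun r => by simp; ring

/-- The angular part of the magnetic gradient on the fiber. -/
def fiberPot (b : ℝ) (m : ℤ) (f : ℝ → ℂ) (r : ℝ) : ℂ := ((m / r - b * r / 2 : ℝ) : ℂ) * f r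

lemma norm_fiberPot_sq {b r : ℝ} (hr : r ≠ 0) :
    ‖fiberPot b m f r‖ ^ 2 = 1 / r ^ 2 * (m - b * r ^ 2 / 2) ^ 2 * ‖f r‖ ^ 2 := by
  rw [fiberPot, norm_mul, mul_pow, Complex.norm_real, Real.norm_eq_abs, sq_abs]
  congr 1
  field_simp

lemma memLp_id_mul {b : ℝ} (hf : MemLp f 2 (radialMeasure R)) :
    MemLp (fun r => ((b * r : ℝ) : ℂ) * f r) 2 (radialMeasure R) := by
  refine hf.of_le_mul (c := |b| * R) ?_ ?_
  · exact (by fun_prop : Continuous fun r : ℝ => ((b * r : ℝ) : ℂ)).aestronglyMeasurable.mul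
      hf.aestronglyMeasurable
  · filter_upwards [ae_radialMeasure_mem R] with r hr
    rw [norm_mul, Complex.norm_real, Real.norm_eq_abs, abs_mul, abs_of_pos hr.1]
    gcongr
    exact hr.2.le

lemma MemFiberDom.memLp_fiberPot (b : ℝ) (hf : MemFiberDom m R f) :
    MemLp (fiberPot b m f) 2 (radialMeasure R) := by
  refine (hf.2.2.2.sub (memLp_id_mul (b := b / 2) hf.2.1)).ae_eq (Eventually.of_forall fun r => ?_)
  simp [fiberPot]; ring

lemma fiberForm_eq (β b : ℝ) (m : ℤ) (R : ℝ) (f : ℝ → ℂ) :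
    fiberForm β b m R f =
      (∫ r, (‖deriv f r‖ ^ 2 + ‖fiberPot b m f r‖ ^ 2) ∂(radialMeasure R)) + β * R * ‖f R‖ ^ 2 := by
  rw [fiberForm]
  congr 1
  refine integral_congr_ae ?_
  filter_upwards [ae_radialMeasure_mem R] with r hr
  rw [norm_fiberPot_sq hr.1.ne']

/-! ### Picone's inequality -/

/-- If `h / r` is integrable near `0`, then `h` takes arbitrarily small values near `0`. -/
lemma frequently_lt_of_integrableOn_div {h : ℝ → ℝ} {R : ℝ} (hR : 0 < R)
    (hi : IntegrableOn (fun r => h r / r) (Set.Ioo 0 R)) {δ : ℝ} (hδ : 0 < δ) :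
    ∃ᶠ r in 𝓝[>] 0, h r < δ := by
  intro hcon
  simp only [not_lt] at hcon
  obtain ⟨η, hη, hη'⟩ := mem_nhdsGT_iff_exists_Ioo_subset.1 (inter_mem hcon (Ioo_mem_nhdsGT hR))
  have hη0 : (0 : ℝ) < η := hη
  have hsub : Set.Ioo 0 η ⊆ Set.Ioo 0 R := fun x hx => (hη' hx).2
  -- If `h ≥ δ` near `0`, then `1 / r` is dominated by `h r / (δ r)` and would be integrable at `0`.
  have hint : IntegrableOn (fun r : ℝ => r⁻¹) (Set.Ioo 0 η) := by
    refine Integrable.mono' ((hi.mono_set hsub).mul_const δ⁻¹)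
      measurable_inv.aestronglyMeasurable ?_
    filter_upwards [ae_restrict_mem measurableSet_Ioo] with r hr
    have h1 : δ ≤ h r := (hη' hr).1
    have hr0 := hr.1
    rw [Real.norm_eq_abs, abs_of_pos (by positivity)]
    rw [div_mul_eq_mul_div, ← div_eq_mul_inv, inv_eq_one_div]
    gcongr
    rwa [one_le_div hδ]
  have := (intervalIntegrable_inv_iff (a := 0) (b := η)).1
    ((intervalIntegrable_iff_integrableOn_Ioo_of_le hη0.le).2 hint)
  rcases this with h | h
  · exact hη0.ne h
  · exact h Set.left_mem_uIcc

/-- **Picone's inequality**: a subsolution of the Riccati equation of the fiber operator bounds the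
fiber form from below. -/
theorem picone {b β μ C : ℝ} (hR : 0 < R) {ρ : ℝ → ℝ}
    (hρ : ∀ r ∈ Set.Ioc 0 R, HasDerivAt ρ
      (r * (1 / r ^ 2 * (m - b * r ^ 2 / 2) ^ 2 - μ) - ρ r ^ 2 / r) r)
    (hC : ∀ r ∈ Set.Ioc 0 R, |ρ r| ≤ |(m : ℝ)| + C * r ^ 2) (hb : -(β * R) ≤ ρ R)
    (hf : MemFiberDom m R f) :
    μ * ∫ r, ‖f r‖ ^ 2 ∂(radialMeasure R) ≤ fiberForm β b m R f := by
  have if0 : Integrable (fun r => ‖f r‖ ^ 2) (radialMeasure R) := hf.2.1.integrable_norm_pow (by simp)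
  have if1 : Integrable (fun r => ‖deriv f r‖ ^ 2) (radialMeasure R) :=
    hf.2.2.1.integrable_norm_pow (by simp)
  have if2 : Integrable (fun r => ‖fiberPot b m f r‖ ^ 2) (radialMeasure R) :=
    (hf.memLp_fiberPot b).integrable_norm_pow (by simp)
  have if3 : Integrable (fun r => ‖((m / r : ℝ) : ℂ) * f r‖ ^ 2) (radialMeasure R) :=
    hf.2.2.2.integrable_norm_pow (by simp)
  set F : ℝ → ℝ := fun r => ‖deriv f r‖ ^ 2 + ‖fiberPot b m f r‖ ^ 2 - μ * ‖f r‖ ^ 2 with hF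
  have iF : Integrable F (radialMeasure R) := (if1.add if2).sub (if0.const_mul μ)
  set J : ℝ → ℝ := fun r => r * F r with hJ
  have iJ : IntegrableOn J (Set.Ioo 0 R) := integrable_radialMeasure_iff.1 iF
  have iJ' : IntegrableOn J (Set.uIcc 0 R) := by
    rwa [Set.uIcc_of_le hR.le, integrableOn_Icc_iff_integrableOn_Ioo]
  set h : ℝ → ℝ := fun r => ρ r * ((f r).re * (f r).re + (f r).im * (f r).im) with hh
  have hnorm : ∀ r, (f r).re * (f r).re + (f r).im * (f r).im = ‖f r‖ ^ 2 := fun r => by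
    rw [← Complex.normSq_eq_norm_sq, Complex.normSq_apply]
  -- On `[ε, R]` the function `h = ρ |f|²` is absolutely continuous, and `h' ≤ J` almost everywhere
  -- by the identity `key` below.
  have main : ∀ ε ∈ Set.Ioo 0 R, h R - h ε ≤ ∫ r in ε..R, J r := by
    intro ε hε
    have hsub : Set.uIcc ε R ⊆ Set.Ioc 0 R := by
      rw [Set.uIcc_of_le hε.2.le]; exact fun x hx => ⟨hε.1.trans_le hx.1, hx.2⟩
    have hρc : ContinuousOn ρ (Set.uIcc ε R) := fun r hr =>
      (hρ r (hsub hr)).continuousAt.continuousWithinAt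
    have hρac : AbsolutelyContinuousOnInterval ρ ε R := by
      have hcont : ContinuousOn (fun r => r * (1 / r ^ 2 * (m - b * r ^ 2 / 2) ^ 2 - μ)
          - ρ r ^ 2 / r) (Set.uIcc ε R) := by
        refine ContinuousOn.sub (ContinuousOn.mul (by fun_prop) (ContinuousOn.sub
          (ContinuousOn.mul (ContinuousOn.div (by fun_prop) (by fun_prop) fun r hr => ?_)
            (by fun_prop)) (by fun_prop)))
          ((hρc.pow 2).div (by fun_prop) fun r hr => (hsub hr).1.ne')
        have := (hsub hr).1
        positivity
      obtain ⟨K, hK⟩ := isCompact_uIcc.exists_bound_of_continuousOn hcont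
      have hK0 : 0 ≤ K := (norm_nonneg _).trans (hK ε Set.left_mem_uIcc)
      refine LipschitzOnWith.absolutelyContinuousOnInterval (K := ⟨K, hK0⟩)
        (Convex.lipschitzOnWith_of_nnnorm_hasDerivWithin_le (convex_uIcc _ _)
          (fun r hr => (hρ r (hsub hr)).hasDerivWithinAt) fun r hr => ?_)
      exact hK r hr
    have hre := AbsolutelyContinuousOnInterval_re (hf.1 ε hε)
    have him := AbsolutelyContinuousOnInterval_im (hf.1 ε hε)
    have hac : AbsolutelyContinuousOnInterval h ε R :=
      hρac.fun_mul ((hre.fun_mul hre).fun_add (him.fun_mul him))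
    rw [← hac.integral_deriv_eq_sub]
    refine intervalIntegral.integral_mono_ae_restrict hε.2.le hac.intervalIntegrable_deriv ?_ ?_
    · rw [intervalIntegrable_iff_integrableOn_Ioo_of_le hε.2.le]
      exact iJ.mono_set (Set.Ioo_subset_Ioo_left hε.1.le)
    · filter_upwards [ae_restrict_mem measurableSet_Icc, ae_restrict_of_ae
        (hf.1 ε hε).boundedVariationOn.ae_differentiableAt_of_mem_uIcc] with r hr hdiff
      have hr' : r ∈ Set.uIcc ε R := by rwa [Set.uIcc_of_le hε.2.le]
      have hd := (hdiff hr').hasDerivAt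
      have hdre : HasDerivAt (fun r => (f r).re) (deriv f r).re r :=
        Complex.reCLM.hasFDerivAt.comp_hasDerivAt r hd
      have hdim : HasDerivAt (fun r => (f r).im) (deriv f r).im r :=
        Complex.imCLM.hasFDerivAt.comp_hasDerivAt r hd
      have hr0 : 0 < r := (hsub hr').1
      have hder := (hρ r (hsub hr')).mul ((hdre.mul hdre).add (hdim.mul hdim))
      rw [show deriv h r = _ from hder.deriv]
      simp only [hJ, hF, norm_fiberPot_sq hr0.ne', Pi.add_apply, Pi.mul_apply]
      rw [← hnorm, show ‖deriv f r‖ ^ 2 = (deriv f r).re * (deriv f r).re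
        + (deriv f r).im * (deriv f r).im by
          rw [← Complex.normSq_eq_norm_sq, Complex.normSq_apply]]
      set x := (f r).re
      set y := (f r).im
      set x' := (deriv f r).re
      set y' := (deriv f r).im
      set W := 1 / r ^ 2 * (m - b * r ^ 2 / 2) ^ 2
      -- Picone's identity: the Riccati equation makes `J - h'` equal to the square `|r f' - ρ f|² /
      -- r`.
      have key : r * (x' * x' + y' * y' + W * (x * x + y * y) - μ * (x * x + y * y))
          - ((r * (W - μ) - ρ r ^ 2 / r) * (x * x + y * y)
            + ρ r * (x' * x + x * x' + (y' * y + y * y')))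
          = ((r * x' - ρ r * x) ^ 2 + (r * y' - ρ r * y) ^ 2) / r := by
        field_simp
        ring
      have : 0 ≤ ((r * x' - ρ r * x) ^ 2 + (r * y' - ρ r * y) ^ 2) / r := by positivity
      linarith
  -- The boundary term at `0` need not be shown to converge: it suffices that it is small along some
  -- sequence. It is dominated by a function `k` with `k r / r` integrable, built from the
  -- integrability of `r |m f / r|²` and `r |f|²`.
  have hsmall : ∀ δ > 0, ∃ᶠ r in 𝓝[>] 0, |h r| < δ := by
    intro δ hδ
    have i3 : IntegrableOn (fun r => |(m : ℝ)| * (r * ‖((m / r : ℝ) : ℂ) * f r‖ ^ 2)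
        + |C| * (r * ‖f r‖ ^ 2)) (Set.Ioo 0 R) :=
      ((integrable_radialMeasure_iff.1 if3).const_mul _).add
        ((integrable_radialMeasure_iff.1 if0).const_mul _)
    set k : ℝ → ℝ := fun r => r * (|(m : ℝ)| * (r * ‖((m / r : ℝ) : ℂ) * f r‖ ^ 2)
        + |C| * (r * ‖f r‖ ^ 2)) with hk
    have i4 : IntegrableOn (fun r => k r / r) (Set.Ioo 0 R) := by
      refine i3.congr_fun (fun r hr => ?_) measurableSet_Ioo
      have := hr.1.ne'
      simp only [hk]
      field_simp
    refine ((frequently_lt_of_integrableOn_div hR i4 hδ).and_eventually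
      (Ioo_mem_nhdsGT hR)).mono fun r hr => ?_
    have hr0 := hr.2.1
    refine lt_of_le_of_lt ?_ hr.1
    simp only [hh, hk]
    rw [hnorm, abs_mul, abs_of_nonneg (sq_nonneg ‖f r‖), norm_mul, Complex.norm_real,
      Real.norm_eq_abs, abs_div, abs_of_pos hr0, mul_pow]
    -- Integrality of `m` enters here: either `m = 0` or `|m| ≥ 1`.
    have hint : |(m : ℝ)| ≤ |(m : ℝ)| * |(m : ℝ)| ^ 2 := by
      rcases eq_or_ne m 0 with rfl | hm
      · simp
      · have : (1 : ℝ) ≤ |(m : ℝ)| := by exact_mod_cast Int.one_le_abs hm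
        nlinarith [abs_nonneg (m : ℝ)]
    have e1 : r * (|(m : ℝ)| * (r * ((|(m : ℝ)| / r) ^ 2 * ‖f r‖ ^ 2)) + |C| * (r * ‖f r‖ ^ 2))
        = (|(m : ℝ)| * |(m : ℝ)| ^ 2 + |C| * r ^ 2) * ‖f r‖ ^ 2 := by
      field_simp
    rw [e1]
    gcongr
    refine (hC r ⟨hr0, hr.2.2.le⟩).trans ?_
    gcongr
    exact le_abs_self C
  have hlim : Tendsto (fun ε => ∫ r in ε..R, J r) (𝓝[>] 0) (𝓝 (∫ r in (0 : ℝ)..R, J r)) := by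
    have := (intervalIntegral.continuousOn_primitive_interval_left iJ') 0 Set.left_mem_uIcc
    rw [Set.uIcc_of_le hR.le] at this
    exact (this.mono Set.Ioc_subset_Icc_self).tendsto.mono_left
      (le_of_eq (nhdsWithin_Ioc_eq_nhdsGT hR).symm)
  have hfin : h R ≤ ∫ r in (0 : ℝ)..R, J r := by
    refine le_of_forall_pos_le_add fun δ hδ => ?_
    have hev : ∀ᶠ ε in 𝓝[>] 0, ∫ r in ε..R, J r < (∫ r in (0 : ℝ)..R, J r) + δ / 2 :=
      hlim.eventually_lt_const (by linarith)
    obtain ⟨ε, ⟨h1, h2⟩, h3⟩ := (((hsmall (δ / 2) (by positivity)).and_eventually hev).and_eventually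
      (Ioo_mem_nhdsGT hR)).exists
    have := main ε h3
    linarith [le_abs_self (h ε)]
  have hJint : ∫ r in (0 : ℝ)..R, J r = (∫ r, (‖deriv f r‖ ^ 2 + ‖fiberPot b m f r‖ ^ 2)
      ∂(radialMeasure R)) - μ * ∫ r, ‖f r‖ ^ 2 ∂(radialMeasure R) := by
    rw [intervalIntegral.integral_of_le hR.le, integral_Ioc_eq_integral_Ioo]
    have h1 := integral_radialMeasure R F
    simp only [smul_eq_mul] at h1
    rw [← h1, ← integral_const_mul]
    exact integral_sub (if1.add if2) (if0.const_mul μ)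
  rw [fiberForm_eq]
  rw [hJint] at hfin
  have : -(β * R) * ‖f R‖ ^ 2 ≤ h R := by
    simp only [hh, hnorm]
    gcongr
  linarith

/-! ### Functions of the form `r ^ m G(r²)` -/

/-- The function `r ^ m G(r²)`. -/
def radialFun (m : ℕ) (G : ℝ → ℝ) (r : ℝ) : ℝ := r ^ m * G (r ^ 2)

lemma memLp_radialMeasure_of_continuous {R : ℝ} {f : ℝ → ℂ} (hf : Continuous f) :
    MemLp f 2 (radialMeasure R) := by
  obtain ⟨C, hC⟩ := (isCompact_Icc (a := (0 : ℝ)) (b := R)).exists_bound_of_continuousOn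
    hf.continuousOn
  refine MemLp.of_bound hf.aestronglyMeasurable C ?_
  filter_upwards [ae_radialMeasure_mem R] with r hr using hC r (Set.Ioo_subset_Icc_self hr)

lemma radialFun_contDiff (m : ℕ) {G : ℝ → ℝ} (hG : ContDiff ℝ ∞ G) :
    ContDiff ℝ ∞ (radialFun m G) :=
  (contDiff_id.pow m).mul (hG.comp (contDiff_id.pow 2))

lemma memFiberDom_of_contDiff {m : ℤ} {R : ℝ} {f : ℝ → ℂ} (hf : ContDiff ℝ 1 f)
    (hm : MemLp (fun r => ((m / r : ℝ) : ℂ) * f r) 2 (radialMeasure R)) : MemFiberDom m R f :=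
  ⟨fun _ _ => hf.contDiffOn.absolutelyContinuousOnInterval,
    memLp_radialMeasure_of_continuous hf.continuous,
    memLp_radialMeasure_of_continuous (hf.continuous_deriv le_rfl), hm⟩

/-- The centrifugal term is `m r ^ (m - 1) G(r²)`, continuous up to `0`; for `m = 0` it vanishes,
whatever the truncated exponent. -/
lemma memFiberDom_radialFun (m : ℕ) {R : ℝ} {G : ℝ → ℝ} (hG : ContDiff ℝ ∞ G) :
    MemFiberDom m R (fun r => (radialFun m G r : ℂ)) := by
  refine memFiberDom_of_contDiff
    ((Complex.ofRealCLM.contDiff.comp (radialFun_contDiff m hG)).of_le (by simp)) ?_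
  have hGc := hG.continuous
  have h1 : MemLp (fun r : ℝ => ((m * r ^ (m - 1) * G (r ^ 2) : ℝ) : ℂ)) 2 (radialMeasure R) :=
    memLp_radialMeasure_of_continuous (by fun_prop)
  refine h1.ae_eq ?_
  filter_upwards [ae_radialMeasure_mem R] with r hr
  rw [← Complex.ofReal_mul]
  congr 1
  have := hr.1.ne'
  rcases m with _ | m
  · simp
  · simp only [radialFun, Nat.add_sub_cancel, pow_succ]
    push_cast
    field_simp

lemma not_ae_eq_zero_of_forall_ne {R : ℝ} (hR : 0 < R) {f : ℝ → ℂ} (hf : ∀ r ∈ Set.Ioo 0 R, f r ≠ 0) :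
    ¬ f =ᵐ[radialMeasure R] 0 := by
  intro h
  have h2 := (ae_withDensity_iff (by fun_prop)).1 h
  have h3 : ∀ᵐ r ∂(volume.restrict (Set.Ioo 0 R)), False := by
    filter_upwards [h2, ae_restrict_mem measurableSet_Ioo] with r h1 hr
    exact hf r hr (h1 (by simpa using hr.1))
  simp only [ae_iff, not_false_eq_true, Set.ofPred_true, Measure.restrict_apply_univ,
    Real.volume_Ioo, sub_zero, ENNReal.ofReal_eq_zero] at h3
  linarith

lemma integral_norm_sq_pos {α : Type*} [MeasurableSpace α] {ν : Measure α} {f : α → ℂ}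
    (hf : MemLp f 2 ν) (h : ¬ f =ᵐ[ν] 0) : 0 < ∫ x, ‖f x‖ ^ 2 ∂ν := by
  refine lt_of_le_of_ne (integral_nonneg fun x => by positivity) fun h0 => h ?_
  have := (integral_eq_zero_iff_of_nonneg (fun x => by positivity)
    (hf.integrable_norm_pow (by simp))).1 h0.symm
  filter_upwards [this] with x hx
  simpa using hx

/-! ### Shooting -/

section Shooting

variable {β b R μ : ℝ} {m : ℕ}

/-- The radial logarithmic derivative `r f' / f` of `f r = r ^ m g(r²)`. -/
def riccati (b : ℝ) (m : ℕ) (κ r : ℝ) : ℝ :=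
  m + 2 * r ^ 2 * (ksol' (b ^ 2 / 4) m κ (r ^ 2) / ksol (b ^ 2 / 4) m κ (r ^ 2))

/-- Expanding the potential gives `m² / r² - m b + b² r² / 4`. The substitution `f = r ^ m g(r²)`
absorbs the first term, the last one becomes the coefficient `b² / 4` of the series equation, and
the middle one shifts the eigenvalue, so that `κ` corresponds to `κ - m b`. -/
lemma hasDerivAt_riccati {κ r : ℝ} (hr : 0 < r) (hg : ksol (b ^ 2 / 4) m κ (r ^ 2) ≠ 0) :
    HasDerivAt (riccati b m κ) (r * (1 / r ^ 2 * ((m : ℤ) - b * r ^ 2 / 2) ^ 2 - (κ - m * b))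
      - riccati b m κ r ^ 2 / r) r := by
  have he : 0 ≤ b ^ 2 / 4 := by positivity
  have hsq : HasDerivAt (fun r : ℝ => r ^ 2) (2 * r) r := by simpa using hasDerivAt_pow 2 r
  have h1 := (hasDerivAt_ksol m κ he (r ^ 2)).comp r hsq
  have h2 := (hasDerivAt_ksol' m κ he (r ^ 2)).comp r hsq
  have h3 := ((hsq.const_mul 2).mul (h2.div h1 hg)).const_add (m : ℝ)
  refine HasDerivAt.congr_deriv h3 ?_
  have ode := ksol_ode m κ he (r ^ 2)
  simp only [riccati, Function.comp_apply, Pi.div_apply]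
  set g := ksol (b ^ 2 / 4) m κ (r ^ 2)
  set g' := ksol' (b ^ 2 / 4) m κ (r ^ 2)
  have hg'' : ksol'' (b ^ 2 / 4) m κ (r ^ 2)
      = ((b ^ 2 / 4 * r ^ 2 - κ) * g - 4 * (m + 1) * g') / (4 * r ^ 2) := by
    field_simp
    linarith
  rw [hg'']
  push_cast
  field_simp
  ring

/-- The boundary functional whose zeros are the eigenvalues. -/
def robinVal (β b R : ℝ) (m : ℕ) (κ : ℝ) : ℝ :=
  (m + β * R) * ksol (b ^ 2 / 4) m κ (R ^ 2) + 2 * R ^ 2 * ksol' (b ^ 2 / 4) m κ (R ^ 2)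

/-- Picone's inequality with the logarithmic derivative of the series solution: positivity of `g`
keeps it finite, and `robinVal ≥ 0` is the boundary condition `ρ R ≥ -β R` multiplied by `g (R²) >
0`. -/
lemma le_fiberForm_of_robinVal_nonneg (hR : 0 < R) {κ : ℝ}
    (hpos : ∀ s ∈ Set.Icc 0 (R ^ 2), 0 < ksol (b ^ 2 / 4) m κ s) (hΦ : 0 ≤ robinVal β b R m κ)
    {f : ℝ → ℂ} (hf : MemFiberDom m R f) :
    (κ - m * b) * ∫ r, ‖f r‖ ^ 2 ∂(radialMeasure R) ≤ fiberForm β b m R f := by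
  have he : 0 ≤ b ^ 2 / 4 := by positivity
  have hmem : ∀ r ∈ Set.Ioc 0 R, r ^ 2 ∈ Set.Icc 0 (R ^ 2) := fun r hr =>
    ⟨by positivity, by have := hr.1; have := hr.2; gcongr⟩
  obtain ⟨C, hC⟩ := (isCompact_Icc (a := (0 : ℝ)) (b := R ^ 2)).exists_bound_of_continuousOn
    (((continuous_ksol' m κ he).continuousOn (s := Set.Icc 0 (R ^ 2))).div
      (continuous_ksol m κ he).continuousOn fun s hs => (hpos s hs).ne')
  refine picone (C := 2 * C) (ρ := riccati b m κ) hR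
    (fun r hr => hasDerivAt_riccati hr.1 (hpos _ (hmem r hr)).ne') (fun r hr => ?_) ?_ hf
  · have := hC _ (hmem r hr)
    rw [riccati]
    refine (abs_add_le _ _).trans ?_
    rw [abs_mul, abs_of_nonneg (by positivity : 0 ≤ 2 * r ^ 2)]
    rw [Real.norm_eq_abs, Pi.div_apply] at this
    push_cast
    nlinarith [sq_nonneg r]
  · have hg := hpos (R ^ 2) ⟨by positivity, le_rfl⟩
    have h2 : riccati b m κ R + β * R
        = robinVal β b R m κ / ksol (b ^ 2 / 4) m κ (R ^ 2) := by
      rw [riccati, robinVal]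
      field_simp
      ring
    have : 0 ≤ robinVal β b R m κ / ksol (b ^ 2 / 4) m κ (R ^ 2) := by positivity
    linarith

/-- Shooting from below: `κ₀` is the supremum of the parameters for which `g` is positive on `[0,
R²]` and the boundary functional is nonnegative. In the limit both hold in the weak sense. A zero of
`g` would have to be a double zero, which `ksol_cauchy_ne_zero` excludes, so positivity stays
strict. If the boundary functional were positive at `κ₀`, both conditions would persist for slightly
larger `κ`. -/
lemma exists_shooting (hR : 0 < R) (β b : ℝ) (m : ℕ) :
    ∃ κ, (∀ s ∈ Set.Icc 0 (R ^ 2), 0 < ksol (b ^ 2 / 4) m κ s) ∧ robinVal β b R m κ = 0 := by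
  have he : 0 ≤ b ^ 2 / 4 := by positivity
  have hX : 0 < R ^ 2 := by positivity
  set S : Set ℝ := {κ | (∀ s ∈ Set.Icc 0 (R ^ 2), 0 < ksol (b ^ 2 / 4) m κ s) ∧
    0 ≤ robinVal β b R m κ} with hS
  have hc1 := continuous_ksol_uncurry m he
  have hc2 := continuous_ksol'_uncurry m he
  have hcΦ : Continuous (robinVal β b R m) := by
    have h1 : Continuous fun κ => ksol (b ^ 2 / 4) m κ (R ^ 2) :=
      hc1.comp (continuous_id.prodMk continuous_const)
    have h2 : Continuous fun κ => ksol' (b ^ 2 / 4) m κ (R ^ 2) :=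
      hc2.comp (continuous_id.prodMk continuous_const)
    unfold robinVal
    fun_prop
  have hne : S.Nonempty := by
    -- With this slope `2 R² g' (R²) ≥ |β| R g (R²)`, which compensates the Robin term;
    -- `mul_ksol_le_ksol'` supplies a sufficiently negative `κ`.
    set K := |β| / (2 * R) with hK
    have hK0 : 0 ≤ K := by positivity
    set κ := -(4 * (K * (m + 1) + K ^ 2 * R ^ 2)) with hκ
    have hκ0 : κ ≤ 0 := by
      have : 0 ≤ K * (m + 1) + K ^ 2 * R ^ 2 := by positivity
      linarith
    refine ⟨κ, fun s hs => ksol_pos_of_nonpos m κ he hκ0 hs.1, ?_⟩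
    have h1 := mul_ksol_le_ksol' m κ he hK0 hX hκ.le
    have h2 := ksol_pos_of_nonpos m κ he hκ0 hX.le
    rw [robinVal]
    have h3 : 2 * R ^ 2 * (K * ksol (b ^ 2 / 4) m κ (R ^ 2))
        = |β| * R * ksol (b ^ 2 / 4) m κ (R ^ 2) := by
      rw [hK]; field_simp
    have h4 : 0 ≤ (|β| + β) * R * ksol (b ^ 2 / 4) m κ (R ^ 2) := by
      have := neg_abs_le β
      have : 0 ≤ |β| + β := by linarith
      positivity
    have h5 : 0 ≤ (m : ℝ) * ksol (b ^ 2 / 4) m κ (R ^ 2) := by positivity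
    nlinarith [mul_le_mul_of_nonneg_left h1 (by positivity : 0 ≤ 2 * R ^ 2)]
  have hbdd : BddAbove S := by
    -- For `κ` in `S`, the number `κ - m b` is a lower bound of the fiber form, hence at most the
    -- Rayleigh quotient of the trial function `r ^ m`.
    have hf := memFiberDom_radialFun (R := R) m (G := fun _ => 1) contDiff_const
    have hpos := integral_norm_sq_pos hf.2.1 (not_ae_eq_zero_of_forall_ne hR fun r hr => by
      have := hr.1.ne'; simp [radialFun, this])
    refine bddAbove_def.2 ⟨fiberForm β b m R (fun r => (radialFun m (fun _ => 1) r : ℂ)) /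
      (∫ r, ‖(radialFun m (fun _ => 1) r : ℂ)‖ ^ 2 ∂(radialMeasure R)) + m * b, fun κ hκ => ?_⟩
    have := le_fiberForm_of_robinVal_nonneg hR hκ.1 hκ.2 hf
    rw [← le_div_iff₀ hpos] at this
    exact sub_le_iff_le_add.1 this
  set κ₀ := sSup S
  obtain ⟨u, -, hu, huS⟩ := exists_seq_tendsto_sSup hne hbdd
  have hge : ∀ s ∈ Set.Icc 0 (R ^ 2), 0 ≤ ksol (b ^ 2 / 4) m κ₀ s := fun s hs => by
    have h1 : Continuous fun κ => ksol (b ^ 2 / 4) m κ s :=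
      hc1.comp (continuous_id.prodMk continuous_const)
    exact ge_of_tendsto' ((h1.tendsto κ₀).comp hu) fun n => ((huS n).1 s hs).le
  have hΦ : 0 ≤ robinVal β b R m κ₀ :=
    ge_of_tendsto' ((hcΦ.tendsto κ₀).comp hu) fun n => (huS n).2
  have hpos : ∀ s ∈ Set.Icc 0 (R ^ 2), 0 < ksol (b ^ 2 / 4) m κ₀ s := by
    intro s hs
    refine lt_of_le_of_ne (hge s hs) fun h0 => ?_
    have hs0 : 0 < s := by
      refine lt_of_le_of_ne hs.1 fun h => ?_
      rw [← h, ksol_zero] at h0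
      exact zero_ne_one h0
    have hcauchy := ksol_cauchy_ne_zero m κ₀ he hs0 h0.symm
    -- An interior zero of `g ≥ 0` is a minimum. At the endpoint the difference quotients from the
    -- left give `g' ≤ 0`, while nonnegativity of the boundary functional with `g = 0` gives `g' ≥
    -- 0`.
    rcases hs.2.lt_or_eq with hlt | heq
    · have hmin : IsLocalMin (ksol (b ^ 2 / 4) m κ₀) s := by
        filter_upwards [Icc_mem_nhds hs0 hlt] with t ht
        rw [← h0]
        exact hge t ht
      exact hcauchy (hmin.hasDerivAt_eq_zero (hasDerivAt_ksol m κ₀ he s))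
    · have h1 : ksol' (b ^ 2 / 4) m κ₀ s ≤ 0 := by
        have hd := ((hasDerivAt_ksol m κ₀ he s).hasDerivWithinAt (s := Set.Iio s))
        rw [hasDerivWithinAt_iff_tendsto_slope' (by simp)] at hd
        refine le_of_tendsto hd ?_
        filter_upwards [Ioo_mem_nhdsLT hs0] with t ht
        rw [slope_def_field, ← h0, sub_zero]
        exact div_nonpos_of_nonneg_of_nonpos (hge t ⟨ht.1.le, (ht.2.trans_le hs.2).le⟩)
          (by linarith [ht.2])
      rw [robinVal, ← heq, ← h0, mul_zero, zero_add] at hΦ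
      have : 0 ≤ ksol' (b ^ 2 / 4) m κ₀ s := by
        by_contra hcon
        push Not at hcon
        nlinarith
      exact hcauchy (le_antisymm h1 this)
  refine ⟨κ₀, hpos, le_antisymm ?_ hΦ⟩
  by_contra hcon
  push Not at hcon
  have hev1 : ∀ᶠ κ in 𝓝 κ₀, ∀ s ∈ Set.Icc 0 (R ^ 2), 0 < ksol (b ^ 2 / 4) m κ s := by
    refine isCompact_Icc.eventually_forall_of_forall_eventually fun s hs => ?_
    exact hc1.continuousAt.eventually_const_lt (hpos s hs)
  have hev2 : ∀ᶠ κ in 𝓝 κ₀, 0 < robinVal β b R m κ := hcΦ.continuousAt.eventually_const_lt hcon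
  obtain ⟨κ, ⟨h1, h2⟩, h3⟩ := (((hev1.and hev2).filter_mono nhdsWithin_le_nhds).and
    (self_mem_nhdsWithin (a := κ₀) (s := Set.Ioi κ₀))).exists
  exact absurd (le_csSup hbdd (show κ ∈ S from ⟨h1, h2.le⟩)) (not_le.2 h3)

/-- The equality case of Picone's identity: for `f = r ^ m g(r²)` the square vanishes, so `ρ f²` is
a primitive of the form density minus `κ - m b` times the norm density, both weighted by `r`. It
vanishes at `0`, and the Robin condition gives its value at `R`. -/
lemma fiberForm_shooting (hR : 0 < R) {κ : ℝ}
    (hpos : ∀ s ∈ Set.Icc 0 (R ^ 2), 0 < ksol (b ^ 2 / 4) m κ s) (hΦ : robinVal β b R m κ = 0) :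
    fiberForm β b m R (fun r => (radialFun m (ksol (b ^ 2 / 4) m κ) r : ℂ)) =
      (κ - m * b) * ∫ r, ‖(radialFun m (ksol (b ^ 2 / 4) m κ) r : ℂ)‖ ^ 2 ∂(radialMeasure R) := by
  have he : 0 ≤ b ^ 2 / 4 := by positivity
  set G := ksol (b ^ 2 / 4) m κ with hG
  set G' := ksol' (b ^ 2 / 4) m κ with hG'
  set f := radialFun m G with hf
  have hdom : MemFiberDom m R fun r => (f r : ℂ) := memFiberDom_radialFun m (ksol_contDiff m κ he)
  have if0 : Integrable (fun r => ‖(f r : ℂ)‖ ^ 2) (radialMeasure R) :=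
    hdom.2.1.integrable_norm_pow (by simp)
  have if1 : Integrable (fun r => ‖deriv (fun r => (f r : ℂ)) r‖ ^ 2) (radialMeasure R) :=
    hdom.2.2.1.integrable_norm_pow (by simp)
  have if2 : Integrable (fun r => ‖fiberPot b m (fun r => (f r : ℂ)) r‖ ^ 2) (radialMeasure R) :=
    (hdom.memLp_fiberPot b).integrable_norm_pow (by simp)
  have if3 : Integrable (fun r => ‖deriv (fun r => (f r : ℂ)) r‖ ^ 2
    + ‖fiberPot b m (fun r => (f r : ℂ)) r‖ ^ 2) (radialMeasure R) := if1.add if2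
  set F : ℝ → ℝ := fun r => ‖deriv (fun r => (f r : ℂ)) r‖ ^ 2
    + ‖fiberPot b m (fun r => (f r : ℂ)) r‖ ^ 2 - (κ - m * b) * ‖(f r : ℂ)‖ ^ 2 with hF
  have iF : Integrable F (radialMeasure R) := if3.sub (if0.const_mul _)
  -- This is `ρ f²` with the division by `G` cancelled, so that continuity holds on the whole line.
  set H : ℝ → ℝ := fun r => r ^ (2 * m) * G (r ^ 2) * (m * G (r ^ 2) + 2 * r ^ 2 * G' (r ^ 2)) with hH
  have hHc : Continuous H := by
    have h1 : Continuous G := continuous_ksol m κ he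
    have h2 : Continuous G' := continuous_ksol' m κ he
    fun_prop
  have hHeq : ∀ r ∈ Set.Ioo 0 R, H r = riccati b m κ r * f r ^ 2 := by
    intro r hr
    have := (hpos (r ^ 2) ⟨by positivity, by have := hr.1; have := hr.2; gcongr⟩).ne'
    simp only [hH, riccati, hf, radialFun, ← hG, ← hG']
    field_simp
    ring
  have hHd : ∀ r ∈ Set.Ioo 0 R, HasDerivAt H (r * F r) r := by
    intro r hr
    have hr0 := hr.1
    have hg := (hpos (r ^ 2) ⟨by positivity, by have := hr.1; have := hr.2; gcongr⟩).ne'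
    have hsq : HasDerivAt (fun r : ℝ => r ^ 2) (2 * r) r := by simpa using hasDerivAt_pow 2 r
    have h1 := (hasDerivAt_pow m r).mul ((hasDerivAt_ksol m κ he (r ^ 2)).comp r hsq)
    have hfd : HasDerivAt f (riccati b m κ r * f r / r) r := by
      refine HasDerivAt.congr_deriv h1 ?_
      simp only [riccati, hf, radialFun, ← hG, ← hG', Function.comp_apply]
      rcases m with _ | m
      · simp
        field_simp
      · rw [Nat.add_sub_cancel, pow_succ]
        push_cast
        field_simp
        ring
    have h2 := ((hasDerivAt_riccati (b := b) hr.1 hg).mul (hfd.pow 2)).congr_of_eventuallyEq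
      (f₁ := H) (by filter_upwards [Ioo_mem_nhds hr.1 hr.2] with t ht using hHeq t ht)
    refine h2.congr_deriv ?_
    simp only [hF, norm_fiberPot_sq hr0.ne']
    rw [show deriv (fun r => (f r : ℂ)) r = ((riccati b m κ r * f r / r : ℝ) : ℂ) from
      hfd.ofReal_comp.deriv, Complex.norm_real, Complex.norm_real, Real.norm_eq_abs,
      Real.norm_eq_abs, sq_abs, sq_abs]
    simp only [Pi.pow_apply]
    push_cast
    field_simp
    ring
  have hftc := intervalIntegral.integral_eq_sub_of_hasDerivAt_of_le hR.le hHc.continuousOn hHd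
    ((intervalIntegrable_iff_integrableOn_Ioo_of_le hR.le).2 (integrable_radialMeasure_iff.1 iF))
  rw [intervalIntegral.integral_of_le hR.le, integral_Ioc_eq_integral_Ioo] at hftc
  have h1 := integral_radialMeasure R F
  simp only [smul_eq_mul] at h1
  rw [← h1, integral_sub if3 (if0.const_mul _), integral_const_mul] at hftc
  rw [fiberForm_eq]
  have hH0 : H 0 = 0 := by
    rcases m with _ | m
    · simp [hH]
    · simp [hH]
  have hHR : H R = -(β * R * ‖(f R : ℂ)‖ ^ 2) := by
    have h2 : m * G (R ^ 2) + 2 * R ^ 2 * G' (R ^ 2) = -(β * R * G (R ^ 2)) := by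
      rw [robinVal] at hΦ
      linarith
    simp only [hH, h2, hf, radialFun, Complex.norm_real, Real.norm_eq_abs, sq_abs]
    ring
  rw [hH0, hHR] at hftc
  linarith

end Shooting

/-! ### Null vectors of positive semidefinite forms -/

/-- For small `c` opposite to `w` the linear term beats the quadratic one. This is the
first-variation argument for a null vector of a nonnegative form. -/
lemma eq_zero_of_forall_nonneg {w : ℂ} {q : ℝ}
    (h : ∀ c : ℂ, 0 ≤ 2 * (conj c * w).re + ‖c‖ ^ 2 * q) : w = 0 := by
  by_contra hw
  have hw0 : 0 < ‖w‖ ^ 2 := by positivity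
  -- For `c = -s w` the expression is `s |w|² (s q - 2)`, and this `s` makes `s q < 2`.
  set s : ℝ := 1 / (|q| + 1) with hs
  have hs0 : 0 < s := by positivity
  have h1 := h (-(s * w))
  have h2 : (conj (-(s * w)) * w).re = -(s * ‖w‖ ^ 2) := by
    rw [map_neg, map_mul, Complex.conj_ofReal, neg_mul, mul_assoc, Complex.conj_mul',
      ← Complex.ofReal_pow, ← Complex.ofReal_mul, Complex.neg_re, Complex.ofReal_re]
  rw [h2, norm_neg, norm_mul, Complex.norm_real, Real.norm_eq_abs, abs_of_pos hs0, mul_pow] at h1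
  have h3 : s * q < 2 := by
    have : s * (|q| + 1) = 1 := by rw [hs]; field_simp
    nlinarith [le_abs_self q]
  nlinarith [mul_pos hs0 hw0]

lemma integrable_mul_conj {α : Type*} [MeasurableSpace α] {ν : Measure α} {f g : α → ℂ}
    (hf : MemLp f 2 ν) (hg : MemLp g 2 ν) : Integrable (fun x => f x * conj (g x)) ν :=
  MemLp.integrable_mul hf hg.star

lemma integral_norm_add_mul_sq {α : Type*} [MeasurableSpace α] {ν : Measure α} {f g : α → ℂ}
    (hf : MemLp f 2 ν) (hg : MemLp g 2 ν) (c : ℂ) :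
    ∫ x, ‖f x + c * g x‖ ^ 2 ∂ν = ∫ x, ‖f x‖ ^ 2 ∂ν
      + 2 * (conj c * ∫ x, f x * conj (g x) ∂ν).re + ‖c‖ ^ 2 * ∫ x, ‖g x‖ ^ 2 ∂ν := by
  have i1 : Integrable (fun x => ‖f x‖ ^ 2) ν := hf.integrable_norm_pow (by simp)
  have i2 : Integrable (fun x => ‖g x‖ ^ 2) ν := hg.integrable_norm_pow (by simp)
  have i3 := (integrable_mul_conj hf hg).const_mul (conj c)
  have i4 : Integrable (fun x => (conj c * (f x * conj (g x))).re) ν := i3.re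
  rw [← integral_const_mul (conj c), ← integral_const_mul (‖c‖ ^ 2)]
  rw [show (∫ x, conj c * (f x * conj (g x)) ∂ν).re = ∫ x, (conj c * (f x * conj (g x))).re ∂ν
    from (integral_re i3).symm]
  have i5 : Integrable (fun x => ‖f x‖ ^ 2 + 2 * (conj c * (f x * conj (g x))).re) ν :=
    i1.add (i4.const_mul 2)
  rw [← integral_const_mul 2, ← integral_add i1 (i4.const_mul 2),
    ← integral_add i5 (i2.const_mul _)]
  refine integral_congr_ae (Eventually.of_forall fun x => ?_)
  simp only
  rw [← Complex.normSq_eq_norm_sq, ← Complex.normSq_eq_norm_sq, ← Complex.normSq_eq_norm_sq,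
    ← Complex.normSq_eq_norm_sq, Complex.normSq_add, Complex.normSq_mul, map_mul]
  rw [show f x * (conj c * conj (g x)) = conj c * (f x * conj (g x)) by ring]
  ring

/-! ### The ground state of the fiber operators -/

section Fiber

variable {β b R μ : ℝ} {m : ℤ} {f g : ℝ → ℂ}

lemma fiberSesqForm_eq (hf : MemFiberDom m R f) (hg : MemFiberDom m R g) :
    fiberSesqForm β b m R f g = (∫ r, deriv f r * conj (deriv g r) ∂(radialMeasure R))
      + (∫ r, fiberPot b m f r * conj (fiberPot b m g r) ∂(radialMeasure R))
      + β * R * (f R * conj (g R)) := by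
  rw [fiberSesqForm, ← integral_add (integrable_mul_conj hf.2.2.1 hg.2.2.1)
    (integrable_mul_conj (hf.memLp_fiberPot b) (hg.memLp_fiberPot b))]
  congr 1
  refine integral_congr_ae ?_
  filter_upwards [ae_radialMeasure_mem R] with r hr
  simp only [fiberPot, map_mul, Complex.conj_ofReal]
  rw [show 1 / r ^ 2 * (m - b * r ^ 2 / 2) ^ 2 = (m / r - b * r / 2) ^ 2 by
    have := hr.1.ne'; field_simp]
  push_cast
  ring

lemma fiberForm_eq' (hf : MemFiberDom m R f) :
    fiberForm β b m R f = (∫ r, ‖deriv f r‖ ^ 2 ∂(radialMeasure R))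
      + (∫ r, ‖fiberPot b m f r‖ ^ 2 ∂(radialMeasure R)) + β * R * ‖f R‖ ^ 2 := by
  rw [fiberForm_eq, integral_add (hf.2.2.1.integrable_norm_pow (by simp))
    ((hf.memLp_fiberPot b).integrable_norm_pow (by simp))]

/-- Second-order expansion used for the first variation of a minimizer. The derivative splits only
where both functions are differentiable, which is almost everywhere. -/
lemma fiberForm_add_mul (hf : MemFiberDom m R f) (hg : MemFiberDom m R g) (c : ℂ) :
    fiberForm β b m R (f + c • g) = fiberForm β b m R f
      + 2 * (conj c * fiberSesqForm β b m R f g).re + ‖c‖ ^ 2 * fiberForm β b m R g := by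
  rw [fiberForm_eq' (hf.add (hg.const_smul c)), fiberForm_eq' hf, fiberForm_eq' hg,
    fiberSesqForm_eq hf hg]
  have e1 : ∫ r, ‖deriv (f + c • g) r‖ ^ 2 ∂(radialMeasure R)
      = ∫ r, ‖deriv f r + c * deriv g r‖ ^ 2 ∂(radialMeasure R) := by
    refine integral_congr_ae ?_
    filter_upwards [hf.ae_differentiableAt, hg.ae_differentiableAt] with r h1 h2
    rw [deriv_add h1 (h2.const_smul c), deriv_const_smul_field, smul_eq_mul]
  have e2 : ∫ r, ‖fiberPot b m (f + c • g) r‖ ^ 2 ∂(radialMeasure R)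
      = ∫ r, ‖fiberPot b m f r + c * fiberPot b m g r‖ ^ 2 ∂(radialMeasure R) := by
    refine integral_congr_ae (Eventually.of_forall fun r => ?_)
    simp only [fiberPot, Pi.add_apply, Pi.smul_apply, smul_eq_mul]
    ring_nf
  have e3 : ‖(f + c • g) R‖ ^ 2 = ‖f R‖ ^ 2 + 2 * (conj c * (f R * conj (g R))).re
      + ‖c‖ ^ 2 * ‖g R‖ ^ 2 := by
    simp only [Pi.add_apply, Pi.smul_apply, smul_eq_mul]
    rw [← Complex.normSq_eq_norm_sq, ← Complex.normSq_eq_norm_sq, ← Complex.normSq_eq_norm_sq,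
      ← Complex.normSq_eq_norm_sq, Complex.normSq_add, Complex.normSq_mul, map_mul]
    rw [show f R * (conj c * conj (g R)) = conj c * (f R * conj (g R)) by ring]
    ring
  have e4 : (conj c * (β * R * (f R * conj (g R)))).re
      = β * R * (conj c * (f R * conj (g R))).re := by
    rw [show conj c * (β * R * (f R * conj (g R)))
      = ((β * R : ℝ) : ℂ) * (conj c * (f R * conj (g R))) by push_cast; ring, Complex.re_ofReal_mul]
  rw [e1, e2, e3, integral_norm_add_mul_sq hf.2.2.1 hg.2.2.1,
    integral_norm_add_mul_sq (hf.memLp_fiberPot b) (hg.memLp_fiberPot b), mul_add (conj c),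
    mul_add (conj c), Complex.add_re, Complex.add_re, e4]
  ring

lemma fiberSesqForm_self (hf : MemFiberDom m R f) :
    fiberSesqForm β b m R f f = fiberForm β b m R f := by
  rw [fiberSesqForm_eq hf hf, fiberForm_eq' hf]
  simp only [Complex.mul_conj']
  push_cast
  rw [← integral_complex_ofReal, ← integral_complex_ofReal]
  push_cast
  rfl

/-- A minimizer of the Rayleigh quotient of a fiber form gives its lowest eigenvalue. -/
theorem fiber_isLeast (hlow : ∀ g, MemFiberDom m R g →
      μ * ∫ r, ‖g r‖ ^ 2 ∂(radialMeasure R) ≤ fiberForm β b m R g)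
    (hf : MemFiberDom m R f) (hf0 : ¬ f =ᵐ[radialMeasure R] 0)
    (heq : fiberForm β b m R f = μ * ∫ r, ‖f r‖ ^ 2 ∂(radialMeasure R)) :
    IsLeast (fiberEigenvalues β b m R) μ ∧ mu1 β b m R = μ := by
  refine ⟨⟨⟨f, hf0, hf, hf.2.1.const_smul (μ : ℂ), fun g hg => ?_⟩, ?_⟩, ?_⟩
  -- The form minus `μ` times the squared norm is nonnegative and vanishes at `f`. Expanding it at
  -- `f + c g` for all complex `c` gives the weak eigenvalue equation.
  · have key : fiberSesqForm β b m R f g - μ * ∫ r, f r * conj (g r) ∂(radialMeasure R) = 0 := by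
      refine eq_zero_of_forall_nonneg (q := fiberForm β b m R g
        - μ * ∫ r, ‖g r‖ ^ 2 ∂(radialMeasure R)) fun c => ?_
      have h1 := hlow _ (hf.add (hg.const_smul c))
      rw [fiberForm_add_mul hf hg, heq] at h1
      simp only [Pi.add_apply, Pi.smul_apply, smul_eq_mul] at h1
      rw [integral_norm_add_mul_sq hf.2.1 hg.2.1] at h1
      rw [mul_sub, Complex.sub_re, show conj c * (μ * ∫ r, f r * conj (g r) ∂(radialMeasure R))
        = μ * (conj c * ∫ r, f r * conj (g r) ∂(radialMeasure R)) by ring, Complex.re_ofReal_mul]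
      linarith
    rw [sub_eq_zero.1 key, ← integral_const_mul]
    simp only [mul_assoc]
  -- Tested with its own eigenfunction, the operator equation identifies any eigenvalue with a
  -- Rayleigh quotient.
  · rintro lam ⟨g, hg0, hg, -, hop⟩
    have h1 := hop g hg
    rw [fiberSesqForm_self hg] at h1
    simp only [mul_assoc, Complex.mul_conj'] at h1
    rw [integral_const_mul] at h1
    have h2 : fiberForm β b m R g = lam * ∫ r, ‖g r‖ ^ 2 ∂(radialMeasure R) := by
      have h3 : (∫ r, (‖g r‖ : ℂ) ^ 2 ∂(radialMeasure R))
          = ((∫ r, ‖g r‖ ^ 2 ∂(radialMeasure R) : ℝ) : ℂ) := by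
        rw [← integral_complex_ofReal]; push_cast; rfl
      rw [h3] at h1
      exact_mod_cast h1
    have h3 := hlow g hg
    rw [h2] at h3
    exact le_of_mul_le_mul_right h3 (integral_norm_sq_pos hg.2.1 hg0)
  · refine IsLeast.csInf_eq ⟨⟨f, hf, hf0, ?_⟩, ?_⟩
    · rw [heq, mul_div_cancel_right₀ _ (integral_norm_sq_pos hf.2.1 hf0).ne']
    · rintro t ⟨g, hg, hg0, rfl⟩
      rw [le_div_iff₀ (integral_norm_sq_pos hg.2.1 hg0)]
      exact hlow g hg

end Fiber

/-- Every fiber operator of nonnegative angular momentum has a ground state `r ^ m G(r²)` with a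
smooth positive function `G`. -/
theorem exists_fiber_ground_state {R : ℝ} (hR : 0 < R) (β b : ℝ) (m : ℕ) :
    ∃ (μ : ℝ) (G : ℝ → ℝ), ContDiff ℝ ∞ G ∧ (∀ s ∈ Set.Icc 0 (R ^ 2), 0 < G s) ∧
      (∀ f, MemFiberDom m R f →
        μ * ∫ r, ‖f r‖ ^ 2 ∂(radialMeasure R) ≤ fiberForm β b m R f) ∧
      fiberForm β b m R (fun r => (radialFun m G r : ℂ)) =
        μ * ∫ r, ‖(radialFun m G r : ℂ)‖ ^ 2 ∂(radialMeasure R) := by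
  obtain ⟨κ, hpos, hΦ⟩ := exists_shooting hR β b m
  exact ⟨κ - m * b, ksol (b ^ 2 / 4) m κ, ksol_contDiff m κ (by positivity), hpos,
    fun f hf => le_fiberForm_of_robinVal_nonneg hR hpos hΦ.ge hf, fiberForm_shooting hR hpos hΦ⟩

/-! ### Weak derivatives on the disk -/

instance (R : ℝ) : IsFiniteMeasure (diskMeasure R) :=
  isFiniteMeasure_restrict.2 measure_ball_lt_top.ne

section WeakDeriv

variable {R : ℝ} {e : ℂ} {u v w w' : ℂ → ℂ}

lemma memLp_diskMeasure_of_continuous {f : ℂ → ℂ} (hf : Continuous f) :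
    MemLp f 2 (diskMeasure R) := by
  obtain ⟨C, hC⟩ := (isCompact_closedBall (0 : ℂ) R).exists_bound_of_continuousOn hf.continuousOn
  refine MemLp.of_bound hf.aestronglyMeasurable C ?_
  filter_upwards [ae_restrict_mem measurableSet_ball] with x hx
  exact hC x (Metric.ball_subset_closedBall hx)

lemma continuous_testFun {φ : ℂ → ℂ} (hφ : ContDiff ℝ ∞ φ) (e : ℂ) :
    Continuous fun x => fderiv ℝ φ x e :=
  (hφ.continuous_fderiv (by simp)).clm_apply continuous_const

lemma integrable_mul_of_memLp {f g : ℂ → ℂ} (hf : MemLp f 2 (diskMeasure R)) (hg : Continuous g) :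
    Integrable (fun x => f x * g x) (diskMeasure R) :=
  hf.integrable_mul (memLp_diskMeasure_of_continuous hg)

/-- Fundamental lemma of the calculus of variations, for which real test functions suffice. -/
lemma HasWeakDeriv.ae_eq (hw : MemLp w 2 (diskMeasure R)) (hw' : MemLp w' 2 (diskMeasure R))
    (h : HasWeakDeriv R e u w) (h' : HasWeakDeriv R e u w') : w =ᵐ[diskMeasure R] w' := by
  have hint : IntegrableOn (fun x => w x - w' x) (Metric.ball 0 R) :=
    (hw.sub hw').integrable (by norm_num)
  have key := Metric.isOpen_ball.ae_eq_zero_of_integral_contDiff_smul_eq_zero (μ := volume)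
    hint.locallyIntegrableOn (fun g hg hgc hgs => by
      have hg' : ContDiff ℝ ∞ fun x => (g x : ℂ) := Complex.ofRealCLM.contDiff.comp hg
      have hts : tsupport (fun x => (g x : ℂ)) ⊆ tsupport g := by
        refine closure_mono fun x hx => ?_
        simpa using hx
      have hgc' : HasCompactSupport fun x => (g x : ℂ) := hgc.mono' (subset_closure.trans hts)
      have h1 := h _ hg' hgc' (hts.trans hgs)
      have h2 := h' _ hg' hgc' (hts.trans hgs)
      rw [h1, neg_inj] at h2
      have h3 : ∫ x, (w x - w' x) * g x ∂(diskMeasure R) = 0 := by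
        simp only [sub_mul]
        rw [integral_sub (integrable_mul_of_memLp hw hg'.continuous)
          (integrable_mul_of_memLp hw' hg'.continuous), h2, sub_self]
      rw [← h3, diskMeasure, ← setIntegral_eq_integral_of_forall_compl_eq_zero
        (s := Metric.ball 0 R)]
      · refine setIntegral_congr_fun measurableSet_ball fun x _ => ?_
        simp [mul_comm]
      · intro x hx
        rw [image_eq_zero_of_notMem_tsupport fun hx' => hx (hgs hx'), zero_smul])
  refine (ae_restrict_iff' measurableSet_ball).2 ?_
  filter_upwards [key] with x hx hxb
  exact sub_eq_zero.1 (hx hxb)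

lemma weakDeriv_spec (h : ∃ w, MemLp w 2 (diskMeasure R) ∧ HasWeakDeriv R e u w) :
    MemLp (weakDeriv R e u) 2 (diskMeasure R) ∧ HasWeakDeriv R e u (weakDeriv R e u) := by
  rw [weakDeriv, dif_pos h]
  exact h.choose_spec

lemma weakDeriv_ae_eq (hw : MemLp w 2 (diskMeasure R)) (h : HasWeakDeriv R e u w) :
    weakDeriv R e u =ᵐ[diskMeasure R] w :=
  have hs := weakDeriv_spec ⟨w, hw, h⟩
  hs.2.ae_eq hs.1 hw h

lemma HasWeakDeriv.add_smul (hu : MemLp u 2 (diskMeasure R)) (hv : MemLp v 2 (diskMeasure R))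
    (hw : MemLp w 2 (diskMeasure R)) (hw' : MemLp w' 2 (diskMeasure R)) (c : ℂ)
    (h : HasWeakDeriv R e u w) (h' : HasWeakDeriv R e v w') :
    HasWeakDeriv R e (u + c • v) (w + c • w') := by
  intro φ hφ hc hs
  have h1 := h φ hφ hc hs
  have h2 := h' φ hφ hc hs
  have c1 := continuous_testFun hφ e
  simp only [Pi.add_apply, Pi.smul_apply, smul_eq_mul, add_mul, mul_assoc]
  rw [integral_add (integrable_mul_of_memLp hu c1) ((integrable_mul_of_memLp hv c1).const_mul c),
    integral_add (integrable_mul_of_memLp hw hφ.continuous)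
      ((integrable_mul_of_memLp hw' hφ.continuous).const_mul c),
    integral_const_mul, integral_const_mul, h1, h2]
  ring

lemma MemH1.weakDeriv_one (h : MemH1 R u) :
    MemLp (weakDeriv R 1 u) 2 (diskMeasure R) ∧ HasWeakDeriv R 1 u (weakDeriv R 1 u) :=
  weakDeriv_spec h.2.1

lemma MemH1.weakDeriv_I (h : MemH1 R u) :
    MemLp (weakDeriv R Complex.I u) 2 (diskMeasure R) ∧
      HasWeakDeriv R Complex.I u (weakDeriv R Complex.I u) :=
  weakDeriv_spec h.2.2

lemma MemH1.add_smul (hu : MemH1 R u) (hv : MemH1 R v) (c : ℂ) : MemH1 R (u + c • v) := by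
  refine ⟨hu.1.add (hv.1.const_smul c), ⟨_, ?_, (hu.weakDeriv_one.2.add_smul hu.1 hv.1
    hu.weakDeriv_one.1 hv.weakDeriv_one.1 c hv.weakDeriv_one.2)⟩, ⟨_, ?_,
    (hu.weakDeriv_I.2.add_smul hu.1 hv.1 hu.weakDeriv_I.1 hv.weakDeriv_I.1 c hv.weakDeriv_I.2)⟩⟩
  · exact hu.weakDeriv_one.1.add (hv.weakDeriv_one.1.const_smul c)
  · exact hu.weakDeriv_I.1.add (hv.weakDeriv_I.1.const_smul c)

lemma MemH1.weakDeriv_one_add_smul (hu : MemH1 R u) (hv : MemH1 R v) (c : ℂ) :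
    weakDeriv R 1 (u + c • v) =ᵐ[diskMeasure R] weakDeriv R 1 u + c • weakDeriv R 1 v :=
  weakDeriv_ae_eq (hu.weakDeriv_one.1.add (hv.weakDeriv_one.1.const_smul c))
    (hu.weakDeriv_one.2.add_smul hu.1 hv.1 hu.weakDeriv_one.1 hv.weakDeriv_one.1 c
      hv.weakDeriv_one.2)

lemma MemH1.weakDeriv_I_add_smul (hu : MemH1 R u) (hv : MemH1 R v) (c : ℂ) :
    weakDeriv R Complex.I (u + c • v) =ᵐ[diskMeasure R]
      weakDeriv R Complex.I u + c • weakDeriv R Complex.I v :=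
  weakDeriv_ae_eq (hu.weakDeriv_I.1.add (hv.weakDeriv_I.1.const_smul c))
    (hu.weakDeriv_I.2.add_smul hu.1 hv.1 hu.weakDeriv_I.1 hv.weakDeriv_I.1 c hv.weakDeriv_I.2)

/-- The test function is supported inside the disk, so both integrals extend to the plane, where
integration by parts has no boundary term. -/
lemma hasWeakDeriv_of_contDiff (hu : ContDiff ℝ ∞ u) : HasWeakDeriv R e u fun x => fderiv ℝ u x e := by
  intro φ hφ hc hs
  have hd : Differentiable ℝ φ := hφ.differentiable (by simp)
  have hdu : Differentiable ℝ u := hu.differentiable (by simp)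
  have c1 := continuous_testFun hφ e
  have c2 := continuous_testFun hu e
  have hc1 : HasCompactSupport fun x => fderiv ℝ φ x e :=
    (hc.fderiv (𝕜 := ℝ)).comp_left (g := fun L : ℂ →L[ℝ] ℂ => L e) rfl
  have hzero : ∀ x ∉ Metric.ball (0 : ℂ) R, φ x = 0 := fun x hx =>
    image_eq_zero_of_notMem_tsupport fun hx' => hx (hs hx')
  have hzero' : ∀ x ∉ Metric.ball (0 : ℂ) R, fderiv ℝ φ x e = 0 := fun x hx => by
    rw [image_eq_zero_of_notMem_tsupport (f := fderiv ℝ φ) fun hx' =>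
      hx (hs (tsupport_fderiv_subset ℝ hx'))]
    rfl
  rw [diskMeasure, setIntegral_eq_integral_of_forall_compl_eq_zero fun x hx => by
    rw [hzero' x hx, mul_zero], setIntegral_eq_integral_of_forall_compl_eq_zero fun x hx => by
    rw [hzero x hx, mul_zero]]
  refine integral_mul_fderiv_eq_neg_fderiv_mul_of_integrable ?_ ?_ ?_ (fun x _ => hdu x)
    (fun x _ => hd x)
  · exact (c2.mul hφ.continuous).integrable_of_hasCompactSupport hc.mul_left
  · exact (hu.continuous.mul c1).integrable_of_hasCompactSupport hc1.mul_left
  · exact (hu.continuous.mul hφ.continuous).integrable_of_hasCompactSupport hc.mul_left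

lemma memH1_of_contDiff (hu : ContDiff ℝ ∞ u) : MemH1 R u :=
  ⟨memLp_diskMeasure_of_continuous hu.continuous,
    ⟨_, memLp_diskMeasure_of_continuous (continuous_testFun hu 1), hasWeakDeriv_of_contDiff hu⟩,
    ⟨_, memLp_diskMeasure_of_continuous (continuous_testFun hu _), hasWeakDeriv_of_contDiff hu⟩⟩

lemma weakDeriv_ae_eq_of_contDiff (hu : ContDiff ℝ ∞ u) :
    weakDeriv R e u =ᵐ[diskMeasure R] fun x => fderiv ℝ u x e :=
  weakDeriv_ae_eq (memLp_diskMeasure_of_continuous (continuous_testFun hu e))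
    (hasWeakDeriv_of_contDiff hu)

end WeakDeriv

/-! ### Approximation by dilation and mollification -/

section Approximation

open scoped ENNReal

/-- Change of variables with Jacobian factor `t⁻² ≤ 4`. The constant is not optimal; only uniformity
in `t` and `y` matters. -/
lemma eLpNorm_comp_smul_sub_le {W : ℂ → ℂ} (hW : AEStronglyMeasurable W volume) {t : ℝ}
    (ht : 1 / 2 ≤ t) (y : ℂ) :
    eLpNorm (fun x => W (t • x - y)) 2 volume ≤ 4 * eLpNorm W 2 volume := by
  have ht0 : 0 < t := by linarith
  have hm : Measurable fun x : ℂ => t • x - y := by fun_prop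
  have hmap : Measure.map (fun x : ℂ => t • x - y) volume
      = ENNReal.ofReal |(t ^ 2)⁻¹| • volume := by
    have h1 := Measure.map_addHaar_smul (volume : Measure ℂ) ht0.ne'
    rw [Complex.finrank_real_complex] at h1
    rw [show (fun x : ℂ => t • x - y) = (fun x => x - y) ∘ fun x => t • x from rfl,
      ← Measure.map_map (by fun_prop) (by fun_prop), h1, Measure.map_smul,
      (measurePreserving_sub_right volume y).map_eq]
  have h2 := eLpNorm_map_measure (μ := volume) (p := 2) (g := W) (f := fun x : ℂ => t • x - y)
    (by rw [hmap]; exact hW.smul_measure _) hm.aemeasurable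
  rw [hmap, eLpNorm_smul_measure_of_ne_top (by simp)] at h2
  rw [show (fun x => W (t • x - y)) = W ∘ fun x : ℂ => t • x - y from rfl, ← h2, smul_eq_mul]
  gcongr
  have h4 : ENNReal.ofReal |(t ^ 2)⁻¹| ≤ 4 := by
    rw [show (4 : ℝ≥0∞) = ENNReal.ofReal 4 by simp]
    refine ENNReal.ofReal_le_ofReal ?_
    rw [abs_of_pos (by positivity), inv_le_comm₀ (by positivity) (by norm_num)]
    nlinarith
  calc ENNReal.ofReal |(t ^ 2)⁻¹| ^ (1 / (2 : ℝ≥0∞)).toReal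
      ≤ (4 : ℝ≥0∞) ^ (1 / (2 : ℝ≥0∞)).toReal := by gcongr
    _ ≤ (4 : ℝ≥0∞) ^ (1 : ℝ) := ENNReal.rpow_le_rpow_of_exponent_le (by norm_num) (by norm_num)
    _ = 4 := ENNReal.rpow_one 4

lemma exists_eLpNorm_comp_sub_le_of_continuous {g : ℂ → ℂ} (hg : Continuous g)
    (hc : HasCompactSupport g) {ε : ℝ≥0∞} (hε : ε ≠ 0) :
    ∃ δ > 0, ∀ t : ℝ, 1 - δ < t → t < 1 → ∀ y : ℂ, ‖y‖ < δ →
      eLpNorm (fun x => g (t • x - y) - g x) 2 volume ≤ ε := by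
  obtain ⟨M, hM⟩ := hc.isBounded.subset_closedBall (0 : ℂ)
  -- For `t > 1 / 2` and `‖y‖ < 1 / 2`, a point `x` outside the ball of radius `B` has both `x` and
  -- `t x - y` outside the support of `g`.
  set B : ℝ := 2 * (|M| + 1) with hB
  have hB0 : 0 < B := by positivity
  set V : ℝ≥0∞ := volume (Metric.closedBall (0 : ℂ) B) ^ (1 / (2 : ℝ≥0∞).toReal) with hV
  have hVtop : V ≠ ⊤ := ENNReal.rpow_ne_top_of_nonneg (by positivity) measure_closedBall_lt_top.ne
  obtain ⟨η, hη0, hη⟩ : ∃ η : ℝ, 0 < η ∧ ENNReal.ofReal η * V ≤ ε := by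
    rcases eq_or_ne ε ⊤ with rfl | hεt
    · exact ⟨1, one_pos, le_top⟩
    · refine ⟨(ε / (V + 1)).toReal, ENNReal.toReal_pos ?_ ?_, ?_⟩
      · exact ENNReal.div_ne_zero.2 ⟨hε, by simp [hVtop]⟩
      · exact (ENNReal.div_lt_top hεt (by simp)).ne
      · rw [ENNReal.ofReal_toReal (ENNReal.div_lt_top hεt (by simp)).ne]
        calc ε / (V + 1) * V ≤ ε / (V + 1) * (V + 1) := by gcongr; exact le_self_add
          _ = ε := ENNReal.div_mul_cancel (by simp) (by simp [hVtop])
  obtain ⟨d, hd0, hd⟩ := Metric.uniformContinuous_iff.1 (hc.uniformContinuous_of_continuous hg) η hη0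
  -- On the ball of radius `B` the displacement `(1 - t) x + y` is then shorter than `d / (B + 1) *
  -- (B + 1) = d`.
  refine ⟨min (1 / 2) (d / (B + 1)), by positivity, fun t ht1 ht2 y hy => ?_⟩
  have ht : 1 / 2 < t := by linarith [min_le_left (1 / 2) (d / (B + 1))]
  have hy1 : ‖y‖ < 1 / 2 := hy.trans_le (min_le_left _ _)
  have hyd : ‖y‖ < d / (B + 1) := hy.trans_le (min_le_right _ _)
  have htd : 1 - t < d / (B + 1) := by linarith [min_le_right (1 / 2) (d / (B + 1))]
  have hg0 : ∀ z : ℂ, |M| < ‖z‖ → g z = 0 := fun z hz =>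
    image_eq_zero_of_notMem_tsupport fun hz' => by
      have := hM hz'
      rw [mem_closedBall_zero_iff] at this
      linarith [le_abs_self M]
  have hpt : ∀ x, ‖g (t • x - y) - g x‖ ≤
      ‖(Metric.closedBall (0 : ℂ) B).indicator (fun _ => η) x‖ := by
    intro x
    by_cases hx : x ∈ Metric.closedBall (0 : ℂ) B
    · rw [Set.indicator_of_mem hx, Real.norm_eq_abs, abs_of_pos hη0, ← dist_eq_norm]
      refine (hd ?_).le
      rw [mem_closedBall_zero_iff] at hx
      rw [dist_eq_norm, show t • x - y - x = -((1 - t) • x + y) by rw [sub_smul, one_smul]; ring,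
        norm_neg]
      refine (norm_add_le _ _).trans_lt ?_
      rw [norm_smul, Real.norm_eq_abs, abs_of_pos (by linarith)]
      have h1 : (1 - t) * ‖x‖ ≤ d / (B + 1) * B := by
        have := norm_nonneg x
        gcongr
      have h2 : d / (B + 1) * B + d / (B + 1) = d := by field_simp
      linarith
    · rw [mem_closedBall_zero_iff, not_le] at hx
      have h1 : |M| < ‖x‖ := by linarith [abs_nonneg M]
      have h2 : |M| < ‖t • x - y‖ := by
        have := norm_sub_norm_le (t • x) y
        rw [norm_smul, Real.norm_eq_abs, abs_of_pos (by linarith)] at this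
        nlinarith [abs_nonneg M]
      rw [hg0 _ h1, hg0 _ h2]
      simp
  refine (eLpNorm_mono hpt).trans ?_
  rw [eLpNorm_indicator_const measurableSet_closedBall (by simp) (by simp),
    Real.enorm_eq_ofReal hη0.le]
  exact hη

/-- Continuity in `L²` of dilations and translations. -/
lemma exists_eLpNorm_comp_sub_le {W : ℂ → ℂ} (hW : MemLp W 2 volume) {ε : ℝ≥0∞} (hε : ε ≠ 0) :
    ∃ δ > 0, ∀ t : ℝ, 1 - δ < t → t < 1 → ∀ y : ℂ, ‖y‖ < δ →
      eLpNorm (fun x => W (t • x - y) - W x) 2 volume ≤ ε := by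
  -- The budget is `4 + 1 + 1`: the transformed approximation error, the displacement of the
  -- continuous function, and the approximation error itself.
  have hε6 : ε / 6 ≠ 0 := by simp [hε]
  obtain ⟨g, hgc, hgW, hg, hgL⟩ := hW.exists_hasCompactSupport_eLpNorm_sub_le (by simp) hε6
  obtain ⟨δ, hδ, h⟩ := exists_eLpNorm_comp_sub_le_of_continuous hg hgc hε6
  refine ⟨min δ (1 / 2), by positivity, fun t ht1 ht2 y hy => ?_⟩
  have ht1' : 1 - δ < t := by linarith [min_le_left δ (1 / 2)]
  have ht : 1 / 2 ≤ t := by linarith [min_le_right δ (1 / 2)]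
  have h1 := h t ht1' ht2 y (hy.trans_le (min_le_left _ _))
  have hm := hW.aestronglyMeasurable.sub hgL.aestronglyMeasurable
  have h2 := eLpNorm_comp_smul_sub_le hm ht y
  have ht0 : t ≠ 0 := by linarith
  have hqmp : Measure.QuasiMeasurePreserving (fun x : ℂ => t • x - y) volume volume := by
    refine ⟨by fun_prop, ?_⟩
    have h1 := Measure.map_addHaar_smul (volume : Measure ℂ) ht0
    rw [show (fun x : ℂ => t • x - y) = (fun x => x - y) ∘ fun x => t • x from rfl,
      ← Measure.map_map (by fun_prop) (by fun_prop), h1, Measure.map_smul,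
      (measurePreserving_sub_right volume y).map_eq]
    exact Measure.smul_absolutelyContinuous
  have hm2 : AEStronglyMeasurable (fun x => (W - g) (t • x - y)) volume :=
    hm.comp_quasiMeasurePreserving hqmp
  have hm3 : AEStronglyMeasurable (fun x => g (t • x - y) - g x) volume := by
    exact (by fun_prop : Continuous fun x => g (t • x - y) - g x).aestronglyMeasurable
  have hsplit : (fun x => W (t • x - y) - W x)
      = ((fun x => (W - g) (t • x - y)) + fun x => g (t • x - y) - g x) - (W - g) := by
    ext x; simp
  rw [hsplit]
  refine (eLpNorm_sub_le (hm2.add hm3) hm (by norm_num)).trans ?_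
  refine (add_le_add (eLpNorm_add_le hm2 hm3 (by norm_num)) le_rfl).trans ?_
  calc _ ≤ 4 * (ε / 6) + ε / 6 + ε / 6 := by
        gcongr
        exact h2.trans (by gcongr)
    _ = 6 * (ε / 6) := by ring
    _ = ε := ENNReal.mul_div_cancel (by simp) (by simp)

/-- The mollification of `W` by `η`. -/
def mollify (η : ContDiffBump (0 : ℂ)) (W : ℂ → ℂ) (x : ℂ) : ℂ :=
  ∫ y, W y * (η.normed volume (x - y) : ℂ)

/-- The mollified function is an average of translates against the probability measure `ν` with
density `η`. Jensen's inequality, in the form that the `L¹` norm is at most the `L²` norm for `ν`,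
and Tonelli reduce the claim to single translates. Strong measurability of `W` itself is what gives
joint measurability for Tonelli. -/
lemma eLpNorm_mollify_sub_le {W : ℂ → ℂ} (hWm : StronglyMeasurable W) (hW : MemLp W 2 volume)
    {ε : ℝ≥0∞} {t : ℝ} (η : ContDiffBump (0 : ℂ))
    (h : ∀ y : ℂ, ‖y‖ < η.rOut → eLpNorm (fun x => W (t • x - y) - W x) 2 volume ≤ ε) :
    eLpNorm (fun x => mollify η W (t • x) - W x) 2 volume ≤ ε := by
  set k : ℂ → ℝ := η.normed volume with hk
  have hk0 : ∀ y, 0 ≤ k y := η.nonneg_normed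
  have hkc : Continuous k := η.continuous_normed
  have hkm : Measurable fun y => ENNReal.ofReal (k y) := hkc.measurable.ennreal_ofReal
  have hk1 : ∫ y, k y = 1 := η.integral_normed
  set ν : Measure ℂ := volume.withDensity fun y => ENNReal.ofReal (k y) with hν
  have hprob : IsProbabilityMeasure ν := by
    constructor
    rw [hν, withDensity_apply _ MeasurableSet.univ, Measure.restrict_univ,
      ← ofReal_integral_eq_lintegral_ofReal η.integrable_normed (Eventually.of_forall hk0), hk1,
      ENNReal.ofReal_one]
  have hWint : LocallyIntegrable W volume := hW.locallyIntegrable (by norm_num)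
  have hkcs : HasCompactSupport fun y => (k y : ℂ) :=
    (η.hasCompactSupport_normed).comp_left (g := fun r : ℝ => (r : ℂ)) (by simp)
  have hrep : ∀ x, mollify η W (t • x) - W x = ∫ y, (W (t • x - y) - W x) ∂ν := by
    intro x
    have hconv : Integrable (fun y => W (t • x - y) * (k y : ℂ)) volume := by
      have := (hkcs.convolutionExists_right (ContinuousLinearMap.mul ℝ ℂ) hWint
        (Complex.continuous_ofReal.comp hkc) (t • x)).integrable_swap
      simpa using this
    have h1 : mollify η W (t • x) = ∫ y, W (t • x - y) * (k y : ℂ) := by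
      rw [mollify, ← integral_sub_left_eq_self _ volume (t • x)]
      simp [hk]
    have h2 : ∫ y, W x * (k y : ℂ) = W x := by
      rw [integral_const_mul, integral_complex_ofReal, hk1]; simp
    have h3 : Integrable (fun y => W x * (k y : ℂ)) volume :=
      (η.integrable_normed.ofReal).const_mul _
    rw [h1]
    conv_lhs => rw [← h2]
    rw [← integral_sub hconv h3, hν,
      integral_withDensity_eq_integral_toReal_smul hkm (by simp)]
    refine integral_congr_ae (Eventually.of_forall fun y => ?_)
    simp only [ENNReal.toReal_ofReal (hk0 y), Complex.real_smul]
    ring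
  have hmeas : Measurable fun p : ℂ × ℂ => ‖W (t • p.1 - p.2) - W p.1‖ₑ ^ (2 : ℝ) := by
    have : Measurable W := hWm.measurable
    fun_prop
  have hpt : ∀ x, ‖mollify η W (t • x) - W x‖ₑ ^ (2 : ℝ)
      ≤ ∫⁻ y, ‖W (t • x - y) - W x‖ₑ ^ (2 : ℝ) ∂ν := by
    intro x
    have hm : AEStronglyMeasurable (fun y => W (t • x - y) - W x) ν := by
      have : StronglyMeasurable fun y => W (t • x - y) :=
        hWm.comp_measurable (by fun_prop)
      exact (this.sub stronglyMeasurable_const).aestronglyMeasurable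
    rw [hrep x]
    have h1 : ‖∫ y, (W (t • x - y) - W x) ∂ν‖ₑ ≤ eLpNorm (fun y => W (t • x - y) - W x) 2 ν := by
      refine (enorm_integral_le_lintegral_enorm _).trans ?_
      rw [← eLpNorm_one_eq_lintegral_enorm]
      exact eLpNorm_le_eLpNorm_of_exponent_le (by norm_num) hm
    calc _ ≤ (eLpNorm (fun y => W (t • x - y) - W x) 2 ν) ^ (2 : ℝ) := by gcongr
      _ = _ := by
        rw [eLpNorm_eq_lintegral_rpow_enorm_toReal (by simp) (by simp), ← ENNReal.rpow_mul]
        simp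
  rw [eLpNorm_eq_lintegral_rpow_enorm_toReal (by simp) (by simp)]
  simp only [ENNReal.toReal_ofNat]
  have hsq : ∫⁻ x, ‖mollify η W (t • x) - W x‖ₑ ^ (2 : ℝ) ≤ ε ^ (2 : ℝ) := by
    calc ∫⁻ x, ‖mollify η W (t • x) - W x‖ₑ ^ (2 : ℝ)
        ≤ ∫⁻ x, ∫⁻ y, ‖W (t • x - y) - W x‖ₑ ^ (2 : ℝ) ∂ν := lintegral_mono hpt
      _ = ∫⁻ y, (∫⁻ x, ‖W (t • x - y) - W x‖ₑ ^ (2 : ℝ)) ∂ν :=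
        lintegral_lintegral_swap hmeas.aemeasurable
      _ ≤ ∫⁻ _, ε ^ (2 : ℝ) ∂ν := by
        refine lintegral_mono_ae ?_
        rw [hν, ae_withDensity_iff hkm]
        refine Eventually.of_forall fun y hy => ?_
        have hy' : ‖y‖ < η.rOut := by
          have : y ∈ Function.support k := by
            intro h0; simp [h0] at hy
          rw [hk, η.support_normed_eq] at this
          simpa using this
        have h1 := h y hy'
        rw [eLpNorm_eq_lintegral_rpow_enorm_toReal (by simp) (by simp)] at h1
        simp only [ENNReal.toReal_ofNat] at h1
        calc _ = ((∫⁻ x, ‖W (t • x - y) - W x‖ₑ ^ (2 : ℝ)) ^ (1 / (2 : ℝ))) ^ (2 : ℝ) := by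
              rw [← ENNReal.rpow_mul]; simp
          _ ≤ _ := by gcongr
      _ = ε ^ (2 : ℝ) := by simp
  calc _ ≤ (ε ^ (2 : ℝ)) ^ (1 / (2 : ℝ)) := by gcongr
    _ = ε := by rw [← ENNReal.rpow_mul]; simp

lemma hasCompactSupport_ofReal_normed (η : ContDiffBump (0 : ℂ)) :
    HasCompactSupport fun y => (η.normed volume y : ℂ) :=
  η.hasCompactSupport_normed.comp_left (g := fun r : ℝ => (r : ℂ)) (by simp)

lemma contDiff_ofReal_normed (η : ContDiffBump (0 : ℂ)) :
    ContDiff ℝ ((⊤ : ℕ∞) : WithTop ℕ∞) fun y => (η.normed volume y : ℂ) :=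
  Complex.ofRealCLM.contDiff.comp η.contDiff_normed

lemma mollify_eq_convolution (η : ContDiffBump (0 : ℂ)) (W : ℂ → ℂ) :
    mollify η W = convolution W (fun y => (η.normed volume y : ℂ))
      (ContinuousLinearMap.mul ℝ ℂ) volume := by
  ext x
  simp [mollify, convolution_def]

lemma contDiff_mollify (η : ContDiffBump (0 : ℂ)) {W : ℂ → ℂ} (hW : LocallyIntegrable W volume) :
    ContDiff ℝ ((⊤ : ℕ∞) : WithTop ℕ∞) (mollify η W) := by
  rw [mollify_eq_convolution]
  exact (hasCompactSupport_ofReal_normed η).contDiff_convolution_right _ hW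
    (contDiff_ofReal_normed η)

lemma fderiv_mollify (η : ContDiffBump (0 : ℂ)) {W : ℂ → ℂ} (hW : LocallyIntegrable W volume)
    (x e : ℂ) : fderiv ℝ (mollify η W) x e
      = ∫ y, W y * fderiv ℝ (fun y => (η.normed volume y : ℂ)) (x - y) e := by
  have hc := hasCompactSupport_ofReal_normed η
  have hd := contDiff_ofReal_normed η
  rw [mollify_eq_convolution, (hc.hasFDerivAt_convolution_right (ContinuousLinearMap.mul ℝ ℂ) hW
    (hd.of_le (by simp)) x).fderiv, convolution_precompR_apply _ hW (hc.fderiv (𝕜 := ℝ))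
    (hd.continuous_fderiv (by simp))]
  simp [convolution_def]

/-- Mollification commutes with weak derivatives in the interior of the disk. -/
lemma fderiv_mollify_eq {R : ℝ} {e : ℂ} {u w U W : ℂ → ℂ} (η : ContDiffBump (0 : ℂ))
    (hU : LocallyIntegrable U volume) (hUu : U =ᵐ[volume] (Metric.ball 0 R).indicator u)
    (hWw : W =ᵐ[volume] (Metric.ball 0 R).indicator w) (h : HasWeakDeriv R e u w) {z : ℂ}
    (hz : ‖z‖ + η.rOut < R) : fderiv ℝ (mollify η U) z e = mollify η W z := by
  have hc := hasCompactSupport_ofReal_normed η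
  have hd := contDiff_ofReal_normed η
  set k : ℂ → ℂ := fun y => (η.normed volume y : ℂ) with hk
  have hφ : ContDiff ℝ ((⊤ : ℕ∞) : WithTop ℕ∞) fun y => k (z - y) :=
    hd.comp (contDiff_const.sub contDiff_id)
  have hsub : tsupport (fun y => k (z - y)) ⊆ Metric.closedBall z η.rOut := by
    refine closure_minimal (fun y hy => ?_) Metric.isClosed_closedBall
    have h1 : z - y ∈ Function.support (η.normed volume) := by
      intro h0; exact hy (by simp [hk, h0])
    rw [η.support_normed_eq] at h1
    rw [Metric.mem_closedBall, dist_comm, dist_eq_norm]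
    exact (mem_ball_zero_iff.1 h1).le
  have hcs : HasCompactSupport fun y => k (z - y) :=
    (isCompact_closedBall z η.rOut).of_isClosed_subset (isClosed_tsupport _) hsub
  have hball : Metric.closedBall z η.rOut ⊆ Metric.ball 0 R := by
    intro y hy
    rw [mem_ball_zero_iff]
    have h1 : ‖y - z‖ ≤ η.rOut := by rwa [← dist_eq_norm]
    calc ‖y‖ = ‖z + (y - z)‖ := by ring_nf
      _ ≤ ‖z‖ + ‖y - z‖ := norm_add_le _ _
      _ < R := by linarith
  -- The reflected and translated bump is admissible as a test function because its support stays
  -- inside the disk; the reflection changes the sign of its derivative.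
  have key := h _ hφ hcs (hsub.trans hball)
  have hder : ∀ y, fderiv ℝ (fun y => k (z - y)) y e = -fderiv ℝ k (z - y) e := by
    intro y
    have h1 : HasFDerivAt (fun y => z - y) (-ContinuousLinearMap.id ℝ ℂ) y := by
      simpa using (hasFDerivAt_id y).const_sub z
    have h2 := ((hd.differentiable (by simp) (z - y)).hasFDerivAt).comp y h1
    rw [show (fun y => k (z - y)) = k ∘ fun y => z - y from rfl, h2.fderiv]
    simp
  simp only [hder, mul_neg] at key
  rw [integral_neg, neg_inj] at key
  rw [fderiv_mollify η hU, mollify]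
  calc ∫ y, U y * fderiv ℝ k (z - y) e
      = ∫ y, (Metric.ball 0 R).indicator (fun y => u y * fderiv ℝ k (z - y) e) y := by
        refine integral_congr_ae ?_
        filter_upwards [hUu] with y hy
        rw [hy, Set.indicator_mul_left]
    _ = ∫ y, u y * fderiv ℝ k (z - y) e ∂(diskMeasure R) :=
        integral_indicator measurableSet_ball
    _ = ∫ y, w y * k (z - y) ∂(diskMeasure R) := key
    _ = ∫ y, (Metric.ball 0 R).indicator (fun y => w y * k (z - y)) y :=
        (integral_indicator measurableSet_ball).symm
    _ = ∫ y, W y * k (z - y) := by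
        refine integral_congr_ae ?_
        filter_upwards [hWw] with y hy
        rw [hy, Set.indicator_mul_left]

/-- Extension by zero, replaced by a strongly measurable version so that the mollification estimate
applies. -/
lemma exists_rep {R : ℝ} {w : ℂ → ℂ} (hw : MemLp w 2 (diskMeasure R)) :
    ∃ W, StronglyMeasurable W ∧ MemLp W 2 volume ∧
      W =ᵐ[volume] (Metric.ball 0 R).indicator w := by
  have h := (memLp_indicator_iff_restrict measurableSet_ball).2 hw
  exact ⟨h.aestronglyMeasurable.mk _, h.aestronglyMeasurable.stronglyMeasurable_mk,
    h.ae_eq h.aestronglyMeasurable.ae_eq_mk, h.aestronglyMeasurable.ae_eq_mk.symm⟩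

/-- Functions smooth up to the boundary are dense in `H¹` of the disk. -/
theorem MemH1.exists_smooth_approx {R : ℝ} (hR : 0 < R) {u : ℂ → ℂ} (hu : MemH1 R u) {ε : ℝ≥0∞}
    (hε : ε ≠ 0) : ∃ φ : ℂ → ℂ, ContDiff ℝ ((⊤ : ℕ∞) : WithTop ℕ∞) φ ∧
      eLpNorm (fun x => φ x - u x) 2 (diskMeasure R) ≤ ε ∧
      eLpNorm (fun x => fderiv ℝ φ x 1 - weakDeriv R 1 u x) 2 (diskMeasure R) ≤ ε ∧
      eLpNorm (fun x => fderiv ℝ φ x Complex.I - weakDeriv R Complex.I u x) 2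
        (diskMeasure R) ≤ ε := by
  obtain ⟨U, hUm, hU, hUu⟩ := exists_rep hu.1
  obtain ⟨W₁, hW₁m, hW₁, hWu₁⟩ := exists_rep hu.weakDeriv_one.1
  obtain ⟨W₂, hW₂m, hW₂, hWu₂⟩ := exists_rep hu.weakDeriv_I.1
  have hε2 : ε / 2 ≠ 0 := by simp [hε]
  obtain ⟨δ₀, hδ₀, h₀⟩ := exists_eLpNorm_comp_sub_le hU hε2
  obtain ⟨δ₁, hδ₁, h₁⟩ := exists_eLpNorm_comp_sub_le hW₁ hε2
  obtain ⟨δ₂, hδ₂, h₂⟩ := exists_eLpNorm_comp_sub_le hW₂ hε2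
  obtain ⟨τ, hτ0, hτ⟩ : ∃ τ : ℝ, 0 < τ ∧ ∀ s : ℝ, 0 ≤ s → s < τ →
      ENNReal.ofReal s * eLpNorm W₁ 2 volume ≤ ε / 2 ∧
      ENNReal.ofReal s * eLpNorm W₂ 2 volume ≤ ε / 2 := by
    have hlim : ∀ W : ℂ → ℂ, MemLp W 2 volume → ∀ᶠ s : ℝ in 𝓝 0,
        ENNReal.ofReal s * eLpNorm W 2 volume ≤ ε / 2 := by
      intro W hW
      have hc : Tendsto (fun s : ℝ => ENNReal.ofReal s * eLpNorm W 2 volume) (𝓝 0) (𝓝 0) := by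
        have := ENNReal.Tendsto.mul_const (b := eLpNorm W 2 volume)
          (ENNReal.continuous_ofReal.tendsto 0) (Or.inr hW.2.ne)
        simpa using this
      exact (hc.eventually_lt_const (pos_iff_ne_zero.2 hε2)).mono fun s hs => hs.le
    obtain ⟨τ, hτ0, hτ⟩ := Metric.eventually_nhds_iff.1 ((hlim W₁ hW₁).and (hlim W₂ hW₂))
    exact ⟨τ, hτ0, fun s h0 hs => hτ (by simpa [abs_of_nonneg h0] using hs)⟩
  set d : ℝ := min (min (min δ₀ δ₁) (min δ₂ τ)) 1 with hd
  have hd0 : 0 < d := by positivity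
  have hdδ₀ : d ≤ δ₀ := by simp [hd]
  have hdδ₁ : d ≤ δ₁ := by simp [hd]
  have hdδ₂ : d ≤ δ₂ := by simp [hd]
  have hdτ : d ≤ τ := by simp [hd]
  have hd1 : d ≤ 1 := by simp [hd]
  -- The dilation by `t < 1` moves the disk into radius `t R`, and the mollification radius `r` is
  -- smaller than the gap `R (1 - t)`. Hence mollification commutes with the weak derivatives at
  -- every point `t x` with `x` in the disk.
  set t : ℝ := 1 - d / 2 with ht
  have ht0 : 0 < t := by linarith
  have ht1 : t < 1 := by linarith
  set r : ℝ := min d (R * (1 - t)) / 2 with hr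
  have hR1 : 0 < R * (1 - t) := mul_pos hR (by linarith)
  have hr0 : 0 < r := by positivity
  have hrd : r < d := by rw [hr]; linarith [min_le_left d (R * (1 - t))]
  have hrR : r < R * (1 - t) := by rw [hr]; linarith [min_le_right d (R * (1 - t))]
  set η : ContDiffBump (0 : ℂ) := ⟨r / 2, r, by positivity, by linarith⟩
  have hη : η.rOut = r := rfl
  have hUl : LocallyIntegrable U volume := hU.locallyIntegrable (by norm_num)
  have m0 := eLpNorm_mollify_sub_le hUm hU (t := t) η fun y hy => h₀ t (by linarith) ht1 y
    (by linarith)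
  have m1 := eLpNorm_mollify_sub_le hW₁m hW₁ (t := t) η fun y hy => h₁ t (by linarith) ht1 y
    (by linarith)
  have m2 := eLpNorm_mollify_sub_le hW₂m hW₂ (t := t) η fun y hy => h₂ t (by linarith) ht1 y
    (by linarith)
  have hind : ∀ {V v : ℂ → ℂ}, V =ᵐ[volume] (Metric.ball 0 R).indicator v →
      V =ᵐ[diskMeasure R] v := by
    intro V v hV
    filter_upwards [ae_restrict_of_ae hV, ae_restrict_mem measurableSet_ball] with x hx hxb
    rw [hx, Set.indicator_of_mem hxb]
  have hmc := contDiff_mollify η hUl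
  have hder : ∀ {V v : ℂ → ℂ} {e : ℂ}, MemLp V 2 volume →
      V =ᵐ[volume] (Metric.ball 0 R).indicator v → HasWeakDeriv R e u v →
      eLpNorm (fun x => mollify η V (t • x) - V x) 2 volume ≤ ε / 2 →
      ENNReal.ofReal (1 - t) * eLpNorm V 2 volume ≤ ε / 2 →
      eLpNorm (fun x => fderiv ℝ (fun x => mollify η U (t • x)) x e - v x) 2 (diskMeasure R) ≤ ε := by
    intro V v e hV hVv hwd hm hs
    have hVm := (contDiff_mollify η (hV.locallyIntegrable (by norm_num))).continuous
    -- The chain rule produces a factor `t`; the error splits into `t` times the mollification error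
    -- and `(1 - t) V`, the latter being controlled by the choice of `τ`.
    have heq : (fun x => fderiv ℝ (fun x => mollify η U (t • x)) x e - v x) =ᵐ[diskMeasure R]
        ((t : ℂ) • fun x => mollify η V (t • x) - V x) - ((1 - t : ℝ) : ℂ) • V := by
      filter_upwards [hind hVv, ae_restrict_mem measurableSet_ball] with x hx hxb
      have hxb' : ‖x‖ < R := mem_ball_zero_iff.1 hxb
      have h1 : HasFDerivAt (fun x : ℂ => t • x) (t • ContinuousLinearMap.id ℝ ℂ) x :=
        (hasFDerivAt_id x).const_smul t
      have h2 := ((hmc.differentiable (by simp) (t • x)).hasFDerivAt).comp x h1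
      have h3 : fderiv ℝ (fun x => mollify η U (t • x)) x e
          = t * fderiv ℝ (mollify η U) (t • x) e := by
        rw [show (fun x => mollify η U (t • x)) = mollify η U ∘ fun x => t • x from rfl, h2.fderiv]
        simp
      rw [h3, fderiv_mollify_eq η hUl hUu hVv hwd]
      · simp only [Pi.sub_apply, Pi.smul_apply, smul_eq_mul, ← hx]
        push_cast
        ring
      · rw [norm_smul, Real.norm_eq_abs, abs_of_pos ht0, hη]
        nlinarith
    rw [eLpNorm_congr_ae heq]
    refine (eLpNorm_mono_measure _ Measure.restrict_le_self).trans ?_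
    have hm1 : AEStronglyMeasurable (fun x => mollify η V (t • x) - V x) volume :=
      (hVm.comp (continuous_const_smul t)).aestronglyMeasurable.sub hV.aestronglyMeasurable
    refine (eLpNorm_sub_le (hm1.const_smul _) (hV.aestronglyMeasurable.const_smul _)
      (by norm_num)).trans ?_
    rw [eLpNorm_const_smul, eLpNorm_const_smul]
    have e1 : ‖(t : ℂ)‖ₑ ≤ 1 := by
      rw [← ofReal_norm, Complex.norm_real, Real.norm_eq_abs, abs_of_pos ht0]
      exact ENNReal.ofReal_le_one.2 ht1.le
    have e2 : ‖((1 - t : ℝ) : ℂ)‖ₑ = ENNReal.ofReal (1 - t) := by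
      rw [← ofReal_norm, Complex.norm_real, Real.norm_eq_abs, abs_of_pos (by linarith)]
    rw [e2]
    calc _ ≤ 1 * (ε / 2) + ε / 2 := by gcongr
      _ = ε := by rw [one_mul, ENNReal.add_halves]
  have hτ' := hτ (1 - t) (by linarith) (by linarith)
  refine ⟨fun x => mollify η U (t • x), hmc.comp (contDiff_id.const_smul t), ?_,
    hder hW₁ hWu₁ hu.weakDeriv_one.2 m1 hτ'.1, hder hW₂ hWu₂ hu.weakDeriv_I.2 m2 hτ'.2⟩
  have : (fun x => mollify η U (t • x) - u x) =ᵐ[diskMeasure R]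
      fun x => mollify η U (t • x) - U x := by
    filter_upwards [hind hUu] with x hx
    rw [hx]
  rw [eLpNorm_congr_ae this]
  exact (eLpNorm_mono_measure _ Measure.restrict_le_self).trans (m0.trans ENNReal.half_le_self)

end Approximation

/-! ### Polar coordinates -/

instance : IsFiniteMeasure angleMeasure :=
  isFiniteMeasure_restrict.2 measure_Ioc_lt_top.ne

lemma integral_angleMeasure {E : Type*} [NormedAddCommGroup E] [NormedSpace ℝ E] (F : ℝ → E) :
    ∫ θ, F θ ∂angleMeasure = ∫ θ in (0 : ℝ)..(2 * Real.pi), F θ := by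
  rw [intervalIntegral.integral_of_le Real.two_pi_pos.le, angleMeasure]

lemma memLp_angleMeasure_of_continuous {f : ℝ → ℂ} (hf : Continuous f) : MemLp f 2 angleMeasure := by
  obtain ⟨C, hC⟩ := (isCompact_Icc (a := (0 : ℝ)) (b := 2 * Real.pi)).exists_bound_of_continuousOn
    hf.continuousOn
  refine MemLp.of_bound hf.aestronglyMeasurable C ?_
  filter_upwards [ae_restrict_mem measurableSet_Ioc] with x hx
  exact hC x (Set.Ioc_subset_Icc_self hx)

lemma polarCoord_symm_eq_circleMap (p : ℝ × ℝ) :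
    Complex.polarCoord.symm p = circleMap 0 p.1 p.2 := by
  rw [Complex.polarCoord_symm_apply, circleMap, zero_add, Complex.exp_mul_I]
  push_cast
  ring

lemma continuous_circleMap_uncurry : Continuous fun p : ℝ × ℝ => circleMap 0 p.1 p.2 := by
  unfold circleMap
  fun_prop

/-- Polar coordinates use angles in `(-π, π)`; periodicity moves the integral to `(0, 2π]`. -/
lemma integral_diskMeasure {F : ℂ → ℝ} (hF : Continuous F) (R : ℝ) :
    ∫ x, F x ∂(diskMeasure R) =
      ∫ r, (∫ θ, F (circleMap 0 r θ) ∂angleMeasure) ∂(radialMeasure R) := by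
  have hc : Continuous fun p : ℝ × ℝ => p.1 * F (circleMap 0 p.1 p.2) :=
    continuous_fst.mul (hF.comp continuous_circleMap_uncurry)
  have hint : IntegrableOn (fun p : ℝ × ℝ => p.1 * F (circleMap 0 p.1 p.2))
      (Set.Ioo 0 R ×ˢ Set.Ioo (-Real.pi) Real.pi) (volume.prod volume) := by
    refine (hc.continuousOn.integrableOn_compact
      (isCompact_Icc.prod isCompact_Icc : IsCompact (Set.Icc 0 R ×ˢ Set.Icc (-Real.pi) Real.pi))).mono_set ?_
    exact Set.prod_mono Set.Ioo_subset_Icc_self Set.Ioo_subset_Icc_self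
  have hset : Set.Ioo 0 R ×ˢ Set.Ioo (-Real.pi) Real.pi
      = polarCoord.target ∩ {p : ℝ × ℝ | p.1 < R} := by
    ext p
    simp only [polarCoord_target, Set.mem_prod, Set.mem_Ioo, Set.mem_inter_iff, Set.mem_Ioi,
      Set.mem_ofPred_eq]
    tauto
  calc ∫ x, F x ∂(diskMeasure R) = ∫ x, (Metric.ball (0 : ℂ) R).indicator F x :=
        (integral_indicator measurableSet_ball).symm
    _ = ∫ p in polarCoord.target, p.1 • (Metric.ball (0 : ℂ) R).indicator F
          (Complex.polarCoord.symm p) := (Complex.integral_comp_polarCoord_symm _).symm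
    _ = ∫ p in polarCoord.target, ({p : ℝ × ℝ | p.1 < R}).indicator
          (fun p => p.1 * F (circleMap 0 p.1 p.2)) p := by
        refine setIntegral_congr_fun polarCoord.open_target.measurableSet fun p hp => ?_
        have hp0 : 0 < p.1 := by
          rw [polarCoord_target] at hp; exact hp.1
        simp only [polarCoord_symm_eq_circleMap]
        by_cases h : p.1 < R
        · rw [Set.indicator_of_mem (by simpa [abs_of_pos hp0] using h),
            Set.indicator_of_mem (by exact h), smul_eq_mul]
        · rw [Set.indicator_of_notMem (by simpa [abs_of_pos hp0] using h),
            Set.indicator_of_notMem (by exact h), smul_zero]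
    _ = ∫ p in Set.Ioo 0 R ×ˢ Set.Ioo (-Real.pi) Real.pi, p.1 * F (circleMap 0 p.1 p.2) := by
        rw [setIntegral_indicator (measurableSet_lt measurable_fst measurable_const), ← hset]
    _ = ∫ r in Set.Ioo 0 R, ∫ θ in Set.Ioo (-Real.pi) Real.pi, r * F (circleMap 0 r θ) := by
        rw [Measure.volume_eq_prod, setIntegral_prod _ hint]
    _ = _ := by
        rw [integral_radialMeasure]
        refine setIntegral_congr_fun measurableSet_Ioo fun r _ => ?_
        simp only [smul_eq_mul]
        rw [integral_const_mul, ← integral_Ioc_eq_integral_Ioo,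
          ← intervalIntegral.integral_of_le (by linarith [Real.pi_pos]), integral_angleMeasure]
        have hper : Function.Periodic (fun θ => F (circleMap 0 r θ)) (2 * Real.pi) := fun θ => by
          simp only [periodic_circleMap 0 r θ]
        have := hper.intervalIntegral_add_eq (-Real.pi) 0
        rw [zero_add, show -Real.pi + 2 * Real.pi = Real.pi by ring] at this
        rw [this]

lemma integrable_circleMap_prod {F : ℂ → ℝ} (hF : Continuous F) (R : ℝ) :
    Integrable (Function.uncurry fun r θ => F (circleMap 0 r θ))
      ((radialMeasure R).prod angleMeasure) := by
  obtain ⟨C, hC⟩ := (isCompact_closedBall (0 : ℂ) R).exists_bound_of_continuousOn hF.continuousOn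
  refine Integrable.of_bound (hF.comp continuous_circleMap_uncurry).aestronglyMeasurable C ?_
  have : ∀ᵐ p ∂((radialMeasure R).prod angleMeasure), p.1 ∈ Set.Ioo 0 R :=
    Measure.quasiMeasurePreserving_fst.ae (ae_radialMeasure_mem R)
  filter_upwards [this] with p hp
  refine hC _ ?_
  simp [abs_of_pos hp.1, hp.2.le]

lemma integral_diskMeasure_swap {F : ℂ → ℝ} (hF : Continuous F) (R : ℝ) :
    ∫ x, F x ∂(diskMeasure R) =
      ∫ θ, (∫ r, F (circleMap 0 r θ) ∂(radialMeasure R)) ∂angleMeasure := by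
  rw [integral_diskMeasure hF, integral_integral_swap (integrable_circleMap_prod hF R)]

/-! ### The trace inequality -/

lemma hasDerivAt_circleMap_radius (r θ : ℝ) :
    HasDerivAt (fun r => circleMap 0 r θ) (Complex.exp (θ * Complex.I)) r := by
  unfold circleMap
  simpa using ((hasDerivAt_id r).ofReal_comp.mul_const (Complex.exp (θ * Complex.I))).const_add 0

lemma fderiv_exp_mul_I (L : ℂ →L[ℝ] ℂ) (θ : ℝ) :
    L (Complex.exp (θ * Complex.I)) = Real.cos θ * L 1 + Real.sin θ * L Complex.I := by
  rw [Complex.exp_mul_I, ← Complex.ofReal_cos, ← Complex.ofReal_sin,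
    show (Real.cos θ : ℂ) + Real.sin θ * Complex.I
      = Real.cos θ • (1 : ℂ) + Real.sin θ • Complex.I by simp, map_add, map_smul, map_smul]
  simp

lemma fderiv_I_mul_exp (L : ℂ →L[ℝ] ℂ) (θ : ℝ) :
    L (Complex.I * Complex.exp (θ * Complex.I))
      = -Real.sin θ * L 1 + Real.cos θ * L Complex.I := by
  rw [Complex.exp_mul_I, ← Complex.ofReal_cos, ← Complex.ofReal_sin,
    show Complex.I * ((Real.cos θ : ℂ) + Real.sin θ * Complex.I)
      = (-Real.sin θ) • (1 : ℂ) + Real.cos θ • Complex.I by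
        simp only [Complex.real_smul]; push_cast; ring_nf; rw [Complex.I_sq]; ring,
    map_add, map_smul, map_smul]
  simp

lemma norm_sq_rotation (p q : ℂ) (θ : ℝ) :
    ‖(Real.cos θ : ℂ) * p + Real.sin θ * q‖ ^ 2 + ‖-(Real.sin θ : ℂ) * p + Real.cos θ * q‖ ^ 2
      = ‖p‖ ^ 2 + ‖q‖ ^ 2 := by
  simp only [← Complex.normSq_eq_norm_sq, Complex.normSq_apply, Complex.add_re, Complex.add_im,
    Complex.mul_re, Complex.mul_im, Complex.ofReal_re, Complex.ofReal_im, Complex.neg_re,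
    Complex.neg_im]
  have := Real.sin_sq_add_cos_sq θ
  linear_combination (p.re ^ 2 + p.im ^ 2 + q.re ^ 2 + q.im ^ 2) * this

lemma hasDerivAt_comp_circleMap {φ : ℂ → ℂ} (hφ : ContDiff ℝ ∞ φ) (r θ : ℝ) :
    HasDerivAt (fun r => φ (circleMap 0 r θ))
      (fderiv ℝ φ (circleMap 0 r θ) (Complex.exp (θ * Complex.I))) r :=
  ((hφ.differentiable (by simp) _).hasFDerivAt).comp_hasDerivAt r (hasDerivAt_circleMap_radius r θ)

lemma continuous_circleMap_radius (θ : ℝ) : Continuous fun r => circleMap 0 r θ := by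
  unfold circleMap
  fun_prop

/-- Integrate the derivative of `r² |φ|²` along each ray. The weight `r²` kills the contribution of
the centre and leaves a factor `r` for the area element; `2 Re (φ̄ ∂ᵣφ) ≤ |φ|² + |∂ᵣφ|²` and `r² ≤ r
R` give the constants. -/
lemma trace_inequality {φ : ℂ → ℂ} (hφ : ContDiff ℝ ∞ φ) {R : ℝ} (hR : 0 < R) :
    R ^ 2 * ∫ θ, ‖φ (circleMap 0 R θ)‖ ^ 2 ∂angleMeasure ≤
      ∫ x, ((2 + R) * ‖φ x‖ ^ 2 + R * (‖fderiv ℝ φ x 1‖ ^ 2 + ‖fderiv ℝ φ x Complex.I‖ ^ 2))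
        ∂(diskMeasure R) := by
  have hc := hφ.continuous
  have hc1 := continuous_testFun hφ 1
  have hc2 := continuous_testFun hφ Complex.I
  set F : ℂ → ℝ := fun x =>
    (2 + R) * ‖φ x‖ ^ 2 + R * (‖fderiv ℝ φ x 1‖ ^ 2 + ‖fderiv ℝ φ x Complex.I‖ ^ 2) with hF
  have hFc : Continuous F := by fun_prop
  rw [integral_diskMeasure_swap hFc, ← integral_const_mul]
  have hcirc : Continuous fun θ => circleMap 0 R θ := continuous_circleMap 0 R
  refine integral_mono ?_ (integrable_circleMap_prod hFc R).integral_prod_right fun θ => ?_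
  · exact ((memLp_angleMeasure_of_continuous (hc.comp hcirc)).integrable_norm_pow
      (by simp)).const_mul _
  set e := Complex.exp (θ * Complex.I)
  set h : ℝ → ℝ := fun r => r ^ 2 * ‖φ (circleMap 0 r θ)‖ ^ 2 with hh
  have hd : ∀ r, HasDerivAt h (2 * r * ‖φ (circleMap 0 r θ)‖ ^ 2 + r ^ 2 *
      (2 * inner ℝ (φ (circleMap 0 r θ)) (fderiv ℝ φ (circleMap 0 r θ) e))) r := by
    intro r
    have h1 : HasDerivAt (fun r : ℝ => r ^ 2) (2 * r) r := by simpa using hasDerivAt_pow 2 r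
    exact h1.mul (hasDerivAt_comp_circleMap hφ r θ).norm_sq
  have hcr := continuous_circleMap_radius θ
  have hce : Continuous fun r => fderiv ℝ φ (circleMap 0 r θ) e :=
    (continuous_testFun hφ e).comp hcr
  have hcφ : Continuous fun r => φ (circleMap 0 r θ) := hc.comp hcr
  have hcd : Continuous fun r => 2 * r * ‖φ (circleMap 0 r θ)‖ ^ 2 + r ^ 2 *
      (2 * inner ℝ (φ (circleMap 0 r θ)) (fderiv ℝ φ (circleMap 0 r θ) e)) := by fun_prop
  have hftc := intervalIntegral.integral_eq_sub_of_hasDerivAt (fun r _ => hd r)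
    (hcd.intervalIntegrable 0 R)
  have h0 : h R - h 0 = R ^ 2 * ‖φ (circleMap 0 R θ)‖ ^ 2 := by simp [hh]
  rw [h0] at hftc
  simp only
  rw [← hftc, integral_radialMeasure, ← integral_Ioc_eq_integral_Ioo,
    ← intervalIntegral.integral_of_le hR.le]
  have hFr : Continuous fun r => F (circleMap 0 r θ) := hFc.comp hcr
  refine intervalIntegral.integral_mono_on hR.le (hcd.intervalIntegrable _ _)
    ((by fun_prop : Continuous fun r => r • F (circleMap 0 r θ)).intervalIntegrable _ _)
    fun r hr => ?_
  have hi := real_inner_le_norm (φ (circleMap 0 r θ)) (fderiv ℝ φ (circleMap 0 r θ) e)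
  have hrot := norm_sq_rotation (fderiv ℝ φ (circleMap 0 r θ) 1)
    (fderiv ℝ φ (circleMap 0 r θ) Complex.I) θ
  have he : fderiv ℝ φ (circleMap 0 r θ) e = _ := fderiv_exp_mul_I _ θ
  rw [← he] at hrot
  simp only [hF, smul_eq_mul, ← hrot]
  set a := ‖φ (circleMap 0 r θ)‖
  set d := ‖fderiv ℝ φ (circleMap 0 r θ) e‖
  set i := inner ℝ (φ (circleMap 0 r θ)) (fderiv ℝ φ (circleMap 0 r θ) e)
  set n := ‖-(Real.sin θ : ℂ) * (fderiv ℝ φ (circleMap 0 r θ)) 1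
    + Real.cos θ * (fderiv ℝ φ (circleMap 0 r θ)) Complex.I‖
  have h1 : 2 * i ≤ a ^ 2 + d ^ 2 := by nlinarith [sq_nonneg (a - d)]
  have h2 : r ^ 2 * (2 * i) ≤ r * R * (a ^ 2 + d ^ 2) := by
    calc r ^ 2 * (2 * i) ≤ r ^ 2 * (a ^ 2 + d ^ 2) := by gcongr
      _ ≤ r * R * (a ^ 2 + d ^ 2) := by
        gcongr
        nlinarith [hr.1, hr.2]
  have h3 : 0 ≤ r * R * n ^ 2 := by have := hr.1; positivity
  nlinarith

open scoped ENNReal in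
lemma eLpNorm_two_eq {α : Type*} [MeasurableSpace α] {ν : Measure α} {f : α → ℂ}
    (hf : MemLp f 2 ν) : eLpNorm f 2 ν = ENNReal.ofReal √(∫ x, ‖f x‖ ^ 2 ∂ν) := by
  rw [hf.eLpNorm_eq_integral_rpow_norm (by simp) (by simp), Real.sqrt_eq_rpow]
  congr 1
  simp

open scoped ENNReal in
lemma exists_trace_bound {R : ℝ} (hR : 0 < R) : ∃ K : ℝ≥0∞, K ≠ ⊤ ∧
    ∀ φ : ℂ → ℂ, ContDiff ℝ ((⊤ : ℕ∞) : WithTop ℕ∞) φ →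
      eLpNorm (fun θ => φ (circleMap 0 R θ)) 2 angleMeasure ≤
        K * (eLpNorm φ 2 (diskMeasure R) + eLpNorm (fun x => fderiv ℝ φ x 1) 2 (diskMeasure R)
          + eLpNorm (fun x => fderiv ℝ φ x Complex.I) 2 (diskMeasure R)) := by
  set k : ℝ := √((2 + R) / R ^ 2) with hk
  refine ⟨ENNReal.ofReal k, ENNReal.ofReal_ne_top, fun φ hφ => ?_⟩
  have m0 := memLp_diskMeasure_of_continuous (R := R) hφ.continuous
  have m1 := memLp_diskMeasure_of_continuous (R := R) (continuous_testFun hφ 1)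
  have m2 := memLp_diskMeasure_of_continuous (R := R) (continuous_testFun hφ Complex.I)
  have i0 : Integrable (fun x => ‖φ x‖ ^ 2) (diskMeasure R) := m0.integrable_norm_pow (by simp)
  have i1 : Integrable (fun x => ‖fderiv ℝ φ x 1‖ ^ 2) (diskMeasure R) :=
    m1.integrable_norm_pow (by simp)
  have i2 : Integrable (fun x => ‖fderiv ℝ φ x Complex.I‖ ^ 2) (diskMeasure R) :=
    m2.integrable_norm_pow (by simp)
  have m3 : MemLp (fun θ => φ (circleMap 0 R θ)) 2 angleMeasure :=
    memLp_angleMeasure_of_continuous (hφ.continuous.comp (continuous_circleMap 0 R))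
  rw [eLpNorm_two_eq m0, eLpNorm_two_eq m1, eLpNorm_two_eq m2, eLpNorm_two_eq m3,
    ← ENNReal.ofReal_add (by positivity) (by positivity),
    ← ENNReal.ofReal_add (by positivity) (by positivity), ← ENNReal.ofReal_mul (by positivity)]
  refine ENNReal.ofReal_le_ofReal ?_
  have hi := trace_inequality hφ hR
  have i3 : Integrable (fun x => ‖fderiv ℝ φ x 1‖ ^ 2 + ‖fderiv ℝ φ x Complex.I‖ ^ 2)
    (diskMeasure R) := i1.add i2
  rw [integral_add (i0.const_mul _) (i3.const_mul _), integral_const_mul,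
    integral_const_mul, integral_add i1 i2] at hi
  set A := ∫ x, ‖φ x‖ ^ 2 ∂(diskMeasure R)
  set B := ∫ x, ‖fderiv ℝ φ x 1‖ ^ 2 ∂(diskMeasure R)
  set C := ∫ x, ‖fderiv ℝ φ x Complex.I‖ ^ 2 ∂(diskMeasure R)
  have hA : 0 ≤ A := integral_nonneg fun x => by positivity
  have hB : 0 ≤ B := integral_nonneg fun x => by positivity
  have hC : 0 ≤ C := integral_nonneg fun x => by positivity
  refine Real.sqrt_le_iff.2 ⟨by positivity, ?_⟩
  rw [mul_pow, Real.sq_sqrt (by positivity), div_mul_eq_mul_div, le_div_iff₀ (by positivity)]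
  have h1 : A + B + C ≤ (√A + √B + √C) ^ 2 := by
    have := Real.sq_sqrt hA; have := Real.sq_sqrt hB; have := Real.sq_sqrt hC
    nlinarith [mul_nonneg (Real.sqrt_nonneg A) (Real.sqrt_nonneg B),
      mul_nonneg (Real.sqrt_nonneg A) (Real.sqrt_nonneg C),
      mul_nonneg (Real.sqrt_nonneg B) (Real.sqrt_nonneg C)]
  have h2 := mul_le_mul_of_nonneg_left h1 (by positivity : 0 ≤ 2 + R)
  nlinarith

/-! ### Traces -/

section Trace

open scoped ENNReal

variable {R : ℝ} {u v : ℂ → ℂ} {g g' : ℝ → ℂ}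

/-- The `H¹` distance of a smooth function `φ` to `u`. -/
def h1Dist (R : ℝ) (u φ : ℂ → ℂ) : ℝ≥0∞ :=
  eLpNorm (fun x => φ x - u x) 2 (diskMeasure R)
    + eLpNorm (fun x => fderiv ℝ φ x 1 - weakDeriv R 1 u x) 2 (diskMeasure R)
    + eLpNorm (fun x => fderiv ℝ φ x Complex.I - weakDeriv R Complex.I u x) 2 (diskMeasure R)

lemma eLpNorm_sub_le_of_common {α : Type*} [MeasurableSpace α] {ν : Measure α} {f g h : α → ℂ}
    (hf : MemLp f 2 ν) (hg : MemLp g 2 ν) (hh : MemLp h 2 ν) :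
    eLpNorm (fun x => f x - g x) 2 ν
      ≤ eLpNorm (fun x => f x - h x) 2 ν + eLpNorm (fun x => g x - h x) 2 ν := by
  have h1 : (fun x => f x - g x) = (f - h) - (g - h) := by ext x; simp
  rw [h1]
  exact eLpNorm_sub_le (hf.sub hh).1 (hg.sub hh).1 (by norm_num)

/-- The trace inequality for `φ - ψ`, with the `H¹` distance measured through `u`. It gives both
existence and uniqueness of the trace. -/
lemma exists_trace_sub_bound (hR : 0 < R) : ∃ K : ℝ≥0∞, K ≠ ⊤ ∧ ∀ u : ℂ → ℂ, MemH1 R u →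
    ∀ φ ψ : ℂ → ℂ, ContDiff ℝ ((⊤ : ℕ∞) : WithTop ℕ∞) φ → ContDiff ℝ ((⊤ : ℕ∞) : WithTop ℕ∞) ψ →
      eLpNorm (fun θ => φ (circleMap 0 R θ) - ψ (circleMap 0 R θ)) 2 angleMeasure ≤
        K * (h1Dist R u φ + h1Dist R u ψ) := by
  obtain ⟨K, hK, h⟩ := exists_trace_bound hR
  refine ⟨K, hK, fun u hu φ ψ hφ hψ => ?_⟩
  refine (h _ (hφ.sub hψ)).trans (mul_le_mul' le_rfl ?_)
  have hfd : ∀ e x, fderiv ℝ (fun x => φ x - ψ x) x e = fderiv ℝ φ x e - fderiv ℝ ψ x e :=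
    fun e x => by
      rw [show (fun x => φ x - ψ x) = φ - ψ from rfl, fderiv_sub (hφ.differentiable (by simp) x)
        (hψ.differentiable (by simp) x)]
      rfl
  simp only [hfd]
  have b0 := eLpNorm_sub_le_of_common (memLp_diskMeasure_of_continuous (R := R) hφ.continuous)
    (memLp_diskMeasure_of_continuous hψ.continuous) hu.1
  have b1 := eLpNorm_sub_le_of_common
    (memLp_diskMeasure_of_continuous (R := R) (continuous_testFun hφ 1))
    (memLp_diskMeasure_of_continuous (continuous_testFun hψ 1)) hu.weakDeriv_one.1
  have b2 := eLpNorm_sub_le_of_common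
    (memLp_diskMeasure_of_continuous (R := R) (continuous_testFun hφ Complex.I))
    (memLp_diskMeasure_of_continuous (continuous_testFun hψ Complex.I)) hu.weakDeriv_I.1
  refine (add_le_add (add_le_add b0 b1) b2).trans (le_of_eq ?_)
  simp only [h1Dist]
  ring

/-- Smooth approximations with errors `2⁻ⁿ` have boundary values forming a fast Cauchy sequence in
`L²`. -/
lemma MemH1.exists_isTrace (hR : 0 < R) (hu : MemH1 R u) : ∃ g, IsTrace R u g := by
  obtain ⟨K, hK, hKb⟩ := exists_trace_sub_bound hR
  have hε : ∀ n : ℕ, ((2 : ℝ≥0∞)⁻¹) ^ n ≠ 0 := fun n => pow_ne_zero _ (by simp)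
  choose φ hφ h0 h1 h2 using fun n => hu.exists_smooth_approx hR (hε n)
  have hdist : ∀ n, h1Dist R u (φ n) ≤ 3 * (2 : ℝ≥0∞)⁻¹ ^ n := fun n => by
    refine (add_le_add (add_le_add (h0 n) (h1 n)) (h2 n)).trans (le_of_eq ?_)
    ring
  have hmem : ∀ n, MemLp (fun θ => φ n (circleMap 0 R θ)) 2 angleMeasure := fun n =>
    memLp_angleMeasure_of_continuous ((hφ n).continuous.comp (continuous_circleMap 0 R))
  -- Two `H¹` distances, each at most `3 * 2⁻ᴺ`, give `6 K`; the extra `1` makes the inequality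
  -- strict even when `K = 0`.
  obtain ⟨g, hg, hlim⟩ := Lp.cauchy_complete_eLpNorm (by norm_num) hmem
    (B := fun n => (6 * K + 1) * (2 : ℝ≥0∞)⁻¹ ^ n) (by
      rw [ENNReal.tsum_mul_left, ENNReal.tsum_geometric]
      refine ENNReal.mul_ne_top (ENNReal.add_ne_top.2 ⟨ENNReal.mul_ne_top (by simp) hK, by simp⟩) ?_
      rw [ENNReal.one_sub_inv_two]
      simp) (fun N n m hn hm => by
      refine (hKb u hu _ _ (hφ n) (hφ m)).trans_lt ?_
      have e1 : ∀ n, N ≤ n → (2 : ℝ≥0∞)⁻¹ ^ n ≤ (2 : ℝ≥0∞)⁻¹ ^ N := fun n hn =>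
        pow_le_pow_right_of_le_one' (by simp) hn
      have hN0 : (2 : ℝ≥0∞)⁻¹ ^ N ≠ 0 := hε N
      have hNt : (2 : ℝ≥0∞)⁻¹ ^ N ≠ ⊤ := ENNReal.pow_ne_top (by simp)
      calc K * (h1Dist R u (φ n) + h1Dist R u (φ m))
          ≤ K * (3 * (2 : ℝ≥0∞)⁻¹ ^ N + 3 * (2 : ℝ≥0∞)⁻¹ ^ N) := by
            gcongr
            · exact (hdist n).trans (mul_le_mul' le_rfl (e1 n hn))
            · exact (hdist m).trans (mul_le_mul' le_rfl (e1 m hm))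
        _ = 6 * K * (2 : ℝ≥0∞)⁻¹ ^ N := by ring
        _ < 6 * K * (2 : ℝ≥0∞)⁻¹ ^ N + (2 : ℝ≥0∞)⁻¹ ^ N :=
            ENNReal.lt_add_right (ENNReal.mul_ne_top (ENNReal.mul_ne_top (by simp) hK) hNt) hN0
        _ = _ := by ring)
  have hpow : Tendsto (fun n : ℕ => (2 : ℝ≥0∞)⁻¹ ^ n) atTop (𝓝 0) :=
    ENNReal.tendsto_pow_atTop_nhds_zero_of_lt_one (by simp)
  exact ⟨g, hg, φ, hφ, tendsto_of_tendsto_of_tendsto_of_le_of_le tendsto_const_nhds hpow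
    (fun _ => zero_le) h0, tendsto_of_tendsto_of_tendsto_of_le_of_le tendsto_const_nhds hpow
    (fun _ => zero_le) h1, tendsto_of_tendsto_of_tendsto_of_le_of_le tendsto_const_nhds hpow
    (fun _ => zero_le) h2, hlim⟩

lemma IsTrace.ae_eq (hR : 0 < R) (hu : MemH1 R u) (hg : IsTrace R u g) (hg' : IsTrace R u g') :
    g =ᵐ[angleMeasure] g' := by
  obtain ⟨K, hK, hKb⟩ := exists_trace_sub_bound hR
  obtain ⟨hgm, φ, hφ, a0, a1, a2, a3⟩ := hg
  obtain ⟨hgm', ψ, hψ, b0, b1, b2, b3⟩ := hg'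
  have hcont : ∀ χ : ℂ → ℂ, ContDiff ℝ ((⊤ : ℕ∞) : WithTop ℕ∞) χ →
      MemLp (fun θ => χ (circleMap 0 R θ)) 2 angleMeasure := fun χ hχ =>
    memLp_angleMeasure_of_continuous (hχ.continuous.comp (continuous_circleMap 0 R))
  have hle : ∀ n, eLpNorm (fun θ => g θ - g' θ) 2 angleMeasure ≤
      eLpNorm (fun θ => φ n (circleMap 0 R θ) - g θ) 2 angleMeasure
        + (K * (h1Dist R u (φ n) + h1Dist R u (ψ n))
        + eLpNorm (fun θ => ψ n (circleMap 0 R θ) - g' θ) 2 angleMeasure) := by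
    intro n
    have e1 : (fun θ => g θ - g' θ) = (((fun θ => φ n (circleMap 0 R θ) - ψ n (circleMap 0 R θ))
        + fun θ => ψ n (circleMap 0 R θ) - g' θ)) - fun θ => φ n (circleMap 0 R θ) - g θ := by
      ext θ; simp
    have mφ := hcont _ (hφ n)
    have mψ := hcont _ (hψ n)
    have m1 : MemLp (fun θ => φ n (circleMap 0 R θ) - ψ n (circleMap 0 R θ)) 2 angleMeasure :=
      mφ.sub mψ
    have m2 : MemLp (fun θ => ψ n (circleMap 0 R θ) - g' θ) 2 angleMeasure := mψ.sub hgm'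
    have m3 : MemLp (fun θ => φ n (circleMap 0 R θ) - g θ) 2 angleMeasure := mφ.sub hgm
    rw [e1]
    refine (eLpNorm_sub_le (m1.add m2).1 m3.1 one_le_two).trans ?_
    rw [add_comm]
    gcongr
    refine (eLpNorm_add_le m1.1 m2.1 one_le_two).trans ?_
    gcongr
    exact hKb u hu _ _ (hφ n) (hψ n)
  have hlim : Tendsto (fun n => eLpNorm (fun θ => φ n (circleMap 0 R θ) - g θ) 2 angleMeasure
        + (K * (h1Dist R u (φ n) + h1Dist R u (ψ n))
        + eLpNorm (fun θ => ψ n (circleMap 0 R θ) - g' θ) 2 angleMeasure)) atTop (𝓝 0) := by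
    have t1 : Tendsto (fun n => h1Dist R u (φ n)) atTop (𝓝 0) := by
      simpa [h1Dist] using (a0.add a1).add a2
    have t2 : Tendsto (fun n => h1Dist R u (ψ n)) atTop (𝓝 0) := by
      simpa [h1Dist] using (b0.add b1).add b2
    have t3 := ENNReal.Tendsto.const_mul (a := K) (t1.add t2) (Or.inr hK)
    simpa using a3.add (t3.add b3)
  have hzero : eLpNorm (fun θ => g θ - g' θ) 2 angleMeasure = 0 :=
    le_antisymm (ge_of_tendsto' hlim hle) zero_le
  filter_upwards [(eLpNorm_eq_zero_iff (hgm.sub hgm').1 (by norm_num)).1 hzero] with θ hθ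
  exact sub_eq_zero.1 hθ

lemma MemH1.isTrace_trace (hR : 0 < R) (hu : MemH1 R u) : IsTrace R u (trace R u) := by
  have h := hu.exists_isTrace hR
  rw [trace, dif_pos h]
  exact h.choose_spec

lemma MemH1.trace_ae_eq (hR : 0 < R) (hu : MemH1 R u) (hg : IsTrace R u g) :
    trace R u =ᵐ[angleMeasure] g :=
  (hu.isTrace_trace hR).ae_eq hR hu hg

lemma tendsto_eLpNorm_add_smul {α : Type*} [MeasurableSpace α] {ν : Measure α}
    {a b : ℕ → α → ℂ} {f g : α → ℂ} (ha : ∀ n, MemLp (a n) 2 ν) (hb : ∀ n, MemLp (b n) 2 ν)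
    (hf : MemLp f 2 ν) (hg : MemLp g 2 ν) (c : ℂ)
    (h1 : Tendsto (fun n => eLpNorm (fun x => a n x - f x) 2 ν) atTop (𝓝 0))
    (h2 : Tendsto (fun n => eLpNorm (fun x => b n x - g x) 2 ν) atTop (𝓝 0)) :
    Tendsto (fun n => eLpNorm (fun x => (a n x + c * b n x) - (f x + c * g x)) 2 ν)
      atTop (𝓝 0) := by
  have h3 := ENNReal.Tendsto.const_mul (a := ‖c‖ₑ) h2 (Or.inr enorm_ne_top)
  have h4 := h1.add h3
  rw [mul_zero, add_zero] at h4
  refine tendsto_of_tendsto_of_tendsto_of_le_of_le tendsto_const_nhds h4 (fun _ => zero_le)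
    fun n => ?_
  have e1 : (fun x => (a n x + c * b n x) - (f x + c * g x))
      = (a n - f) + c • (b n - g) := by
    ext x; simp; ring
  simp only [e1]
  refine (eLpNorm_add_le ((ha n).sub hf).1 (((hb n).sub hg).const_smul c).1 (by norm_num)).trans ?_
  rw [eLpNorm_const_smul]
  exact le_rfl

lemma IsTrace.add_smul (hu : MemH1 R u) (hv : MemH1 R v) (hg : IsTrace R u g)
    (hg' : IsTrace R v g') (c : ℂ) : IsTrace R (u + c • v) (g + c • g') := by
  obtain ⟨hgm, φ, hφ, a0, a1, a2, a3⟩ := hg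
  obtain ⟨hgm', ψ, hψ, b0, b1, b2, b3⟩ := hg'
  have hfd : ∀ n e x, fderiv ℝ (fun x => φ n x + c * ψ n x) x e
      = fderiv ℝ (φ n) x e + c * fderiv ℝ (ψ n) x e := by
    intro n e x
    have h1 := ((hφ n).differentiable (by simp) x).hasFDerivAt.add
      (((hψ n).differentiable (by simp) x).hasFDerivAt.const_mul c)
    rw [show (fun x => φ n x + c * ψ n x) = φ n + fun y => c * ψ n y from rfl, h1.fderiv]
    simp
  have mem : ∀ χ : ℂ → ℂ, Continuous χ → MemLp χ 2 (diskMeasure R) := fun χ hχ =>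
    memLp_diskMeasure_of_continuous hχ
  refine ⟨hgm.add (hgm'.const_smul c), fun n x => φ n x + c * ψ n x,
    fun n => (hφ n).add (contDiff_const.mul (hψ n)), ?_, ?_, ?_, ?_⟩
  · exact tendsto_eLpNorm_add_smul (fun n => mem _ (hφ n).continuous)
      (fun n => mem _ (hψ n).continuous) hu.1 hv.1 c a0 b0
  · refine (tendsto_eLpNorm_add_smul (fun n => mem _ (continuous_testFun (hφ n) 1))
      (fun n => mem _ (continuous_testFun (hψ n) 1)) hu.weakDeriv_one.1 hv.weakDeriv_one.1
      c a1 b1).congr fun n => eLpNorm_congr_ae ?_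
    filter_upwards [hu.weakDeriv_one_add_smul hv c] with x hx
    rw [hx, hfd]
    simp
  · refine (tendsto_eLpNorm_add_smul (fun n => mem _ (continuous_testFun (hφ n) Complex.I))
      (fun n => mem _ (continuous_testFun (hψ n) Complex.I)) hu.weakDeriv_I.1 hv.weakDeriv_I.1
      c a2 b2).congr fun n => eLpNorm_congr_ae ?_
    filter_upwards [hu.weakDeriv_I_add_smul hv c] with x hx
    rw [hx, hfd]
    simp
  · exact tendsto_eLpNorm_add_smul
      (fun n => memLp_angleMeasure_of_continuous
        ((hφ n).continuous.comp (continuous_circleMap 0 R)))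
      (fun n => memLp_angleMeasure_of_continuous
        ((hψ n).continuous.comp (continuous_circleMap 0 R))) hgm hgm' c a3 b3

lemma MemH1.trace_add_smul (hR : 0 < R) (hu : MemH1 R u) (hv : MemH1 R v) (c : ℂ) :
    trace R (u + c • v) =ᵐ[angleMeasure] trace R u + c • trace R v :=
  (hu.add_smul hv c).trace_ae_eq hR
    ((hu.isTrace_trace hR).add_smul hu hv (hv.isTrace_trace hR) c)

lemma isTrace_of_contDiff {φ : ℂ → ℂ} (hφ : ContDiff ℝ ((⊤ : ℕ∞) : WithTop ℕ∞) φ) :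
    IsTrace R φ fun θ => φ (circleMap 0 R θ) := by
  refine ⟨memLp_angleMeasure_of_continuous (hφ.continuous.comp (continuous_circleMap 0 R)),
    fun _ => φ, fun _ => hφ, ?_, ?_, ?_, ?_⟩
  · simp
  · refine tendsto_const_nhds.congr fun _ => (eLpNorm_zero (ε := ℂ)).symm.trans
      (eLpNorm_congr_ae ?_)
    filter_upwards [weakDeriv_ae_eq_of_contDiff (R := R) (e := 1) hφ] with x hx
    simp [hx]
  · refine tendsto_const_nhds.congr fun _ => (eLpNorm_zero (ε := ℂ)).symm.trans
      (eLpNorm_congr_ae ?_)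
    filter_upwards [weakDeriv_ae_eq_of_contDiff (R := R) (e := Complex.I) hφ] with x hx
    simp [hx]
  · simp

end Trace

/-! ### The form on smooth functions -/

/-- First component of the magnetic gradient of a differentiable function. -/
def magGrad1 (b : ℝ) (φ : ℂ → ℂ) (x : ℂ) : ℂ :=
  fderiv ℝ φ x 1 - Complex.I * b * ((-x.im / 2 : ℝ) : ℂ) * φ x

/-- Second component of the magnetic gradient of a differentiable function. -/
def magGrad2 (b : ℝ) (φ : ℂ → ℂ) (x : ℂ) : ℂ :=
  fderiv ℝ φ x Complex.I - Complex.I * b * ((x.re / 2 : ℝ) : ℂ) * φ x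

/-- The magnetic Robin form of a smooth function. -/
def smoothForm (β b R : ℝ) (φ : ℂ → ℂ) : ℝ :=
  (∫ x, (‖magGrad1 b φ x‖ ^ 2 + ‖magGrad2 b φ x‖ ^ 2) ∂(diskMeasure R))
    + β * ∫ θ, ‖φ (circleMap 0 R θ)‖ ^ 2 * R ∂angleMeasure

/-- The radial derivative in polar coordinates. -/
def radDeriv (φ : ℂ → ℂ) (r θ : ℝ) : ℂ :=
  fderiv ℝ φ (circleMap 0 r θ) (Complex.exp (θ * Complex.I))

/-- The normalized angular derivative in polar coordinates. -/
def angDeriv (φ : ℂ → ℂ) (r θ : ℝ) : ℂ :=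
  fderiv ℝ φ (circleMap 0 r θ) (Complex.I * Complex.exp (θ * Complex.I))

section Polar

variable {β b R : ℝ} {φ : ℂ → ℂ}

lemma continuous_magGrad1 (hφ : ContDiff ℝ ∞ φ) : Continuous (magGrad1 b φ) := by
  have := continuous_testFun hφ 1
  have := hφ.continuous
  have h : Continuous fun x : ℂ => (-x.im / 2 : ℝ) := by fun_prop
  have := Complex.continuous_ofReal.comp h
  unfold magGrad1
  fun_prop

lemma continuous_magGrad2 (hφ : ContDiff ℝ ∞ φ) : Continuous (magGrad2 b φ) := by
  have := continuous_testFun hφ Complex.I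
  have := hφ.continuous
  unfold magGrad2
  fun_prop

/-- The potential is tangential with length `r / 2`, so rotating the frame to the radial and angular
directions leaves it only in the angular component. -/
lemma norm_sq_magGrad (b : ℝ) (φ : ℂ → ℂ) (r θ : ℝ) :
    ‖magGrad1 b φ (circleMap 0 r θ)‖ ^ 2 + ‖magGrad2 b φ (circleMap 0 r θ)‖ ^ 2
      = ‖radDeriv φ r θ‖ ^ 2
        + ‖angDeriv φ r θ - Complex.I * ((b * r / 2 : ℝ) : ℂ) * φ (circleMap 0 r θ)‖ ^ 2 := by
  have hre : (circleMap 0 r θ).re = r * Real.cos θ := by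
    simp [circleMap, Complex.exp_re]
  have him : (circleMap 0 r θ).im = r * Real.sin θ := by
    simp [circleMap, Complex.exp_im]
  rw [← norm_sq_rotation _ _ θ]
  have hcs : (Real.sin θ : ℂ) ^ 2 + (Real.cos θ : ℂ) ^ 2 = 1 := by
    exact_mod_cast Real.sin_sq_add_cos_sq θ
  congr 3
  · rw [radDeriv, fderiv_exp_mul_I, magGrad1, magGrad2, hre, him]
    push_cast
    ring
  · rw [angDeriv, fderiv_I_mul_exp, magGrad1, magGrad2, hre, him]
    push_cast at hcs ⊢
    linear_combination (-Complex.I * b * r / 2 * φ (circleMap 0 r θ)) * hcs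

lemma continuous_radDeriv (hφ : ContDiff ℝ ∞ φ) :
    Continuous fun p : ℝ × ℝ => radDeriv φ p.1 p.2 := by
  have h1 := (hφ.continuous_fderiv (by simp)).comp continuous_circleMap_uncurry
  exact h1.clm_apply (by fun_prop)

lemma continuous_angDeriv (hφ : ContDiff ℝ ∞ φ) :
    Continuous fun p : ℝ × ℝ => angDeriv φ p.1 p.2 := by
  have h1 := (hφ.continuous_fderiv (by simp)).comp continuous_circleMap_uncurry
  exact h1.clm_apply (by fun_prop)

lemma hasDerivAt_comp_circleMap_angle (hφ : ContDiff ℝ ∞ φ) (r θ : ℝ) :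
    HasDerivAt (fun θ => φ (circleMap 0 r θ)) (r * angDeriv φ r θ) θ := by
  have h := ((hφ.differentiable (by simp) (circleMap 0 r θ)).hasFDerivAt).comp_hasDerivAt θ
    (hasDerivAt_circleMap 0 r θ)
  refine h.congr_deriv ?_
  rw [angDeriv, show circleMap 0 r θ * Complex.I
    = r • (Complex.I * Complex.exp (θ * Complex.I)) by
      simp only [circleMap, zero_add, Complex.real_smul]; ring, map_smul, Complex.real_smul]

/-! ### Fourier coefficients in the angular variable -/

/-- The `k`-th Fourier coefficient of a function of the polar angle. -/
def angCoeff (f : ℝ → ℂ) (k : ℤ) : ℂ := fourierCoeffOn Real.two_pi_pos f k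

lemma angCoeff_eq (f : ℝ → ℂ) (k : ℤ) :
    angCoeff f k = (1 / (2 * Real.pi - 0)) • ∫ θ in (0 : ℝ)..(2 * Real.pi),
      fourier (-k) (θ : AddCircle (2 * Real.pi - 0)) • f θ :=
  fourierCoeffOn_eq_integral f k Real.two_pi_pos

lemma continuous_fourier_coe (k : ℤ) :
    Continuous fun θ : ℝ => fourier k (θ : AddCircle (2 * Real.pi - 0)) :=
  (fourier k).continuous.comp (AddCircle.continuous_mk' _)

lemma hasSum_sq_angCoeff {f : ℝ → ℂ} (hf : Continuous f) :
    HasSum (fun k => ‖angCoeff f k‖ ^ 2)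
      ((2 * Real.pi)⁻¹ * ∫ θ, ‖f θ‖ ^ 2 ∂angleMeasure) := by
  have := hasSum_sq_fourierCoeffOn Real.two_pi_pos (memLp_angleMeasure_of_continuous hf)
  rwa [sub_zero, smul_eq_mul, ← integral_angleMeasure] at this

lemma angCoeff_sub_const_mul {f g : ℝ → ℂ} (hf : Continuous f) (hg : Continuous g) (c : ℂ) (k : ℤ) :
    angCoeff (fun θ => f θ - c * g θ) k = angCoeff f k - c * angCoeff g k := by
  have hc := continuous_fourier_coe (-k)
  simp only [angCoeff_eq, smul_eq_mul, mul_sub, Complex.real_smul]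
  have i1 : IntervalIntegrable (fun θ : ℝ =>
      fourier (-k) (θ : AddCircle (2 * Real.pi - 0)) * f θ) volume 0 (2 * Real.pi) :=
    (hc.mul hf).intervalIntegrable _ _
  have i2 : IntervalIntegrable (fun θ : ℝ =>
      fourier (-k) (θ : AddCircle (2 * Real.pi - 0)) * (c * g θ)) volume 0 (2 * Real.pi) :=
    (hc.mul (continuous_const.mul hg)).intervalIntegrable _ _
  rw [intervalIntegral.integral_sub i1 i2, show (fun θ : ℝ => fourier (-k) (θ : AddCircle (2 * Real.pi - 0)) * (c * g θ))
    = fun θ : ℝ => c * (fourier (-k) (θ : AddCircle (2 * Real.pi - 0)) * g θ) by ext; ring,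
    intervalIntegral.integral_const_mul]
  ring

/-- Integration by parts over a period; for `k = 0` it reduces to the fundamental theorem of
calculus. -/
lemma angCoeff_deriv {f f' : ℝ → ℂ} (hf : ∀ θ, HasDerivAt f (f' θ) θ) (hf' : Continuous f')
    (hper : f (2 * Real.pi) = f 0) (k : ℤ) : angCoeff f' k = Complex.I * k * angCoeff f k := by
  rcases eq_or_ne k 0 with rfl | hk
  · rw [angCoeff_eq]
    simp only [neg_zero, fourier_zero, one_smul, Int.cast_zero, mul_zero, zero_mul]
    rw [intervalIntegral.integral_eq_sub_of_hasDerivAt (fun θ _ => hf θ)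
      (hf'.intervalIntegrable _ _), hper, sub_self, smul_zero]
  · have h := fourierCoeffOn_of_hasDerivAt Real.two_pi_pos hk (fun θ _ => hf θ)
      (hf'.intervalIntegrable _ _)
    rw [hper, sub_self, mul_zero] at h
    change angCoeff f k = _ * (0 - _ * angCoeff f' k) at h
    rw [h]
    have hπ : (Real.pi : ℂ) ≠ 0 := by exact_mod_cast Real.pi_ne_zero
    have hk' : (k : ℂ) ≠ 0 := by exact_mod_cast hk
    push_cast
    have hI := Complex.I_ne_zero
    field_simp
    ring

lemma continuous_angCoeff {F : ℝ → ℝ → ℂ} (hF : Continuous fun p : ℝ × ℝ => F p.1 p.2) (k : ℤ) :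
    Continuous fun r => angCoeff (F r) k := by
  simp only [angCoeff_eq, Complex.real_smul]
  refine Continuous.mul continuous_const ?_
  refine intervalIntegral.continuous_parametric_intervalIntegral_of_continuous' ?_ _ _
  exact ((continuous_fourier_coe (-k)).comp continuous_snd).smul hF

lemma hasDerivAt_angCoeff {F F' : ℝ → ℝ → ℂ} (hF : Continuous fun p : ℝ × ℝ => F p.1 p.2)
    (hF' : Continuous fun p : ℝ × ℝ => F' p.1 p.2)
    (hd : ∀ r θ, HasDerivAt (fun r => F r θ) (F' r θ) r) (k : ℤ) (r : ℝ) :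
    HasDerivAt (fun r => angCoeff (F r) k) (angCoeff (F' r) k) r := by
  have hc := continuous_fourier_coe (-k)
  simp only [angCoeff_eq, Complex.real_smul]
  refine HasDerivAt.const_mul _ ?_
  obtain ⟨C, hC⟩ := ((isCompact_Icc (a := r - 1) (b := r + 1)).prod
    (isCompact_Icc (a := (0 : ℝ)) (b := 2 * Real.pi))).exists_bound_of_continuousOn hF'.continuousOn
  have hs : ∀ r, Continuous fun θ => F r θ := fun r => hF.comp (by fun_prop : Continuous fun θ => (r, θ))
  have hs' : ∀ r, Continuous fun θ => F' r θ := fun r =>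
    hF'.comp (by fun_prop : Continuous fun θ => (r, θ))
  refine (intervalIntegral.hasDerivAt_integral_of_dominated_loc_of_deriv_le
    (bound := fun _ => C) (F := fun r (θ : ℝ) =>
      fourier (-k) (θ : AddCircle (2 * Real.pi - 0)) • F r θ)
    (F' := fun r (θ : ℝ) => fourier (-k) (θ : AddCircle (2 * Real.pi - 0)) • F' r θ)
    (Icc_mem_nhds (by linarith : r - 1 < r) (by linarith : r < r + 1)) ?_ ?_ ?_ ?_ ?_ ?_).2
  · exact Eventually.of_forall fun r => (hc.smul (hs r)).aestronglyMeasurable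
  · exact (hc.smul (hs r)).intervalIntegrable _ _
  · exact (hc.smul (hs' r)).aestronglyMeasurable
  · refine Eventually.of_forall fun θ hθ r' hr' => ?_
    rw [Set.uIoc_of_le Real.two_pi_pos.le] at hθ
    rw [norm_smul, fourier_apply, Circle.norm_coe, one_mul]
    exact hC (r', θ) ⟨hr', Set.Ioc_subset_Icc_self hθ⟩
  · exact intervalIntegrable_const
  · exact Eventually.of_forall fun θ _ r' _ => by
      simpa only [smul_eq_mul] using (hd r' θ).const_mul (fourier (-k) (θ : AddCircle _))

/-- The radial Fourier coefficient functions of `φ`. -/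
def radCoeff (φ : ℂ → ℂ) (k : ℤ) (r : ℝ) : ℂ := angCoeff (fun θ => φ (circleMap 0 r θ)) k

lemma continuous_circleMap_comp (hφ : ContDiff ℝ ∞ φ) :
    Continuous fun p : ℝ × ℝ => φ (circleMap 0 p.1 p.2) :=
  hφ.continuous.comp continuous_circleMap_uncurry

lemma hasDerivAt_radCoeff (hφ : ContDiff ℝ ∞ φ) (k : ℤ) (r : ℝ) :
    HasDerivAt (radCoeff φ k) (angCoeff (radDeriv φ r) k) r :=
  hasDerivAt_angCoeff (continuous_circleMap_comp hφ) (continuous_radDeriv hφ)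
    (fun r θ => hasDerivAt_comp_circleMap hφ r θ) k r

lemma contDiff_radCoeff (hφ : ContDiff ℝ ∞ φ) (k : ℤ) : ContDiff ℝ 1 (radCoeff φ k) := by
  refine contDiff_one_iff_deriv.2 ⟨fun r => (hasDerivAt_radCoeff hφ k r).differentiableAt, ?_⟩
  rw [show deriv (radCoeff φ k) = fun r => angCoeff (radDeriv φ r) k from
    funext fun r => (hasDerivAt_radCoeff hφ k r).deriv]
  exact continuous_angCoeff (continuous_radDeriv hφ) k

lemma continuous_slice {F : ℝ → ℝ → ℂ} (hF : Continuous fun p : ℝ × ℝ => F p.1 p.2) (r : ℝ) :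
    Continuous (F r) :=
  hF.comp (by fun_prop : Continuous fun θ : ℝ => (r, θ))

lemma continuous_comp_circleMap_angle (hφ : ContDiff ℝ ∞ φ) (r : ℝ) :
    Continuous fun θ => φ (circleMap 0 r θ) :=
  hφ.continuous.comp (continuous_circleMap 0 r)

/-- Since `∂_θ` equals `r` times the normalized angular derivative, the factor `r` stays on the left
and no division at the centre occurs. -/
lemma mul_angCoeff_angDeriv (hφ : ContDiff ℝ ∞ φ) (k : ℤ) (r : ℝ) :
    (r : ℂ) * angCoeff (angDeriv φ r) k = Complex.I * k * radCoeff φ k r := by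
  have hc := continuous_slice (continuous_angDeriv hφ) r
  have h := angCoeff_deriv (hasDerivAt_comp_circleMap_angle hφ r) (continuous_const.mul hc)
    (by simp [circleMap]) k
  rw [radCoeff, ← h]
  exact (fourierCoeffOn.const_mul (angDeriv φ r) (r : ℂ) k Real.two_pi_pos).symm

/-- The singular quotient `k a_k / r` is `-i` times a Fourier coefficient of the normalized angular
derivative, hence bounded up to the centre. -/
lemma memFiberDom_radCoeff (hφ : ContDiff ℝ ∞ φ) (k : ℤ) : MemFiberDom k R (radCoeff φ k) := by
  refine memFiberDom_of_contDiff (contDiff_radCoeff hφ k) ?_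
  have h1 : MemLp (fun r => -Complex.I * angCoeff (angDeriv φ r) k) 2 (radialMeasure R) :=
    memLp_radialMeasure_of_continuous
      (continuous_const.mul (continuous_angCoeff (continuous_angDeriv hφ) k))
  refine h1.ae_eq ?_
  filter_upwards [ae_radialMeasure_mem R] with r hr
  have hr0 : (r : ℂ) ≠ 0 := by exact_mod_cast hr.1.ne'
  have h := mul_angCoeff_angDeriv hφ k r
  push_cast
  rw [eq_comm, div_mul_eq_mul_div, div_eq_iff hr0]
  linear_combination Complex.I * h + ((k : ℂ) * radCoeff φ k r) * Complex.I_sq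

/-- Needed because high modes are compared with the fiber of angular momentum zero, whose form is
evaluated at the same function. -/
lemma memFiberDom_zero_radCoeff (hφ : ContDiff ℝ ∞ φ) (k : ℤ) :
    MemFiberDom 0 R (radCoeff φ k) :=
  memFiberDom_of_contDiff (contDiff_radCoeff hφ k) (by simp)

/-! ### Decomposition of the disk form into fiber forms -/

lemma hasSum_integral_of_nonneg {α : Type*} [MeasurableSpace α] {ν : Measure α}
    {f : ℤ → α → ℝ} {g : α → ℝ} (hf0 : ∀ k x, 0 ≤ f k x) (hf : ∀ k, Integrable (f k) ν)
    (hg : Integrable g ν) (hs : ∀ᵐ x ∂ν, HasSum (fun k => f k x) (g x)) :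
    HasSum (fun k => ∫ x, f k x ∂ν) (∫ x, g x ∂ν) := by
  have hsum : Summable fun k => ∫ x, ‖f k x‖ ∂ν := by
    refine summable_of_sum_le (c := ∫ x, g x ∂ν)
      (fun k => integral_nonneg fun x => norm_nonneg _) fun s => ?_
    rw [← integral_finsetSum s fun k _ => (hf k).norm]
    refine integral_mono_ae (integrable_finsetSum s fun k _ => (hf k).norm) hg ?_
    filter_upwards [hs] with x hx
    simp only [Real.norm_of_nonneg (hf0 _ x)]
    exact sum_le_hasSum s (fun k _ => hf0 k x) hx
  have h := hasSum_integral_of_summable_integral_norm hf hsum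
  rwa [integral_congr_ae (g := g)] at h
  filter_upwards [hs] with x hx using hx.tsum_eq

/-- Parseval on each circle for the radial and the magnetic angular derivative, integrated in `r`,
and once more on the boundary circle. The `k`-th coefficient of the magnetic angular derivative is
`i` times `fiberPot`. -/
lemma hasSum_fiberForm (hφ : ContDiff ℝ ∞ φ) :
    HasSum (fun k => fiberForm β b k R (radCoeff φ k)) ((2 * Real.pi)⁻¹ * smoothForm β b R φ) := by
  set F : ℂ → ℝ := fun x => ‖magGrad1 b φ x‖ ^ 2 + ‖magGrad2 b φ x‖ ^ 2 with hF
  have hFc : Continuous F := by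
    have := continuous_magGrad1 (b := b) hφ
    have := continuous_magGrad2 (b := b) hφ
    fun_prop
  have hb := (hasSum_sq_angCoeff (continuous_comp_circleMap_angle hφ R)).mul_left (β * R)
  have hdom : ∀ k, MemFiberDom k R (radCoeff φ k) := fun k => memFiberDom_radCoeff hφ k
  have hmain : HasSum (fun k => ∫ r, (‖deriv (radCoeff φ k) r‖ ^ 2
      + ‖fiberPot b k (radCoeff φ k) r‖ ^ 2) ∂(radialMeasure R))
      (∫ r, (2 * Real.pi)⁻¹ * (∫ θ, F (circleMap 0 r θ) ∂angleMeasure) ∂(radialMeasure R)) := by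
    refine hasSum_integral_of_nonneg (fun k r => by positivity) (fun k => ?_) ?_ ?_
    · exact ((hdom k).2.2.1.integrable_norm_pow (by simp)).add
        (((hdom k).memLp_fiberPot b).integrable_norm_pow (by simp))
    · exact (integrable_circleMap_prod hFc R).integral_prod_left.const_mul _
    · filter_upwards [ae_radialMeasure_mem R] with r hr
      have c0 := continuous_comp_circleMap_angle hφ r
      have c1 := continuous_slice (continuous_radDeriv hφ) r
      have c2 := continuous_slice (continuous_angDeriv hφ) r
      have c3 : Continuous fun θ => angDeriv φ r θ
          - Complex.I * ((b * r / 2 : ℝ) : ℂ) * φ (circleMap 0 r θ) := c2.sub (continuous_const.mul c0)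
      have s1 := hasSum_sq_angCoeff c1
      have s2 := hasSum_sq_angCoeff c3
      have s3 := s1.add s2
      rw [← mul_add, ← integral_add
        ((memLp_angleMeasure_of_continuous c1).integrable_norm_pow (by simp))
        ((memLp_angleMeasure_of_continuous c3).integrable_norm_pow (by simp))] at s3
      simp only [hF, norm_sq_magGrad]
      refine s3.congr_fun fun k => ?_
      rw [(hasDerivAt_radCoeff hφ k r).deriv]
      congr 2
      rw [angCoeff_sub_const_mul c2 c0]
      have h := mul_angCoeff_angDeriv hφ k r
      have hr0 : (r : ℂ) ≠ 0 := by exact_mod_cast hr.1.ne'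
      have h2 : angCoeff (angDeriv φ r) k = Complex.I * k * radCoeff φ k r / r := by
        rw [← h]; field_simp
      have h3 : angCoeff (angDeriv φ r) k - Complex.I * ((b * r / 2 : ℝ) : ℂ) *
          angCoeff (fun θ => φ (circleMap 0 r θ)) k = Complex.I * fiberPot b k (radCoeff φ k) r := by
        rw [h2, fiberPot, radCoeff]
        push_cast
        ring
      rw [h3, norm_mul, Complex.norm_I, one_mul]
  have htot := hmain.add hb
  have hval : (2 * Real.pi)⁻¹ * smoothForm β b R φ
      = (∫ r, (2 * Real.pi)⁻¹ * (∫ θ, F (circleMap 0 r θ) ∂angleMeasure) ∂(radialMeasure R))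
        + β * R * ((2 * Real.pi)⁻¹ * ∫ θ, ‖φ (circleMap 0 R θ)‖ ^ 2 ∂angleMeasure) := by
    rw [smoothForm, integral_diskMeasure hFc, integral_const_mul, integral_mul_const]
    ring
  simp only [fiberForm_eq]
  rw [hval]
  exact htot

lemma hasSum_integral_radCoeff (hφ : ContDiff ℝ ∞ φ) :
    HasSum (fun k => ∫ r, ‖radCoeff φ k r‖ ^ 2 ∂(radialMeasure R))
      ((2 * Real.pi)⁻¹ * ∫ x, ‖φ x‖ ^ 2 ∂(diskMeasure R)) := by
  have hFc : Continuous fun x => ‖φ x‖ ^ 2 := by have := hφ.continuous; fun_prop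
  rw [integral_diskMeasure hFc, ← integral_const_mul]
  refine hasSum_integral_of_nonneg (fun k r => by positivity) (fun k => ?_) ?_ ?_
  · exact (memFiberDom_radCoeff (R := R) hφ k).2.1.integrable_norm_pow (by simp)
  · exact (integrable_circleMap_prod hFc R).integral_prod_left.const_mul _
  · exact Eventually.of_forall fun r =>
      hasSum_sq_angCoeff (continuous_comp_circleMap_angle hφ r)

/-- Lower bounds for the fiber forms give a lower bound for the form of the disk. -/
theorem le_smoothForm {μ : ℝ} (hφ : ContDiff ℝ ∞ φ)
    (h : ∀ (k : ℤ) (f : ℝ → ℂ), MemFiberDom k R f → MemFiberDom 0 R f →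
      μ * ∫ r, ‖f r‖ ^ 2 ∂(radialMeasure R) ≤ fiberForm β b k R f) :
    μ * ∫ x, ‖φ x‖ ^ 2 ∂(diskMeasure R) ≤ smoothForm β b R φ := by
  have h1 := hasSum_le (fun k => h k _ (memFiberDom_radCoeff hφ k) (memFiberDom_zero_radCoeff hφ k))
    ((hasSum_integral_radCoeff (R := R) hφ).mul_left μ) (hasSum_fiberForm (β := β) (b := b) hφ)
  have hπ := Real.two_pi_pos
  rw [mul_left_comm] at h1
  exact le_of_mul_le_mul_left h1 (by positivity)

/-! ### The planar ground state -/

/-- The planar function `z ^ m G(|z|²)`. -/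
def planarFun (m : ℕ) (G : ℝ → ℝ) (z : ℂ) : ℂ := z ^ m * (G (‖z‖ ^ 2) : ℂ)

variable {m : ℕ} {G : ℝ → ℝ}

lemma contDiff_planarFun (hG : ContDiff ℝ ∞ G) : ContDiff ℝ ∞ (planarFun m G) :=
  (contDiff_id.pow m).mul (Complex.ofRealCLM.contDiff.comp (hG.comp (contDiff_norm_sq ℝ)))

lemma planarFun_circleMap (r θ : ℝ) :
    planarFun m G (circleMap 0 r θ) = radialFun m G r * Complex.exp (m * (θ * Complex.I)) := by
  rw [planarFun, radialFun, norm_circleMap_zero, sq_abs, circleMap, zero_add, mul_pow,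
    ← Complex.exp_nat_mul]
  push_cast
  ring

lemma norm_exp_nat_mul (θ : ℝ) : ‖Complex.exp (m * (θ * Complex.I))‖ = 1 := by
  rw [Complex.exp_nat_mul, norm_pow, Complex.norm_exp_ofReal_mul_I, one_pow]

lemma integral_const_angleMeasure (c : ℝ) : ∫ _, c ∂angleMeasure = 2 * Real.pi * c := by
  rw [integral_angleMeasure, intervalIntegral.integral_const, sub_zero, smul_eq_mul]

lemma integral_norm_planarFun (hG : ContDiff ℝ ∞ G) :
    ∫ x, ‖planarFun m G x‖ ^ 2 ∂(diskMeasure R)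
      = 2 * Real.pi * ∫ r, ‖(radialFun m G r : ℂ)‖ ^ 2 ∂(radialMeasure R) := by
  have hc : Continuous fun x => ‖planarFun m G x‖ ^ 2 := by
    have := (contDiff_planarFun (m := m) hG).continuous
    fun_prop
  rw [integral_diskMeasure hc, ← integral_const_mul]
  simp only [planarFun_circleMap, norm_mul, norm_exp_nat_mul, mul_one, integral_const_angleMeasure]

/-- The angular dependence is the unimodular factor `exp (i m θ)`, so the density does not depend on
the angle and equals the fiber density. -/
lemma smoothForm_planarFun (hG : ContDiff ℝ ∞ G) :
    smoothForm β b R (planarFun m G)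
      = 2 * Real.pi * fiberForm β b m R (fun r => (radialFun m G r : ℂ)) := by
  have hφ := contDiff_planarFun (m := m) hG
  have hc : Continuous fun x => ‖magGrad1 b (planarFun m G) x‖ ^ 2
      + ‖magGrad2 b (planarFun m G) x‖ ^ 2 := by
    have := continuous_magGrad1 (b := b) hφ
    have := continuous_magGrad2 (b := b) hφ
    fun_prop
  rw [smoothForm, integral_diskMeasure hc, fiberForm_eq, mul_add]
  congr 1
  · rw [← integral_const_mul]
    refine integral_congr_ae ?_
    filter_upwards [ae_radialMeasure_mem R] with r hr
    have hr0 : (r : ℂ) ≠ 0 := by exact_mod_cast hr.1.ne'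
    rw [← integral_const_angleMeasure]
    refine integral_congr_ae (Eventually.of_forall fun θ => ?_)
    simp only [norm_sq_magGrad]

    have hd : HasDerivAt (fun r => (radialFun m G r : ℂ))
        (deriv (fun r => (radialFun m G r : ℂ)) r) r :=
      ((Complex.ofRealCLM.contDiff.comp (radialFun_contDiff m hG)).differentiable
        (by simp) r).hasDerivAt
    have h1 : radDeriv (planarFun m G) r θ
        = deriv (fun r => (radialFun m G r : ℂ)) r * Complex.exp (m * (θ * Complex.I)) := by
      refine (hasDerivAt_comp_circleMap hφ r θ).unique ?_
      simp only [planarFun_circleMap]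
      exact hd.mul_const _
    have h2 : (r : ℂ) * angDeriv (planarFun m G) r θ
        = radialFun m G r * (Complex.exp (m * (θ * Complex.I)) * (m * Complex.I)) := by
      refine (hasDerivAt_comp_circleMap_angle hφ r θ).unique ?_
      simp only [planarFun_circleMap]
      have h3 : HasDerivAt (fun θ : ℝ => (m : ℂ) * (θ * Complex.I)) (m * Complex.I) θ := by
        simpa using ((hasDerivAt_id θ).ofReal_comp.mul_const Complex.I).const_mul (m : ℂ)
      exact h3.cexp.const_mul _
    have h4 : angDeriv (planarFun m G) r θ
        - Complex.I * ((b * r / 2 : ℝ) : ℂ) * planarFun m G (circleMap 0 r θ)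
        = Complex.I * fiberPot b m (fun r => (radialFun m G r : ℂ)) r
          * Complex.exp (m * (θ * Complex.I)) := by
      have h5 : angDeriv (planarFun m G) r θ
          = radialFun m G r * (Complex.exp (m * (θ * Complex.I)) * (m * Complex.I)) / r := by
        rw [← h2]; field_simp
      rw [h5, planarFun_circleMap, fiberPot]
      push_cast
      ring
    rw [h1, h4, norm_mul, norm_mul, norm_mul, norm_exp_nat_mul, Complex.norm_I]
    simp
  · simp only [planarFun_circleMap, norm_mul, norm_exp_nat_mul, mul_one, integral_const_angleMeasure]
    ring

end Polar

/-! ### The form on the Sobolev space -/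

lemma tendsto_integral_norm_sq {α : Type*} [MeasurableSpace α] {ν : Measure α}
    {a : ℕ → α → ℂ} {f : α → ℂ} (ha : ∀ n, MemLp (a n) 2 ν) (hf : MemLp f 2 ν)
    (h : Tendsto (fun n => eLpNorm (fun x => a n x - f x) 2 ν) atTop (𝓝 0)) :
    Tendsto (fun n => ∫ x, ‖a n x‖ ^ 2 ∂ν) atTop (𝓝 (∫ x, ‖f x‖ ^ 2 ∂ν)) := by
  have key : ∀ g : α → ℂ, ∀ hg : MemLp g 2 ν, ‖hg.toLp g‖ ^ 2 = ∫ x, ‖g x‖ ^ 2 ∂ν := by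
    intro g hg
    have h0 : 0 ≤ ∫ x, ‖g x‖ ^ 2 ∂ν := integral_nonneg fun x => by positivity
    rw [Lp.norm_toLp, eLpNorm_two_eq hg, ENNReal.toReal_ofReal (Real.sqrt_nonneg _),
      Real.sq_sqrt h0]
  have h1 := (((Lp.tendsto_Lp_iff_tendsto_eLpNorm'' a ha f hf).2 h).norm).pow 2
  simpa only [key] using h1

section Form

variable {β b R μ : ℝ} {u v : ℂ → ℂ}

lemma MemLp.bounded_mul_disk {p : ℂ → ℝ} (hp : Continuous p) (hu : MemLp u 2 (diskMeasure R)) :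
    MemLp (fun x => Complex.I * b * (p x : ℂ) * u x) 2 (diskMeasure R) := by
  have hc : Continuous fun x => Complex.I * b * (p x : ℂ) :=
    continuous_const.mul (Complex.continuous_ofReal.comp hp)
  obtain ⟨C, hC⟩ := (isCompact_closedBall (0 : ℂ) R).exists_bound_of_continuousOn hc.continuousOn
  refine hu.of_le_mul (c := C) (hc.aestronglyMeasurable.mul hu.1) ?_
  filter_upwards [ae_restrict_mem measurableSet_ball] with x hx
  rw [norm_mul]
  exact mul_le_mul_of_nonneg_right (hC x (Metric.ball_subset_closedBall hx)) (norm_nonneg _)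

lemma MemH1.memLp_magD1 (b : ℝ) (hu : MemH1 R u) : MemLp (magD1 b R u) 2 (diskMeasure R) :=
  hu.weakDeriv_one.1.sub (MemLp.bounded_mul_disk (by fun_prop) hu.1)

lemma MemH1.memLp_magD2 (b : ℝ) (hu : MemH1 R u) : MemLp (magD2 b R u) 2 (diskMeasure R) :=
  hu.weakDeriv_I.1.sub (MemLp.bounded_mul_disk (by fun_prop) hu.1)

lemma MemH1.memLp_trace (hR : 0 < R) (hu : MemH1 R u) : MemLp (trace R u) 2 angleMeasure :=
  (hu.isTrace_trace hR).1

lemma MemH1.form_eq (β b : ℝ) (hu : MemH1 R u) :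
    form β b R u = (∫ x, ‖magD1 b R u x‖ ^ 2 ∂(diskMeasure R))
      + (∫ x, ‖magD2 b R u x‖ ^ 2 ∂(diskMeasure R))
      + β * R * ∫ θ, ‖trace R u θ‖ ^ 2 ∂angleMeasure := by
  rw [form, integral_add ((hu.memLp_magD1 b).integrable_norm_pow (by simp))
    ((hu.memLp_magD2 b).integrable_norm_pow (by simp)), integral_mul_const]
  ring

lemma MemH1.sesqForm_eq (β b : ℝ) (hu : MemH1 R u) (hv : MemH1 R v) :
    sesqForm β b R u v = (∫ x, magD1 b R u x * conj (magD1 b R v x) ∂(diskMeasure R))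
      + (∫ x, magD2 b R u x * conj (magD2 b R v x) ∂(diskMeasure R))
      + β * R * ∫ θ, trace R u θ * conj (trace R v θ) ∂angleMeasure := by
  rw [sesqForm, integral_add (integrable_mul_conj (hu.memLp_magD1 b) (hv.memLp_magD1 b))
    (integrable_mul_conj (hu.memLp_magD2 b) (hv.memLp_magD2 b)), integral_mul_const]
  ring

lemma form_add_smul (hR : 0 < R) (hu : MemH1 R u) (hv : MemH1 R v) (c : ℂ) :
    form β b R (u + c • v) = form β b R u
      + 2 * (conj c * sesqForm β b R u v).re + ‖c‖ ^ 2 * form β b R v := by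
  rw [(hu.add_smul hv c).form_eq, hu.form_eq, hv.form_eq, hu.sesqForm_eq β b hv]
  have e1 : ∫ x, ‖magD1 b R (u + c • v) x‖ ^ 2 ∂(diskMeasure R)
      = ∫ x, ‖magD1 b R u x + c * magD1 b R v x‖ ^ 2 ∂(diskMeasure R) := by
    refine integral_congr_ae ?_
    filter_upwards [hu.weakDeriv_one_add_smul hv c] with x hx
    simp only [magD1, hx, Pi.add_apply, Pi.smul_apply, smul_eq_mul]
    ring_nf
  have e2 : ∫ x, ‖magD2 b R (u + c • v) x‖ ^ 2 ∂(diskMeasure R)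
      = ∫ x, ‖magD2 b R u x + c * magD2 b R v x‖ ^ 2 ∂(diskMeasure R) := by
    refine integral_congr_ae ?_
    filter_upwards [hu.weakDeriv_I_add_smul hv c] with x hx
    simp only [magD2, hx, Pi.add_apply, Pi.smul_apply, smul_eq_mul]
    ring_nf
  have e3 : ∫ θ, ‖trace R (u + c • v) θ‖ ^ 2 ∂angleMeasure
      = ∫ θ, ‖trace R u θ + c * trace R v θ‖ ^ 2 ∂angleMeasure := by
    refine integral_congr_ae ?_
    filter_upwards [hu.trace_add_smul hR hv c] with x hx
    simp only [hx, Pi.add_apply, Pi.smul_apply, smul_eq_mul]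
  have e4 (z : ℂ) : (conj c * (β * R * z)).re = β * R * (conj c * z).re := by
    rw [show conj c * (β * R * z) = ((β * R : ℝ) : ℂ) * (conj c * z) by push_cast; ring,
      Complex.re_ofReal_mul]
  rw [e1, e2, e3, integral_norm_add_mul_sq (hu.memLp_magD1 b) (hv.memLp_magD1 b),
    integral_norm_add_mul_sq (hu.memLp_magD2 b) (hv.memLp_magD2 b),
    integral_norm_add_mul_sq (hu.memLp_trace hR) (hv.memLp_trace hR), mul_add (conj c),
    mul_add (conj c), Complex.add_re, Complex.add_re, e4]
  ring

lemma sesqForm_self (hu : MemH1 R u) : sesqForm β b R u u = form β b R u := by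
  rw [hu.sesqForm_eq β b hu, hu.form_eq]
  simp only [Complex.mul_conj']
  push_cast
  rw [← integral_complex_ofReal, ← integral_complex_ofReal, ← integral_complex_ofReal]
  push_cast
  rfl

/-- On smooth functions the form is given by the classical derivatives and boundary values. -/
lemma form_of_contDiff (hR : 0 < R) {φ : ℂ → ℂ} (hφ : ContDiff ℝ ∞ φ) :
    form β b R φ = smoothForm β b R φ := by
  rw [form, smoothForm]
  congr 1
  · refine integral_congr_ae ?_
    filter_upwards [weakDeriv_ae_eq_of_contDiff (R := R) (e := 1) hφ,
      weakDeriv_ae_eq_of_contDiff (R := R) (e := Complex.I) hφ] with x h1 h2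
    rw [magD1, magD2, h1, h2, magGrad1, magGrad2]
  · congr 1
    refine integral_congr_ae ?_
    filter_upwards [(memH1_of_contDiff hφ).trace_ae_eq hR (isTrace_of_contDiff hφ)] with θ hθ
    rw [hθ]

lemma tendsto_eLpNorm_sub_bounded_mul {p : ℂ → ℝ} (hp : Continuous p) {a d : ℕ → ℂ → ℂ}
    {u w : ℂ → ℂ} (ha : ∀ n, MemLp (a n) 2 (diskMeasure R))
    (hd : ∀ n, MemLp (d n) 2 (diskMeasure R)) (hu : MemLp u 2 (diskMeasure R))
    (hw : MemLp w 2 (diskMeasure R))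
    (h1 : Tendsto (fun n => eLpNorm (fun x => d n x - w x) 2 (diskMeasure R)) atTop (𝓝 0))
    (h2 : Tendsto (fun n => eLpNorm (fun x => a n x - u x) 2 (diskMeasure R)) atTop (𝓝 0)) :
    Tendsto (fun n => eLpNorm (fun x => (d n x - Complex.I * b * (p x : ℂ) * a n x)
      - (w x - Complex.I * b * (p x : ℂ) * u x)) 2 (diskMeasure R)) atTop (𝓝 0) := by
  have hc : Continuous fun x => Complex.I * b * (p x : ℂ) :=
    continuous_const.mul (Complex.continuous_ofReal.comp hp)
  obtain ⟨C, hC⟩ := (isCompact_closedBall (0 : ℂ) R).exists_bound_of_continuousOn hc.continuousOn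
  have h3 := h1.add (ENNReal.Tendsto.const_mul (a := ENNReal.ofReal C) h2
    (Or.inr ENNReal.ofReal_ne_top))
  rw [mul_zero, add_zero] at h3
  refine tendsto_of_tendsto_of_tendsto_of_le_of_le tendsto_const_nhds h3 (fun _ => zero_le)
    fun n => ?_
  have h4 : (fun x => (d n x - Complex.I * b * (p x : ℂ) * a n x)
      - (w x - Complex.I * b * (p x : ℂ) * u x))
      = (d n - w) - fun x => Complex.I * b * (p x : ℂ) * (a n - u) x := by
    ext x
    simp only [Pi.sub_apply]
    ring
  rw [h4]
  refine (eLpNorm_sub_le ((hd n).sub hw).1 (MemLp.bounded_mul_disk hp ((ha n).sub hu)).1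
    (by norm_num)).trans (add_le_add le_rfl ?_)
  refine eLpNorm_le_mul_eLpNorm_of_ae_le_mul ?_ 2
  filter_upwards [ae_restrict_mem measurableSet_ball] with x hx
  rw [norm_mul]
  exact mul_le_mul_of_nonneg_right (hC x (Metric.ball_subset_closedBall hx)) (norm_nonneg _)

/-- A lower bound for the form on smooth functions extends to `H¹`. -/
theorem le_form_of_le_smoothForm (hR : 0 < R)
    (h : ∀ φ, ContDiff ℝ ∞ φ → μ * ∫ x, ‖φ x‖ ^ 2 ∂(diskMeasure R) ≤ smoothForm β b R φ)
    (hu : MemH1 R u) : μ * ∫ x, ‖u x‖ ^ 2 ∂(diskMeasure R) ≤ form β b R u := by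
  -- The sequence that defines the trace converges in `H¹` and on the boundary simultaneously, so
  -- every term of the inequality passes to the limit.
  obtain ⟨hg, φ, hφ, t0, t1, t2, t3⟩ := hu.isTrace_trace hR
  have m0 : ∀ n, MemLp (φ n) 2 (diskMeasure R) := fun n =>
    memLp_diskMeasure_of_continuous (hφ n).continuous
  have md1 : ∀ n, MemLp (fun x => fderiv ℝ (φ n) x 1) 2 (diskMeasure R) := fun n =>
    memLp_diskMeasure_of_continuous (continuous_testFun (hφ n) 1)
  have md2 : ∀ n, MemLp (fun x => fderiv ℝ (φ n) x Complex.I) 2 (diskMeasure R) := fun n =>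
    memLp_diskMeasure_of_continuous (continuous_testFun (hφ n) Complex.I)
  have g1 : ∀ n, MemLp (magGrad1 b (φ n)) 2 (diskMeasure R) := fun n =>
    memLp_diskMeasure_of_continuous (continuous_magGrad1 (hφ n))
  have g2 : ∀ n, MemLp (magGrad2 b (φ n)) 2 (diskMeasure R) := fun n =>
    memLp_diskMeasure_of_continuous (continuous_magGrad2 (hφ n))
  have g3 : ∀ n, MemLp (fun θ => φ n (circleMap 0 R θ)) 2 angleMeasure := fun n =>
    memLp_angleMeasure_of_continuous ((hφ n).continuous.comp (continuous_circleMap 0 R))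
  have s0 := tendsto_integral_norm_sq m0 hu.1 t0
  have s1 := tendsto_integral_norm_sq g1 (hu.memLp_magD1 b)
    (tendsto_eLpNorm_sub_bounded_mul (p := fun x => -x.im / 2) (by fun_prop) m0 md1 hu.1
      hu.weakDeriv_one.1 t1 t0)
  have s2 := tendsto_integral_norm_sq g2 (hu.memLp_magD2 b)
    (tendsto_eLpNorm_sub_bounded_mul (p := fun x => x.re / 2) (by fun_prop) m0 md2 hu.1
      hu.weakDeriv_I.1 t2 t0)
  have s3 := tendsto_integral_norm_sq g3 hg t3
  rw [hu.form_eq]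
  refine le_of_tendsto_of_tendsto' (s0.const_mul μ) ((s1.add s2).add (s3.const_mul (β * R)))
    fun n => ?_
  refine (h _ (hφ n)).trans_eq ?_
  rw [smoothForm, integral_add ((g1 n).integrable_norm_pow (by simp))
    ((g2 n).integrable_norm_pow (by simp)), integral_mul_const]
  ring

/-- A minimizer of the Rayleigh quotient gives the lowest eigenvalue of the magnetic Robin
Laplacian. -/
theorem disk_isLeast (hR : 0 < R) (hlow : ∀ v, MemH1 R v →
      μ * ∫ x, ‖v x‖ ^ 2 ∂(diskMeasure R) ≤ form β b R v)
    (hu : MemH1 R u) (hu0 : ¬ u =ᵐ[diskMeasure R] 0)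
    (heq : form β b R u = μ * ∫ x, ‖u x‖ ^ 2 ∂(diskMeasure R)) :
    IsEigenfunction β b R μ u ∧ IsLeast (eigenvalues β b R) μ ∧ lambda1 β b R = μ := by
  have hu1 : IsEigenfunction β b R μ u := by
    refine ⟨hu0, hu, hu.1.const_smul (μ : ℂ), fun v hv => ?_⟩
    -- As for the fibers: `u` is a null vector of the nonnegative form obtained by subtracting `μ`
    -- times the squared norm.
    have key : sesqForm β b R u v - μ * ∫ x, u x * conj (v x) ∂(diskMeasure R) = 0 := by
      refine eq_zero_of_forall_nonneg (q := form β b R v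
        - μ * ∫ x, ‖v x‖ ^ 2 ∂(diskMeasure R)) fun c => ?_
      have h1 := hlow _ (hu.add_smul hv c)
      rw [form_add_smul hR hu hv, heq] at h1
      simp only [Pi.add_apply, Pi.smul_apply, smul_eq_mul] at h1
      rw [integral_norm_add_mul_sq hu.1 hv.1] at h1
      rw [mul_sub, Complex.sub_re, show conj c * (μ * ∫ x, u x * conj (v x) ∂(diskMeasure R))
        = μ * (conj c * ∫ x, u x * conj (v x) ∂(diskMeasure R)) by ring, Complex.re_ofReal_mul]
      linarith
    rw [sub_eq_zero.1 key, ← integral_const_mul]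
    simp only [mul_assoc]
  refine ⟨hu1, ⟨⟨u, hu1⟩, ?_⟩, ?_⟩
  · rintro lam ⟨v, hv0, hv, -, hop⟩
    have h1 := hop v hv
    rw [sesqForm_self hv] at h1
    simp only [mul_assoc, Complex.mul_conj'] at h1
    rw [integral_const_mul] at h1
    have h2 : form β b R v = lam * ∫ x, ‖v x‖ ^ 2 ∂(diskMeasure R) := by
      have h3 : (∫ x, (‖v x‖ : ℂ) ^ 2 ∂(diskMeasure R))
          = ((∫ x, ‖v x‖ ^ 2 ∂(diskMeasure R) : ℝ) : ℂ) := by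
        rw [← integral_complex_ofReal]; push_cast; rfl
      rw [h3] at h1
      exact_mod_cast h1
    have h3 := hlow v hv
    rw [h2] at h3
    exact le_of_mul_le_mul_right h3 (integral_norm_sq_pos hv.1 hv0)
  · refine IsLeast.csInf_eq ⟨⟨u, hu, hu0, ?_⟩, ?_⟩
    · rw [heq, mul_div_cancel_right₀ _ (integral_norm_sq_pos hu.1 hu0).ne']
    · rintro t ⟨v, hv, hv0, rfl⟩
      rw [le_div_iff₀ (integral_norm_sq_pos hv.1 hv0)]
      exact hlow v hv

end Form

/-! ### Localization of the optimal angular momentum -/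

/-- Fibers whose angular momentum lies outside `[0, b R²]` lie above the fiber of angular
momentum zero. -/
lemma fiberForm_zero_le {β b R : ℝ} {k : ℤ} {f : ℝ → ℂ} (hb : 0 ≤ b)
    (hk : k ≤ 0 ∨ b * R ^ 2 ≤ k) (h0 : MemFiberDom 0 R f) (h : MemFiberDom k R f) :
    fiberForm β b 0 R f ≤ fiberForm β b k R f := by
  rw [fiberForm_eq, fiberForm_eq]
  refine add_le_add (integral_mono_ae
    ((h.2.2.1.integrable_norm_pow (by simp)).add ((h0.memLp_fiberPot b).integrable_norm_pow (by simp)))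
    ((h.2.2.1.integrable_norm_pow (by simp)).add ((h.memLp_fiberPot b).integrable_norm_pow (by simp)))
    ?_) le_rfl
  filter_upwards [ae_radialMeasure_mem R] with r hr
  simp only [norm_fiberPot_sq hr.1.ne']
  have h1 : ((0 : ℤ) - b * r ^ 2 / 2) ^ 2 ≤ ((k : ℝ) - b * r ^ 2 / 2) ^ 2 := by
    have h2 : 0 ≤ b * r ^ 2 := by positivity
    have h3 : b * r ^ 2 ≤ b * R ^ 2 := by have := hr.1; have := hr.2; gcongr
    -- This product is exactly the difference of the two squares.
    have h4 : 0 ≤ (k : ℝ) * (k - b * r ^ 2) := by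
      rcases hk with hk | hk
      · have : (k : ℝ) ≤ 0 := by exact_mod_cast hk
        nlinarith
      · exact mul_nonneg (by linarith) (by linarith)
    push_cast
    nlinarith
  gcongr

end MagneticRobin

end

/-! ### The optimal angular momentum and the radial ground state -/

open MagneticRobin in
theorem proposition2p2 (β b R : ℝ) (hβ : β ≤ 0) (hb : 0 ≤ b) (hR : 0 < R) :
    IsLeast (MagneticRobin.eigenvalues β b R) (MagneticRobin.lambda1 β b R) ∧
    (∃ m : ℤ, |(m : ℝ)| ≤ b * R ^ 2 ∧
      IsLeast (MagneticRobin.fiberEigenvalues β b m R) (MagneticRobin.mu1 β b m R) ∧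
      MagneticRobin.lambda1 β b R = MagneticRobin.mu1 β b m R) ∧
    (b * R ^ 2 < 1 →
      ∃ f : ℝ → ℂ, MagneticRobin.IsEigenfunction β b R (MagneticRobin.lambda1 β b R)
        (fun x => f ‖x‖)) := by
  choose μ G hG hGpos hlow heq using exists_fiber_ground_state hR β b
  -- Only the fibers `0, …, N` can be optimal; `m` is a minimizer of the ground energy among them.
  set N := ⌊b * R ^ 2⌋₊ with hN
  have hbR : 0 ≤ b * R ^ 2 := by positivity
  obtain ⟨m, hm, hmin⟩ := (Finset.range (N + 1)).exists_min_image μ ⟨0, by simp⟩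
  have hmN : m ≤ N := by have := Finset.mem_range.1 hm; omega
  have hmle : (m : ℝ) ≤ b * R ^ 2 := (Nat.cast_le.2 hmN).trans (Nat.floor_le hbR)
  have hfiber : ∀ (k : ℤ) (f : ℝ → ℂ), MemFiberDom k R f → MemFiberDom 0 R f →
      μ m * ∫ r, ‖f r‖ ^ 2 ∂(radialMeasure R) ≤ fiberForm β b k R f := by
    intro k f hk h0
    have hI : 0 ≤ ∫ r, ‖f r‖ ^ 2 ∂(radialMeasure R) := integral_nonneg fun r => by positivity
    have hle : ∀ n : ℕ, n ≤ N → MemFiberDom n R f →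
        μ m * ∫ r, ‖f r‖ ^ 2 ∂(radialMeasure R) ≤ fiberForm β b n R f := fun n hn hf =>
      (mul_le_mul_of_nonneg_right (hmin n (Finset.mem_range.2 (by omega))) hI).trans (hlow n f hf)
    by_cases hcase : 0 ≤ k ∧ k ≤ N
    · lift k to ℕ using hcase.1
      exact hle k (by exact_mod_cast hcase.2) hk
    -- The remaining modes are negative or at least `N + 1 > b R²`, so they are compared with the
    -- zero fiber, which is among the candidates.
    · refine (hle 0 (Nat.zero_le _) (by simpa using h0)).trans ?_
      rw [Nat.cast_zero]
      refine fiberForm_zero_le hb ?_ h0 hk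
      rcases le_or_gt k 0 with h | h
      · exact Or.inl h
      · refine Or.inr ?_
        have h1 : ((N : ℤ) + 1) ≤ k := by omega
        have h2 : ((N : ℝ) + 1) ≤ k := by exact_mod_cast h1
        exact (Nat.lt_floor_add_one (b * R ^ 2)).le.trans h2
  have hdisk : ∀ v, MemH1 R v → μ m * ∫ x, ‖v x‖ ^ 2 ∂(diskMeasure R) ≤ form β b R v :=
    fun v hv => le_form_of_le_smoothForm hR (fun φ hφ => le_smoothForm hφ hfiber) hv
  have hf0 : ¬ (fun r => (radialFun m (G m) r : ℂ)) =ᵐ[radialMeasure R] 0 := by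
    refine not_ae_eq_zero_of_forall_ne hR fun r hr => ?_
    have h1 := hr.1
    have h2 : r ≤ R := hr.2.le
    have h3 := hGpos m (r ^ 2) ⟨by positivity, by gcongr⟩
    rw [radialFun]
    exact_mod_cast (mul_pos (pow_pos h1 m) h3).ne'
  have hdom := memFiberDom_radialFun m (R := R) (hG m)
  obtain ⟨hev, hmu⟩ := fiber_isLeast (hlow m) hdom hf0 (heq m)
  have hpos := integral_norm_sq_pos hdom.2.1 hf0
  have hu := contDiff_planarFun (m := m) (hG m)
  -- The planar norm is `2π` times the norm of the fiber ground state, which is positive.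
  have hu0 : ¬ planarFun m (G m) =ᵐ[diskMeasure R] 0 := by
    intro h0
    have h1 : ∫ x, ‖planarFun m (G m) x‖ ^ 2 ∂(diskMeasure R) = 0 := by
      rw [← integral_zero ℂ ℝ (μ := diskMeasure R)]
      refine integral_congr_ae ?_
      filter_upwards [h0] with x hx
      simp [hx]
    rw [integral_norm_planarFun (hG m)] at h1
    exact (mul_pos Real.two_pi_pos hpos).ne' h1
  have hform : form β b R (planarFun m (G m))
      = μ m * ∫ x, ‖planarFun m (G m) x‖ ^ 2 ∂(diskMeasure R) := by
    rw [form_of_contDiff hR hu, smoothForm_planarFun (hG m), heq m, integral_norm_planarFun (hG m)]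
    ring
  obtain ⟨heig, hleast, hlam⟩ := disk_isLeast hR hdisk (memH1_of_contDiff hu) hu0 hform
  rw [hlam]
  refine ⟨hleast, ⟨m, ?_, hmu.symm ▸ hev, hmu.symm⟩, fun hlt => ?_⟩
  · rw [Int.cast_natCast, Nat.abs_cast]
    exact hmle
  -- The optimal `m` is a natural number below `1`, and `planarFun 0 G` depends only on `‖x‖`.
  · have hm0 : m = 0 := by
      have : (m : ℝ) < 1 := hmle.trans_lt hlt
      exact Nat.lt_one_iff.1 (by exact_mod_cast this)
    refine ⟨fun r => (G m (r ^ 2) : ℂ), ?_⟩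
    convert heig using 1
    ext x
    rw [planarFun, hm0, pow_zero, one_mul]
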